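/- A front in $\mathbb{RP}^3$ is the image of an immersed Legendrian surface $L$ of $PT^*\mathbb{RP}^3$ (pairs: point, plane through it) under the projection to points; its dual front $S^\vee$ is the image of $L$ under the projection to planes. Let $S$ be a front in general position and $s$ a swallowtail point of $S$: near $s$, $S$ is locally diffeomorphic to the standard swallowtail, and $S^\vee$ is a smooth surface near the corresponding point $g=s^\vee$ (no parabolic curve passes through $s$). On $S$ near $s$, let $\Sigma$ be the cuspidal edge, $D^\vee$ the self-intersection line, and $F$ the flecnodal curve (closure of the regular points at which some tangent line has at least $4$-point contact with $S$). The corresponding curves of $S^\vee$ at $g$ are the parabolic curve $P$, the conodal curve $D$ (closure of the points of contact of bitangent planes) and the flecnodal curve. They are smooth and mutually tangent at $g$, so their Legendrian lifts to the contact elements of $S^\vee$ are tangent to one contact plane $\Pi$. The cr-invariant is the cross-ratio $\rho=\rho(s)=(\ell_F,\ell_P,\ell_D,\ell_g)$ of the tangent lines in $\Pi$ of the lifts of $F,P,D$ and of the fibre over $g$, where $(\ell_1,\ell_2,\ell_3,\ell_4)=\frac{k_1-k_3}{k_2-k_3}$ if the lines have slopes $k_1,k_2,k_3,\infty$. The swallowtail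 is elliptic (hyperbolic) if $D^\vee\smallsetminus\{s\}$ lies, near $s$, in the elliptic (hyperbolic) domain of $S$. The local $s$-contour is the germ at $s$ of the set of points of $S$ whose tangent plane passes through $s$. Separation and order of curves near $s$ are understood on the Legendrian surface $L$ (equivalently, on the smooth surface $S^\vee$). Theorem. The number $\rho$ is well defined and $\rho\ne1$; $s$ is elliptic iff $\rho>1$ and hyperbolic iff $\rho<1$; and every $\rho\neq1$ occurs. The curve $\Sigma$ has a semicubic cusp at $s$. If $\rho\neq-\frac12$, then $F$ has a cusp at $s$ with the same tangent line as $\Sigma$ (semicubic if also $\rho\ne0$), pointing in the same direction as $\Sigma$ if $\rho>-\frac12$ and in the opposite direction if $\rho<-\frac12$. (e) The local $s$-contour is trivial (just the point $s$) if and only if $s$ is elliptic ($\rho>1$). In that case $\Sigma$ separates $D^\vee$ from $F$. (h) If $s$ is hyperbolic ($\rho<1$), the local $s$-contour consists of two cusps $T_-^\vee$, $T_+^\vee$ pointing in opposite directions, $T_-^\vee$ in the same direction as $\Sigma$; $T_+^\vee$ is semicubic, and so is $T_-^\vee$ if $\rho\neq0$. Near $s$ the five curves lie in the following order, each curve separating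 the preceding ones from the following ones: ($h_{1,1}$) $\rho\in(\frac89,1)$: $T_-^\vee,\Sigma,F,D^\vee,T_+^\vee$, and $T_-^\vee\smallsetminus\{s\}$ lies in the elliptic domain; ($h_{1,2}$) $\rho\in(\frac{\sqrt3}2,\frac89)$: $\Sigma,T_-^\vee,F,D^\vee,T_+^\vee$; ($h_{1,3}$) $\rho\in(0,\frac{\sqrt3}2)$: $\Sigma,F,T_-^\vee,D^\vee,T_+^\vee$; ($h_2$) $\rho\in(-\frac12,0)$: $\Sigma,D^\vee,T_-^\vee,F,T_+^\vee$; ($h_{3,1}$) $\rho\in(-\frac{\sqrt3}2,-\frac12)$: $\Sigma,D^\vee,T_-^\vee,F,T_+^\vee$ (here, unlike in $h_2$, the cusps of $F$ and $\Sigma$ point in opposite directions); ($h_{3,2}$) $\rho\in(-\infty,-\frac{\sqrt3}2)$: $\Sigma,D^\vee,T_-^\vee,T_+^\vee,F$. -/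

import Mathlib

open Filter Topology
open scoped ContDiff Matrix

noncomputable section

/-- Two nonzero vectors of `ℝ⁴` that are homogeneous coordinates of the same point of `ℝP³`
(or, read as covectors, of the same plane). -/
def ProjEq (x y : Fin 4 → ℝ) : Prop := ∃ c : ℝ, c ≠ 0 ∧ y = c • x

/-- A germ of smooth map at `x`: a map that is smooth on a neighbourhood of `x`. -/
def SmoothNear {E F : Type*} [NormedAddCommGroup E] [NormedSpace ℝ E]
    [NormedAddCommGroup F] [NormedSpace ℝ F] (f : E → F) (x : E) : Prop :=
  ∀ᶠ y in 𝓝 x, ContDiffAt ℝ ∞ f y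

/-- A (piece of a) front of `ℝP³`, presented by an immersed Legendrian surface of the space
`PT*ℝP³` of contact elements: a parameter `u` in an open set of the plane is sent to the contact
element formed by the point with homogeneous coordinates `point u` and by the plane
`{x | plane u ⬝ᵥ x = 0}`. The front is the image of `point`; `plane u` is its tangent plane at
`point u`. -/
structure Front where
  dom : Set (ℝ × ℝ)
  point : ℝ × ℝ → Fin 4 → ℝ
  plane : ℝ × ℝ → Fin 4 → ℝ
  isOpen_dom : IsOpen dom
  smooth_point : ContDiffOn ℝ ∞ point dom
  smooth_plane : ContDiffOn ℝ ∞ plane dom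
  point_ne : ∀ u ∈ dom, point u ≠ 0
  plane_ne : ∀ u ∈ dom, plane u ≠ 0
  /-- the point lies in the plane -/
  incident : ∀ u ∈ dom, plane u ⬝ᵥ point u = 0
  /-- the Legendre condition -/
  legendrian : ∀ u ∈ dom, ∀ v, plane u ⬝ᵥ fderiv ℝ point u v = 0
  /-- the map `u ↦ ([point u], [plane u])` is an immersion -/
  immersed : ∀ u ∈ dom, ∀ v, (∃ a : ℝ, fderiv ℝ point u v = a • point u) →
    (∃ b : ℝ, fderiv ℝ plane u v = b • plane u) → v = 0

namespace Front

theorem dual_legendrian (S : Front) (u : ℝ × ℝ) (hu : u ∈ S.dom) (v : ℝ × ℝ) :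
    S.point u ⬝ᵥ fderiv ℝ S.plane u v = 0 := by
  have hn : S.dom ∈ 𝓝 u := S.isOpen_dom.mem_nhds hu
  have hp : HasFDerivAt S.point (fderiv ℝ S.point u) u :=
    ((S.smooth_point.contDiffAt hn).differentiableAt (by simp)).hasFDerivAt
  have hl : HasFDerivAt S.plane (fderiv ℝ S.plane u) u :=
    ((S.smooth_plane.contDiffAt hn).differentiableAt (by simp)).hasFDerivAt
  have h1 := HasFDerivAt.fun_sum (u := Finset.univ)
    (fun (i : Fin 4) _ => (hasFDerivAt_pi'.1 hl i).mul (hasFDerivAt_pi'.1 hp i))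
  have h2 : HasFDerivAt (fun x => ∑ i : Fin 4, S.plane x i * S.point x i)
      (0 : ℝ × ℝ →L[ℝ] ℝ) u := by
    refine (hasFDerivAt_const (0 : ℝ) u).congr_of_eventuallyEq ?_
    filter_upwards [hn] with x hx
    exact S.incident x hx
  have h3 := congrArg (fun L : ℝ × ℝ →L[ℝ] ℝ => L v) (h1.unique h2)
  have h4 := S.legendrian u hu v
  simp only [dotProduct, Fin.sum_univ_four] at h4 ⊢
  simp [Fin.sum_univ_four] at h3
  linarith

/-- The dual front, in the dual projective space: the roles of points and planes are exchanged. -/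
def dual (S : Front) : Front where
  dom := S.dom
  point := S.plane
  plane := S.point
  isOpen_dom := S.isOpen_dom
  smooth_point := S.smooth_plane
  smooth_plane := S.smooth_point
  point_ne := S.plane_ne
  plane_ne := S.point_ne
  incident := fun u hu => by rw [dotProduct_comm]; exact S.incident u hu
  legendrian := S.dual_legendrian
  immersed := fun u hu v h1 h2 => S.immersed u hu v h2 h1

/-- A smaller piece of a front. -/
def restrict (S : Front) (V : Set (ℝ × ℝ)) (hV : IsOpen V) : Front where
  dom := S.dom ∩ V
  point := S.point
  plane := S.plane
  isOpen_dom := S.isOpen_dom.inter hV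
  smooth_point := S.smooth_point.mono Set.inter_subset_left
  smooth_plane := S.smooth_plane.mono Set.inter_subset_left
  point_ne := fun u hu => S.point_ne u hu.1
  plane_ne := fun u hu => S.plane_ne u hu.1
  incident := fun u hu => S.incident u hu.1
  legendrian := fun u hu => S.legendrian u hu.1
  immersed := fun u hu => S.immersed u hu.1

/-! ### Points of a front -/

/-- The front is a smooth immersed surface of `ℝP³` at this parameter. -/
def IsRegular (S : Front) (u : ℝ × ℝ) : Prop :=
  u ∈ S.dom ∧ ∀ v, (∃ a : ℝ, fderiv ℝ S.point u v = a • S.point u) → v = 0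

/-- The second fundamental form (up to a nonzero factor): its isotropic vectors at a regular point
are the asymptotic directions. -/
def secondForm (S : Front) (u v w : ℝ × ℝ) : ℝ :=
  S.plane u ⬝ᵥ fderiv ℝ (fderiv ℝ S.point) u v w

/-- Determinant of the second fundamental form (its sign is that of the Gaussian curvature). -/
def disc (S : Front) (u : ℝ × ℝ) : ℝ :=
  S.secondForm u (1, 0) (1, 0) * S.secondForm u (0, 1) (0, 1) - S.secondForm u (1, 0) (0, 1) ^ 2

def IsElliptic (S : Front) (u : ℝ × ℝ) : Prop := S.IsRegular u ∧ 0 < S.disc u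

def IsHyperbolic (S : Front) (u : ℝ × ℝ) : Prop := S.IsRegular u ∧ S.disc u < 0

def IsParabolic (S : Front) (u : ℝ × ℝ) : Prop := S.IsRegular u ∧ S.disc u = 0

/-- A regular point at which some line exceeds 3-point contact with the surface: a regular curve
of the surface through that point has at least 4-point contact with the line `ℙ(W)`. -/
def IsFlecnodal (S : Front) (u : ℝ × ℝ) : Prop :=
  S.IsRegular u ∧ ∃ γ : ℝ → ℝ × ℝ, SmoothNear γ 0 ∧ γ 0 = u ∧ deriv γ 0 ≠ 0 ∧
    ∃ W : Submodule ℝ (Fin 4 → ℝ), Module.finrank ℝ W = 2 ∧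
      ∀ i ≤ 3, iteratedDeriv i (fun t => S.point (γ t)) 0 ∈ W

/-! ### Curves of a front (as sets of parameters, that is, on the Legendrian surface) -/

def parabolicCurve (S : Front) : Set (ℝ × ℝ) := {u | S.IsParabolic u}

def flecnodalCurve (S : Front) : Set (ℝ × ℝ) := closure {u | S.IsFlecnodal u}

/-- Closure of the locus of points of contact of the surface with its bitangent planes. -/
def conodalCurve (S : Front) : Set (ℝ × ℝ) :=
  closure {u | u ∈ S.dom ∧ ∃ u' ∈ S.dom, ¬ ProjEq (S.point u) (S.point u') ∧
    ProjEq (S.plane u) (S.plane u')}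

/-- The singular points of the front; near a swallowtail they form the cuspidal edge (together
with the swallowtail point). -/
def cuspidalEdge (S : Front) : Set (ℝ × ℝ) := {u | u ∈ S.dom ∧ ¬ S.IsRegular u}

/-- The self-intersection line. -/
def selfIntersection (S : Front) : Set (ℝ × ℝ) :=
  closure {u | u ∈ S.dom ∧ ∃ u' ∈ S.dom, u' ≠ u ∧ ProjEq (S.point u) (S.point u')}

/-- The contour from the point `s`: points of tangency of the tangent planes through `s`. -/
def contour (S : Front) (s : ℝ × ℝ) : Set (ℝ × ℝ) :=
  {u | u ∈ S.dom ∧ S.plane u ⬝ᵥ S.point s = 0}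

/-- The germ of the contour at `s` consists just of `s`. -/
def ContourTrivial (S : Front) (s : ℝ × ℝ) : Prop :=
  ∀ᶠ u in 𝓝 s, u ∈ S.contour s ↔ u = s

end Front

/-- `α` is a regular smooth parametrization of the germ at `s` of the set `A`. -/
def ParametrizesAt (α : ℝ → ℝ × ℝ) (A : Set (ℝ × ℝ)) (s : ℝ × ℝ) : Prop :=
  SmoothNear α 0 ∧ α 0 = s ∧ deriv α 0 ≠ 0 ∧
    ∀ᶠ ε in 𝓝[>] (0 : ℝ), ∀ᶠ u in 𝓝 s, u ∈ A ↔ u ∈ α '' Set.Ioo (-ε) ε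

/-! ### The cr-invariant of a godron -/

def cross (v w : ℝ × ℝ) : ℝ := v.1 * w.2 - v.2 * w.1

/-- The cross-ratio of the lines of the plane spanned by `a`, `b`, `c`, `d`, normalized so that
the lines of slopes `x`, `y`, `0`, `∞` have cross-ratio `x / y`. -/
def crossRatio (a b c d : ℝ × ℝ) : ℝ :=
  (cross a c * cross b d) / (cross b c * cross a d)

/-- The Legendrian curve of contact elements tangent to the plane curve `α`. The contact element
of direction `v` at a point is represented in the affine chart of `ℝP¹` centred at the direction
`e`, by its slope `cross e v / ⟨e, v⟩`. -/
def contactLift (e : ℝ × ℝ) (α : ℝ → ℝ × ℝ) (t : ℝ) : (ℝ × ℝ) × ℝ :=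
  (α t, cross e (deriv α t) / (e.1 * (deriv α t).1 + e.2 * (deriv α t).2))

/-- The surface has at `g` a godron (a parabolic point whose asymptotic direction `e` is tangent
to the parabolic curve) with cr-invariant `ρ`. The curves `F`, `P`, `D` are regular at `g` and
tangent to `e`. The tangent vectors of their Legendrian lifts lie in the contact plane, which is
`{(a • e, b)}` and has coordinates `(a, b)`; there the fibre over `g` has direction `(0, 1)`. -/
def Front.HasCrInvariant (S : Front) (g : ℝ × ℝ) (ρ : ℝ) : Prop :=
  S.IsParabolic g ∧ ∃ e : ℝ × ℝ, e ≠ 0 ∧ S.secondForm g e e = 0 ∧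
    ∃ αF αP αD : ℝ → ℝ × ℝ, ∃ lF lP lD : ℝ × ℝ,
      ParametrizesAt αF S.flecnodalCurve g ∧
      ParametrizesAt αP S.parabolicCurve g ∧
      ParametrizesAt αD S.conodalCurve g ∧
      HasDerivAt (contactLift e αF) (lF.1 • e, lF.2) 0 ∧
      HasDerivAt (contactLift e αP) (lP.1 • e, lP.2) 0 ∧
      HasDerivAt (contactLift e αD) (lD.1 • e, lD.2) 0 ∧
      cross lP lD ≠ 0 ∧ ρ = crossRatio lF lP lD (0, 1)

/-! ### Swallowtails -/

/-- The standard swallowtail: `x⁴ + a x² + b x + c` has the multiple root `t` when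
`(a, b, c)` is the value at `(t, a)`. -/
def standardSwallowtail (q : ℝ × ℝ) : Fin 3 → ℝ :=
  ![q.2, -4 * q.1 ^ 3 - 2 * q.2 * q.1, 3 * q.1 ^ 4 + q.2 * q.1 ^ 2]

namespace Front

/-- The front is locally diffeomorphic to the standard swallowtail: `h` is a local diffeomorphism
of the source and `[Ψ]` one from `ℝ³` to `ℝP³`. -/
def IsSwallowtail (S : Front) (s : ℝ × ℝ) : Prop :=
  s ∈ S.dom ∧ ∃ (h : ℝ × ℝ → ℝ × ℝ) (Ψ : (Fin 3 → ℝ) → Fin 4 → ℝ),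
    SmoothNear h s ∧ h s = 0 ∧ (∀ v, fderiv ℝ h s v = 0 → v = 0) ∧
    SmoothNear Ψ 0 ∧ Ψ 0 ≠ 0 ∧ (∀ w, (∃ a : ℝ, fderiv ℝ Ψ 0 w = a • Ψ 0) → w = 0) ∧
    ∀ᶠ u in 𝓝 s, ProjEq (S.point u) (Ψ (standardSwallowtail (h u)))

/-- A swallowtail of a front in general position: the parabolic curve (along which the dual front
is singular) does not pass through it. -/
def IsGenericSwallowtail (S : Front) (s : ℝ × ℝ) : Prop :=
  S.IsSwallowtail s ∧ S.dual.IsRegular s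

/-- Locally, the self-intersection line lies in the elliptic domain. -/
def IsEllipticSwallowtail (S : Front) (s : ℝ × ℝ) : Prop :=
  ∀ᶠ u in 𝓝 s, u ∈ S.selfIntersection → u ≠ s → S.IsElliptic u

/-- Locally, the self-intersection line lies in the hyperbolic domain. -/
def IsHyperbolicSwallowtail (S : Front) (s : ℝ × ℝ) : Prop :=
  ∀ᶠ u in 𝓝 s, u ∈ S.selfIntersection → u ≠ s → S.IsHyperbolic u

/-! ### Cusps in `ℝP³`

The tangent space of `ℝP³` at `[x]` is `ℝ⁴ / ℝx` once the vector `x` is fixed. -/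

/-- The curve `[point ∘ α]` has velocity zero and nonzero acceleration at `t = 0`. -/
def IsCusp (S : Front) (α : ℝ → ℝ × ℝ) : Prop :=
  (∃ a : ℝ, deriv (fun t => S.point (α t)) 0 = a • S.point (α 0)) ∧
    LinearIndependent ℝ ![S.point (α 0), iteratedDeriv 2 (fun t => S.point (α t)) 0]

/-- The curve `[point ∘ α]` has velocity zero and linearly independent second and third
derivatives at `t = 0`. -/
def IsSemicubicCusp (S : Front) (α : ℝ → ℝ × ℝ) : Prop :=
  (∃ a : ℝ, deriv (fun t => S.point (α t)) 0 = a • S.point (α 0)) ∧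
    LinearIndependent ℝ ![S.point (α 0), iteratedDeriv 2 (fun t => S.point (α t)) 0,
      iteratedDeriv 3 (fun t => S.point (α t)) 0]

/-- Two cusps at the same point have the same tangent line and point in the same direction. -/
def SameDirection (S : Front) (α β : ℝ → ℝ × ℝ) : Prop :=
  ∃ k a : ℝ, 0 < k ∧ iteratedDeriv 2 (fun t => S.point (α t)) 0 =
    k • iteratedDeriv 2 (fun t => S.point (β t)) 0 + a • S.point (β 0)

/-- Two cusps at the same point have the same tangent line and point in opposite directions. -/
def OppositeDirection (S : Front) (α β : ℝ → ℝ × ℝ) : Prop :=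
  ∃ k a : ℝ, k < 0 ∧ iteratedDeriv 2 (fun t => S.point (α t)) 0 =
    k • iteratedDeriv 2 (fun t => S.point (β t)) 0 + a • S.point (β 0)

end Front

/-! ### Relative position of curves -/

/-- Near `s`, the set `A` separates `B` from `C` (the point `s` excepted). -/
def SeparatesAt (s : ℝ × ℝ) (A B C : Set (ℝ × ℝ)) : Prop :=
  ∃ N ∈ 𝓝 s, ∃ O₁ O₂ : Set (ℝ × ℝ), IsOpen O₁ ∧ IsOpen O₂ ∧ Disjoint O₁ O₂ ∧
    N \ A ⊆ O₁ ∪ O₂ ∧ (B ∩ N) \ {s} ⊆ O₁ ∧ (C ∩ N) \ {s} ⊆ O₂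

/-- The curves of the list are met in this order (or in the reverse order) on crossing them near
`s`: each one separates the preceding ones from the following ones. -/
def OrderedAt (s : ℝ × ℝ) {n : ℕ} (A : Fin n → Set (ℝ × ℝ)) : Prop :=
  ∀ i j k, i < j → j < k → SeparatesAt s (A j) (A i) (A k)

end

/-! ### Smooth germs and globally smooth functions -/

/-! Everything is read on the dual surface, which is smooth at `g`. In projective coordinates
adapted to `g` it is a graph z = f(x, y), and the front is the surface of its tangent planes, (f_x,
f_y, -1, f - x f_x - y f_y) (`Front.exists_isDualGraph`). If this map is a swallowtail, then f_xx,
f_xy and f_xxx vanish at the origin, a = f_yy and b = f_xxy do not, and a f_xxxx - 3b² = 12ab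
(`jet_of_swallowtail`). Rescaling y and z gives f = y²/2 - x²y + ρx⁴/2 + (higher weight), where x
has weight 1 and y weight 2; the relation becomes ρ ≠ 1
(`Front.IsGenericSwallowtail.exists_normal_form`).

In this chart every curve of the theorem has an equation y = kx² + ⋯, and k depends only on the
weighted leading part of f. The cuspidal edge, which is the parabolic curve of the dual, is the zero
set of the Hessian determinant: k = 3ρ - 2. The flecnodal curve consists of the points where the
quadratic and cubic forms of f have a common direction: k = 2ρ² - ρ. This works for front and dual
alike, because four-point contact of a line is self-dual (`Front.IsFlecnodal.dual`). The
self-intersection line, which is the conodal curve of the dual, joins pairs with equal tangent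
planes. Evenness under exchange of the two points gives k = ρ. The contour is f = 0, a quadratic
equation in y up to a unit, with k = 1 ∓ √(1 - ρ). It reduces to the origin when ρ > 1.

The rest is arithmetic with these coefficients. The slope of a Legendrian lift is affine in k, so
the cross-ratio is (k_D - k_F)/(k_D - k_P) = ρ (`crossRatio_contactLift`). Along y = kx² + ⋯ the
Hessian determinant is (6ρ - 4 - 2k)x² + ⋯, so a curve is elliptic if k < 3ρ - 2 and hyperbolic if k
> 3ρ - 2. The corresponding curve of the front has zero velocity and acceleration proportional to k
- 1, while its third derivative has a transverse component proportional to ρ - k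
(`IsGodronJet.deriv_graphPoint`). This decides which cusps are semicubic and where they point.
Finally, curves with distinct k are ordered as their coefficients (`IsGraphCurve.orderedAt`), and
with w = √(1 - ρ) the thresholds are the roots of the factored differences
(`Front.IsDualGraph.exists_cusps`).

Every ρ ≠ 1 is realized by the polynomial y²/2 - x²y + ρx⁴/2 itself. -/

theorem SmoothNear.exists_contDiff {E F : Type*} [NormedAddCommGroup E] [NormedSpace ℝ E]
    [FiniteDimensional ℝ E] [NormedAddCommGroup F] [NormedSpace ℝ F] {f : E → F} {x : E}
    (hf : SmoothNear f x) : ∃ g : E → F, ContDiff ℝ ∞ g ∧ g =ᶠ[𝓝 x] f := by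
  obtain ⟨r, hr, hball⟩ := Metric.eventually_nhds_iff_ball.1 hf
  -- The bump is supported in the closed ball of radius r/2. A point outside the ball of radius r
  -- therefore has a neighbourhood on which the product is zero, whatever `f` does there.
  let b : ContDiffBump x := ⟨r / 4, r / 2, by positivity, by linarith⟩
  refine ⟨fun y => b y • f y, ?_, ?_⟩
  · refine contDiff_iff_contDiffAt.2 fun y => ?_
    by_cases hy : y ∈ Metric.ball x r
    · exact b.contDiffAt.smul (hball y hy)
    · have hz : ∀ᶠ z in 𝓝 y, (fun z => b z • f z) z = (fun _ => (0 : F)) z := by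
        have : {z | r / 2 < dist z x} ∈ 𝓝 y :=
          (isOpen_lt continuous_const (continuous_id.dist continuous_const)).mem_nhds (by
            simp only [Metric.mem_ball, not_lt] at hy
            simp only [Set.mem_ofPred_eq, id]; linarith)
        filter_upwards [this] with z hz
        simp [b.zero_of_le_dist (le_of_lt hz)]
      exact contDiffAt_const.congr_of_eventuallyEq hz
  · filter_upwards [b.eventuallyEq_one] with y hy
    simp [hy]

theorem ContDiffOn.smoothNear {E F : Type*} [NormedAddCommGroup E] [NormedSpace ℝ E]
    [NormedAddCommGroup F] [NormedSpace ℝ F] {f : E → F} {s : Set E} {x : E}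
    (hf : ContDiffOn ℝ ∞ f s) (hs : IsOpen s) (hx : x ∈ s) : SmoothNear f x := by
  filter_upwards [hs.mem_nhds hx] with y hy
  exact hf.contDiffAt (hs.mem_nhds hy)

theorem SmoothNear.contDiffAt {E F : Type*} [NormedAddCommGroup E] [NormedSpace ℝ E]
    [NormedAddCommGroup F] [NormedSpace ℝ F] {f : E → F} {x : E}
    (hf : SmoothNear f x) : ContDiffAt ℝ ∞ f x := hf.self_of_nhds

theorem ContDiff.smoothNear {E F : Type*} [NormedAddCommGroup E] [NormedSpace ℝ E]
    [NormedAddCommGroup F] [NormedSpace ℝ F] {f : E → F} (hf : ContDiff ℝ ∞ f) (x : E) :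
    SmoothNear f x := Eventually.of_forall fun _ => hf.contDiffAt

/-- A globally smooth function that inverts a smooth map near a point. -/
theorem ContDiff.exists_local_inverse {E F : Type*} [NormedAddCommGroup E] [NormedSpace ℝ E]
    [FiniteDimensional ℝ E] [NormedAddCommGroup F] [NormedSpace ℝ F] [FiniteDimensional ℝ F]
    {f : E → F} (hf : ContDiff ℝ ∞ f) (a : E)
    (f' : E ≃L[ℝ] F) (hf' : fderiv ℝ f a = f') :
    ∃ g : F → E, ContDiff ℝ ∞ g ∧ g (f a) = a ∧ (∀ᶠ x in 𝓝 a, g (f x) = x) ∧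
      ∀ᶠ y in 𝓝 (f a), f (g y) = y := by
  have : CompleteSpace E := FiniteDimensional.complete ℝ E
  have hd : HasFDerivAt f (f' : E →L[ℝ] F) a := by
    rw [← hf']; exact (hf.differentiable (by simp) a).hasFDerivAt
  let e := hf.contDiffAt.toOpenPartialHomeomorph f hd (by simp)
  have hae : a ∈ e.source := hf.contDiffAt.mem_toOpenPartialHomeomorph_source hd (by simp)
  have hfe : f a ∈ e.target := hf.contDiffAt.image_mem_toOpenPartialHomeomorph_target hd (by simp)
  have hef : ∀ x, e x = f x := fun _ => rfl
  have hea : e.symm (f a) = a := by rw [← hef]; exact e.left_inv hae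
  have hsm : SmoothNear e.symm (f a) := by
    -- Invertibility of the derivative is an open condition, so the inverse is smooth on a whole
    -- neighbourhood and can be cut off to a global map.
    have h1 : ∀ᶠ x in 𝓝 a, fderiv ℝ f x ∈ Set.range ((↑) : (E ≃L[ℝ] F) → E →L[ℝ] F) :=
      (hf.continuous_fderiv (by simp)).continuousAt.eventually
        (by rw [hf']; exact f'.nhds)
    have h2 : Tendsto e.symm (𝓝 (f a)) (𝓝 a) := by
      have := e.continuousAt_symm hfe
      rwa [ContinuousAt, hea] at this
    filter_upwards [h2.eventually h1, e.open_target.mem_nhds hfe] with y ⟨g', hg'⟩ hy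
    refine e.contDiffAt_symm (f₀' := g') hy ?_ hf.contDiffAt
    rw [hg']
    exact (hf.differentiable (by simp) _).hasFDerivAt
  obtain ⟨g, hg, hge⟩ := hsm.exists_contDiff
  refine ⟨g, hg, ?_, ?_, ?_⟩
  · rw [hge.self_of_nhds, hea]
  · filter_upwards [hf.continuous.continuousAt.eventually hge, e.open_source.mem_nhds hae] with x h hx
    rw [h, ← hef, e.left_inv hx]
  · filter_upwards [hge, e.open_target.mem_nhds hfe] with y h hy
    rw [h, ← hef, e.right_inv hy]

/-! ### Integrals depending smoothly on a parameter, and Hadamard's lemma -/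

/-- Differentiation under the integral sign. The dominating constant is the maximum of the partial
derivative over the compact set (closed unit ball around `p`) × [0, 1]. -/
theorem hasFDerivAt_intervalIntegral_of_contDiff {E H : Type} [NormedAddCommGroup E]
    [NormedSpace ℝ E] [FiniteDimensional ℝ E] [NormedAddCommGroup H] [NormedSpace ℝ H]
    [CompleteSpace H] (Φ : E × ℝ → H) (hΦ : ContDiff ℝ ∞ Φ) (p : E) :
    HasFDerivAt (fun p => ∫ s in (0 : ℝ)..1, Φ (p, s))
      (∫ s in (0 : ℝ)..1, (fderiv ℝ Φ (p, s)).comp (ContinuousLinearMap.inl ℝ E ℝ)) p := by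
  have : ProperSpace E := FiniteDimensional.proper ℝ E
  have hc : Continuous fun q : E × ℝ => (fderiv ℝ Φ q).comp (ContinuousLinearMap.inl ℝ E ℝ) :=
    (hΦ.continuous_fderiv (by simp)).clm_comp continuous_const
  obtain ⟨C, hC⟩ := ((isCompact_closedBall p 1).prod (isCompact_Icc (a := (0:ℝ)) (b := 1))).bddAbove_image
    hc.norm.continuousOn
  refine intervalIntegral.hasFDerivAt_integral_of_dominated_of_fderiv_le
    (F := fun p s => Φ (p, s))
    (F' := fun p s => (fderiv ℝ Φ (p, s)).comp (ContinuousLinearMap.inl ℝ E ℝ))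
    (bound := fun _ => C) (s := Metric.ball p 1) (Metric.ball_mem_nhds p one_pos) ?_ ?_ ?_ ?_ ?_ ?_
  · exact Eventually.of_forall fun q =>
      (hΦ.continuous.comp (Continuous.prodMk_right q)).aestronglyMeasurable
  · exact (hΦ.continuous.comp (Continuous.prodMk_right p)).intervalIntegrable _ _
  · exact (hc.comp (Continuous.prodMk_right p)).aestronglyMeasurable
  · refine Eventually.of_forall fun s hs q hq => hC ⟨(q, s), ⟨?_, ?_⟩, rfl⟩
    · exact Metric.ball_subset_closedBall hq
    · rw [Set.uIoc_of_le zero_le_one] at hs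
      exact Set.Ioc_subset_Icc_self hs
  · exact intervalIntegrable_const
  · refine Eventually.of_forall fun s _ q _ => ?_
    exact (hΦ.differentiable (by simp) (q, s)).hasFDerivAt.comp q (hasFDerivAt_prodMk_left q s)

/-- The derivative is again an integral of the same kind, with values in a space of linear maps.
Hence the target space has to vary in the induction on the order. -/
theorem contDiff_nat_intervalIntegral {E : Type} [NormedAddCommGroup E] [NormedSpace ℝ E]
    [FiniteDimensional ℝ E] (n : ℕ) : ∀ {H : Type} [NormedAddCommGroup H] [NormedSpace ℝ H]
    [CompleteSpace H] (Φ : E × ℝ → H), ContDiff ℝ ∞ Φ →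
    ContDiff ℝ n (fun p => ∫ s in (0 : ℝ)..1, Φ (p, s)) := by
  induction n with
  | zero =>
    intro H _ _ _ Φ hΦ
    simp only [Nat.cast_zero, contDiff_zero]
    exact continuous_iff_continuousAt.2 fun p =>
      (hasFDerivAt_intervalIntegral_of_contDiff Φ hΦ p).continuousAt
  | succ n ih =>
    intro H _ _ _ Φ hΦ
    have h := hasFDerivAt_intervalIntegral_of_contDiff Φ hΦ
    push_cast
    refine contDiff_succ_iff_hasFDerivAt.2 ⟨_, ih (fun q =>
      (fderiv ℝ Φ q).comp (ContinuousLinearMap.inl ℝ E ℝ)) ?_, h⟩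
    exact (hΦ.fderiv_right (by simp)).clm_comp contDiff_const

theorem contDiff_intervalIntegral {E H : Type} [NormedAddCommGroup E] [NormedSpace ℝ E]
    [FiniteDimensional ℝ E] [NormedAddCommGroup H] [NormedSpace ℝ H]
    [CompleteSpace H] {Φ : E × ℝ → H} (hΦ : ContDiff ℝ ∞ Φ) :
    ContDiff ℝ ∞ (fun p => ∫ s in (0 : ℝ)..1, Φ (p, s)) :=
  contDiff_infty.2 fun n => contDiff_nat_intervalIntegral n Φ hΦ

/-- Hadamard's lemma: a smooth function vanishing on the axis `y = 0` is divisible by `y`. -/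
theorem ContDiff.exists_eq_snd_mul {f : ℝ × ℝ → ℝ} (hf : ContDiff ℝ ∞ f)
    (h0 : ∀ x, f (x, 0) = 0) :
    ∃ g : ℝ × ℝ → ℝ, ContDiff ℝ ∞ g ∧ ∀ p, f p = p.2 * g p := by
  -- The quotient is ∫₀¹ f_y(x, sy) ds, since y f_y(x, sy) is the derivative of s ↦ f(x, sy).
  let Φ : (ℝ × ℝ) × ℝ → ℝ := fun q => fderiv ℝ f (q.1.1, q.2 * q.1.2) (0, 1)
  have hΦ : ContDiff ℝ ∞ Φ := by
    have h1 : ContDiff ℝ ∞ (fderiv ℝ f) := hf.fderiv_right (by simp)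
    have h2 : ContDiff ℝ ∞ fun q : (ℝ × ℝ) × ℝ => (q.1.1, q.2 * q.1.2) := by fun_prop
    exact (h1.comp h2).clm_apply contDiff_const
  refine ⟨_, contDiff_intervalIntegral hΦ, fun p => ?_⟩
  have hd : ∀ s : ℝ, HasDerivAt (fun s => f (p.1, s * p.2)) (p.2 * Φ (p, s)) s := fun s => by
    have h1 : HasDerivAt (fun s : ℝ => (p.1, s * p.2)) (0, p.2) s := by
      simpa using (hasDerivAt_const s p.1).prodMk ((hasDerivAt_id s).mul_const p.2)
    have h2 := ((hf.differentiable (by simp) (p.1, s * p.2)).hasFDerivAt).comp_hasDerivAt s h1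
    have h3 : ((0, p.2) : ℝ × ℝ) = p.2 • (0, 1) := by simp
    rw [h3, map_smul, smul_eq_mul] at h2
    exact h2
  have := intervalIntegral.integral_eq_sub_of_hasDerivAt (a := 0) (b := 1) (fun s _ => hd s)
    ((continuous_const.mul (hΦ.continuous.comp (Continuous.prodMk_right p))).intervalIntegrable _ _)
  rw [intervalIntegral.integral_const_mul] at this
  simp [h0] at this
  exact this.symm

theorem ContDiff.exists_eq_mul_of_zero {f : ℝ → ℝ} (hf : ContDiff ℝ ∞ f) (h0 : f 0 = 0) :
    ∃ g : ℝ → ℝ, ContDiff ℝ ∞ g ∧ ∀ x, f x = x * g x := by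
  obtain ⟨g, hg, h⟩ := (hf.comp (contDiff_snd (E := ℝ))).exists_eq_snd_mul (by simpa using h0)
  exact ⟨fun x => g (0, x), hg.comp (by fun_prop), fun x => h (0, x)⟩

/-! ### Partial derivatives and derivatives along plane curves -/

noncomputable def px (f : ℝ × ℝ → ℝ) (p : ℝ × ℝ) : ℝ := fderiv ℝ f p (1, 0)

noncomputable def py (f : ℝ × ℝ → ℝ) (p : ℝ × ℝ) : ℝ := fderiv ℝ f p (0, 1)

theorem ContDiff.px {f : ℝ × ℝ → ℝ} (hf : ContDiff ℝ ∞ f) : ContDiff ℝ ∞ (px f) :=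
  (hf.fderiv_right (by simp)).clm_apply contDiff_const

theorem ContDiff.py {f : ℝ × ℝ → ℝ} (hf : ContDiff ℝ ∞ f) : ContDiff ℝ ∞ (py f) :=
  (hf.fderiv_right (by simp)).clm_apply contDiff_const

theorem ContDiff.deriv_infty {E : Type*} [NormedAddCommGroup E] [NormedSpace ℝ E] {a : ℝ → E}
    (ha : ContDiff ℝ ∞ a) : ContDiff ℝ ∞ (deriv a) :=
  (contDiff_infty_iff_deriv.1 ha).2

theorem fderiv_apply_eq_px_py (f : ℝ × ℝ → ℝ) (p v : ℝ × ℝ) :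
    fderiv ℝ f p v = px f p * v.1 + py f p * v.2 := by
  have : v = v.1 • ((1, 0) : ℝ × ℝ) + v.2 • ((0, 1) : ℝ × ℝ) := by ext <;> simp
  conv_lhs => rw [this]
  rw [map_add, map_smul, map_smul, px, py, smul_eq_mul, smul_eq_mul]
  ring

/-- Used throughout to bring mixed partial derivatives to one normal order, with `px` outermost. -/
theorem py_px {f : ℝ × ℝ → ℝ} (hf : ContDiff ℝ ∞ f) : py (px f) = px (py f) := by
  funext p
  have hs : IsSymmSndFDerivAt ℝ f p := hf.contDiffAt.isSymmSndFDerivAt (by simp; exact ENat.LEInfty.out)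
  have h2 : DifferentiableAt ℝ (fderiv ℝ f) p :=
    (hf.fderiv_right (m := ∞) (by simp)).differentiable (by simp) p
  have key : ∀ v w : ℝ × ℝ, fderiv ℝ (fun q => fderiv ℝ f q v) p w =
      fderiv ℝ (fderiv ℝ f) p w v := fun v w => by
    rw [fderiv_clm_apply h2 (differentiableAt_const v)]
    simp
  change fderiv ℝ (fun q => fderiv ℝ f q (1, 0)) p (0, 1) =
    fderiv ℝ (fun q => fderiv ℝ f q (0, 1)) p (1, 0)
  rw [key, key]
  exact hs _ _

theorem hasDerivAt_curve {f : ℝ × ℝ → ℝ} {p : ℝ × ℝ} (hf : DifferentiableAt ℝ f p)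
    {γ : ℝ → ℝ × ℝ} {t : ℝ} {v : ℝ × ℝ} (hp : γ t = p) (hγ : HasDerivAt γ v t) :
    HasDerivAt (fun t => f (γ t)) (px f p * v.1 + py f p * v.2) t := by
  subst hp
  have := hf.hasFDerivAt.comp_hasDerivAt t hγ
  rwa [fderiv_apply_eq_px_py] at this

section Curve

variable {f : ℝ × ℝ → ℝ} {a b : ℝ → ℝ}

theorem hasDerivAt_curve_pair (hf : ContDiff ℝ ∞ f) (ha : ContDiff ℝ ∞ a) (hb : ContDiff ℝ ∞ b)
    (t : ℝ) : HasDerivAt (fun t => f (a t, b t))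
      (px f (a t, b t) * deriv a t + py f (a t, b t) * deriv b t) t :=
  hasDerivAt_curve (hf.differentiable (by simp) _) rfl
    ((ha.differentiable (by simp) t).hasDerivAt.prodMk (hb.differentiable (by simp) t).hasDerivAt)

theorem deriv_curve (hf : ContDiff ℝ ∞ f) (ha : ContDiff ℝ ∞ a) (hb : ContDiff ℝ ∞ b) :
    deriv (fun t => f (a t, b t)) =
      fun t => px f (a t, b t) * deriv a t + py f (a t, b t) * deriv b t :=
  funext fun t => (hasDerivAt_curve_pair hf ha hb t).deriv

theorem ContDiff.hasDerivAt' {a : ℝ → ℝ} (ha : ContDiff ℝ ∞ a) (t : ℝ) :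
    HasDerivAt a (deriv a t) t := (ha.differentiable (by simp) t).hasDerivAt

theorem deriv_deriv_curve (hf : ContDiff ℝ ∞ f) (ha : ContDiff ℝ ∞ a) (hb : ContDiff ℝ ∞ b) :
    deriv (deriv (fun t => f (a t, b t))) = fun t =>
      px (px f) (a t, b t) * deriv a t ^ 2 + 2 * px (py f) (a t, b t) * deriv a t * deriv b t +
      py (py f) (a t, b t) * deriv b t ^ 2 + px f (a t, b t) * deriv (deriv a) t +
      py f (a t, b t) * deriv (deriv b) t := by
  rw [deriv_curve hf ha hb]
  funext t
  have h1 := hasDerivAt_curve_pair hf.px ha hb t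
  have h2 := hasDerivAt_curve_pair hf.py ha hb t
  rw [((h1.fun_mul (ha.deriv_infty.hasDerivAt' t)).fun_add
    (h2.fun_mul (hb.deriv_infty.hasDerivAt' t))).deriv, py_px hf]
  ring

theorem deriv_deriv_deriv_curve (hf : ContDiff ℝ ∞ f) (ha : ContDiff ℝ ∞ a)
    (hb : ContDiff ℝ ∞ b) :
    deriv (deriv (deriv (fun t => f (a t, b t)))) = fun t =>
      px (px (px f)) (a t, b t) * deriv a t ^ 3 +
      3 * px (px (py f)) (a t, b t) * deriv a t ^ 2 * deriv b t +
      3 * px (py (py f)) (a t, b t) * deriv a t * deriv b t ^ 2 +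
      py (py (py f)) (a t, b t) * deriv b t ^ 3 +
      3 * (px (px f) (a t, b t) * deriv a t * deriv (deriv a) t +
        px (py f) (a t, b t) * (deriv a t * deriv (deriv b) t + deriv (deriv a) t * deriv b t) +
        py (py f) (a t, b t) * deriv b t * deriv (deriv b) t) +
      px f (a t, b t) * deriv (deriv (deriv a)) t +
      py f (a t, b t) * deriv (deriv (deriv b)) t := by
  rw [deriv_deriv_curve hf ha hb]
  funext t
  have h1 := hasDerivAt_curve_pair hf.px ha hb t
  have h2 := hasDerivAt_curve_pair hf.py ha hb t
  have h11 := hasDerivAt_curve_pair hf.px.px ha hb t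
  have h12 := hasDerivAt_curve_pair hf.py.px ha hb t
  have h22 := hasDerivAt_curve_pair hf.py.py ha hb t
  have a1 := ha.deriv_infty.hasDerivAt' t
  have b1 := hb.deriv_infty.hasDerivAt' t
  have a2 := ha.deriv_infty.deriv_infty.hasDerivAt' t
  have b2 := hb.deriv_infty.deriv_infty.hasDerivAt' t
  rw [((((((h11.fun_mul (a1.fun_pow 2)).fun_add (((h12.const_mul 2).fun_mul a1).fun_mul b1)).fun_add
    (h22.fun_mul (b1.fun_pow 2))).fun_add (h1.fun_mul a2)).fun_add (h2.fun_mul b2))).deriv]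
  simp only [py_px hf.px, py_px hf.py, py_px hf]
  push_cast
  ring

end Curve

/-- The implicit function theorem for a plane curve, with a globally smooth solution. -/
theorem exists_implicit {E : Type*} [NormedAddCommGroup E] [NormedSpace ℝ E]
    [FiniteDimensional ℝ E] {G : E × ℝ → ℝ} (hG : ContDiff ℝ ∞ G) (a : E) (b : ℝ)
    (h0 : G (a, b) = 0) (h1 : fderiv ℝ G (a, b) (0, 1) ≠ 0) :
    ∃ c : E → ℝ, ContDiff ℝ ∞ c ∧ c a = b ∧ ∀ᶠ p in 𝓝 (a, b), G p = 0 ↔ p.2 = c p.1 := by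
  -- The map (x, y) ↦ (x, G(x, y)) is a local diffeomorphism. The solution is the second component
  -- of its inverse on the slice G = 0.
  let Φ : E × ℝ → E × ℝ := fun p => (p.1, G p)
  have hΦ : ContDiff ℝ ∞ Φ := contDiff_fst.prodMk hG
  set m := fderiv ℝ G (a, b) (0, 1) with hm
  set L := fderiv ℝ G (a, b) with hL
  have hd : fderiv ℝ Φ (a, b) = (ContinuousLinearMap.fst ℝ E ℝ).prod L := by
    have := (hasFDerivAt_fst (𝕜 := ℝ) (p := (a, b))).prodMk
      (hG.differentiable (by simp) (a, b)).hasFDerivAt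
    exact this.fderiv
  have hinj : Function.Injective ((ContinuousLinearMap.fst ℝ E ℝ).prod L) := by
    rw [injective_iff_map_eq_zero]
    rintro ⟨v, w⟩ h
    simp only [ContinuousLinearMap.prod_apply, ContinuousLinearMap.coe_fst', Prod.mk_eq_zero] at h
    obtain ⟨rfl, h⟩ := h
    have h2 : ((0 : E), w) = w • ((0 : E), (1 : ℝ)) := by simp
    rw [h2, map_smul, smul_eq_mul, mul_eq_zero] at h
    rcases h with rfl | h
    · rfl
    · exact absurd h h1
  let e : (E × ℝ) ≃L[ℝ] (E × ℝ) :=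
    (LinearEquiv.ofInjectiveEndo
      ((ContinuousLinearMap.fst ℝ E ℝ).prod L).toLinearMap hinj).toContinuousLinearEquiv
  have he : fderiv ℝ Φ (a, b) = e := by
    rw [hd]; ext <;> rfl
  obtain ⟨Ψ, hΨ, hΨ0, hl, hr⟩ := hΦ.exists_local_inverse (a, b) e he
  have hΦ0 : Φ (a, b) = (a, 0) := by simp [Φ, h0]
  rw [hΦ0] at hr hΨ0
  refine ⟨fun x => (Ψ (x, 0)).2, hΨ.snd.comp (contDiff_id.prodMk contDiff_const), by simp [hΨ0], ?_⟩
  have ht : Tendsto (fun p : E × ℝ => (p.1, (0 : ℝ))) (𝓝 (a, b)) (𝓝 (a, 0)) := by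
    have : Continuous fun p : E × ℝ => (p.1, (0 : ℝ)) := by fun_prop
    exact this.tendsto (a, b)
  filter_upwards [hl, ht.eventually hr] with p hp hq
  have h3 : (Ψ (p.1, 0)).1 = p.1 := (Prod.ext_iff.1 hq).1
  have h4 : G (Ψ (p.1, 0)) = 0 := (Prod.ext_iff.1 hq).2
  constructor
  · intro h
    have : Φ p = (p.1, 0) := by simp [Φ, h]
    rw [this] at hp
    change p.2 = (Ψ (p.1, 0)).2
    rw [hp]
  · intro h
    have : p = Ψ (p.1, 0) := by
      ext
      · exact h3.symm
      · exact h
    rw [this, h4]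

/-! ### Taylor expansion with a smooth remainder -/

theorem deriv_pow_succ_mul {g : ℝ → ℝ} (hg : ContDiff ℝ ∞ g) (n : ℕ) :
    deriv (fun x => x ^ (n + 1) * g x) = fun x => x ^ n * ((n + 1) * g x + x * deriv g x) := by
  funext x
  rw [((hasDerivAt_pow (n + 1) x).fun_mul (hg.hasDerivAt' x)).deriv]
  push_cast
  ring

theorem iteratedDeriv_pow_mul_zero (n : ℕ) : ∀ {g : ℝ → ℝ}, ContDiff ℝ ∞ g →
    iteratedDeriv n (fun x => x ^ n * g x) 0 = n.factorial * g 0 := by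
  induction n with
  | zero => intro g _; simp
  | succ n ih =>
    intro g hg
    have h1 : ContDiff ℝ ∞ (fun x => ((n : ℝ) + 1) * g x + x * deriv g x) := by
      have := hg.deriv_infty
      fun_prop
    rw [iteratedDeriv_succ', deriv_pow_succ_mul hg, ih h1, Nat.factorial_succ]
    push_cast
    ring

theorem ContDiff.exists_eq_pow_mul {f : ℝ → ℝ} (hf : ContDiff ℝ ∞ f) (n : ℕ)
    (h0 : ∀ i < n, iteratedDeriv i f 0 = 0) :
    ∃ g : ℝ → ℝ, ContDiff ℝ ∞ g ∧ (∀ x, f x = x ^ n * g x) ∧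
      iteratedDeriv n f 0 = n.factorial * g 0 := by
  induction n with
  | zero => exact ⟨f, hf, by simp, by simp⟩
  | succ n ih =>
    obtain ⟨g, hg, hfg, hn⟩ := ih fun i hi => h0 i (by omega)
    have hg0 : g 0 = 0 := by
      rw [h0 n (by omega)] at hn
      have := Nat.factorial_ne_zero n
      simpa [this] using hn.symm
    obtain ⟨w, hw, hgw⟩ := hg.exists_eq_mul_of_zero hg0
    have hfw : ∀ x, f x = x ^ (n + 1) * w x := fun x => by rw [hfg, hgw]; ring
    refine ⟨w, hw, hfw, ?_⟩
    rw [show f = fun x => x ^ (n + 1) * w x from funext hfw, iteratedDeriv_pow_mul_zero _ hw]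

theorem ContDiff.exists_eq_sq_mul {f : ℝ → ℝ} (hf : ContDiff ℝ ∞ f) (h0 : f 0 = 0)
    (h1 : deriv f 0 = 0) :
    ∃ g : ℝ → ℝ, ContDiff ℝ ∞ g ∧ (∀ x, f x = x ^ 2 * g x) ∧ deriv (deriv f) 0 = 2 * g 0 := by
  obtain ⟨g, hg, hfg, h2⟩ := hf.exists_eq_pow_mul 2 (fun i hi => by
    interval_cases i <;> simp [iteratedDeriv_one, h0, h1])
  refine ⟨g, hg, hfg, ?_⟩
  simpa [iteratedDeriv_succ, iteratedDeriv_zero] using h2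

theorem eventually_pos_of_deriv_deriv_pos {f : ℝ → ℝ} (hf : ContDiff ℝ ∞ f) (h0 : f 0 = 0)
    (h1 : deriv f 0 = 0) (h2 : 0 < deriv (deriv f) 0) : ∀ᶠ x in 𝓝 (0 : ℝ), x ≠ 0 → 0 < f x := by
  obtain ⟨g, hg, hfg, h3⟩ := hf.exists_eq_sq_mul h0 h1
  have hg0 : 0 < g 0 := by linarith
  filter_upwards [hg.continuous.continuousAt.eventually (lt_mem_nhds hg0)] with x hx hne
  rw [hfg]
  positivity

/-- Decides which of two tangent graphs lies above the other, simultaneously on both sides of the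
point of tangency. -/
theorem eventually_lt_of_deriv_deriv_lt {f g : ℝ → ℝ} (hf : ContDiff ℝ ∞ f)
    (hg : ContDiff ℝ ∞ g) (h0 : f 0 = g 0) (h1 : deriv f 0 = deriv g 0)
    (h2 : deriv (deriv f) 0 < deriv (deriv g) 0) : ∀ᶠ x in 𝓝 (0 : ℝ), x ≠ 0 → f x < g x := by
  have e1 : deriv (fun x => g x - f x) = fun x => deriv g x - deriv f x := funext fun x =>
    deriv_fun_sub (hg.hasDerivAt' x).differentiableAt (hf.hasDerivAt' x).differentiableAt
  have e2 : deriv (fun x => deriv g x - deriv f x) 0 = deriv (deriv g) 0 - deriv (deriv f) 0 :=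
    deriv_fun_sub (hg.deriv_infty.hasDerivAt' 0).differentiableAt
      (hf.deriv_infty.hasDerivAt' 0).differentiableAt
  filter_upwards [eventually_pos_of_deriv_deriv_pos (hg.sub hf) (by simp [h0])
    (by rw [e1]; simp [h1]) (by rw [e1, e2]; linarith)] with x hx hne
  simpa using hx hne

/-! ### Charts -/

/-- `χ` is a local diffeomorphism at `s` that sends `s` to the origin, `ξ` is its local inverse. -/
structure IsChartAt (χ ξ : ℝ × ℝ → ℝ × ℝ) (s : ℝ × ℝ) : Prop where
  contDiff : ContDiff ℝ ∞ χ
  contDiff_inv : ContDiff ℝ ∞ ξ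
  map_base : χ s = 0
  inv_zero : ξ 0 = s
  left_inv : ∀ᶠ u in 𝓝 s, ξ (χ u) = u
  right_inv : ∀ᶠ p in 𝓝 0, χ (ξ p) = p

/-- If the determinant vanished, (d, -c) and (b, -a) would lie in the kernel. All entries would then
be zero, and so would the kernel vector (1, 0). -/
theorem det_ne_zero_of_injective {a b c d : ℝ}
    (h : ∀ v : ℝ × ℝ, a * v.1 + b * v.2 = 0 → c * v.1 + d * v.2 = 0 → v = 0) :
    a * d - b * c ≠ 0 := by
  intro h0
  have h1 := h (d, -c) (by simp; linarith) (by simp; ring)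
  have h2 := h (b, -a) (by simp; ring) (by simp; linarith)
  simp only [Prod.mk_eq_zero, neg_eq_zero] at h1 h2
  have h3 := h (1, 0) (by simp [h2.2]) (by simp [h1.2])
  simp at h3

namespace IsChartAt

variable {χ ξ : ℝ × ℝ → ℝ × ℝ} {s : ℝ × ℝ}

theorem fderiv_injective (hc : IsChartAt χ ξ s) {u : ℝ × ℝ} (hu : ∀ᶠ w in 𝓝 u, ξ (χ w) = w)
    {v : ℝ × ℝ} (hv : fderiv ℝ χ u v = 0) : v = 0 := by
  have h1 : HasFDerivAt (fun w => ξ (χ w)) ((fderiv ℝ ξ (χ u)).comp (fderiv ℝ χ u)) u :=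
    (hc.contDiff_inv.differentiable (by simp) (χ u)).hasFDerivAt.comp u
      (hc.contDiff.differentiable (by simp) u).hasFDerivAt
  have h2 : HasFDerivAt (fun w => ξ (χ w)) (ContinuousLinearMap.id ℝ (ℝ × ℝ)) u :=
    (hasFDerivAt_id u).congr_of_eventuallyEq hu
  have := congrArg (fun L : ℝ × ℝ →L[ℝ] ℝ × ℝ => L v) (h1.unique h2)
  simpa [hv] using this.symm

theorem fderiv_eq (hc : IsChartAt χ ξ s) (u v : ℝ × ℝ) : fderiv ℝ χ u v =
    (px (fun u => (χ u).1) u * v.1 + py (fun u => (χ u).1) u * v.2,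
      px (fun u => (χ u).2) u * v.1 + py (fun u => (χ u).2) u * v.2) := by
  have hd := (hc.contDiff.differentiable (by simp) u).hasFDerivAt
  rw [← fderiv_apply_eq_px_py, ← fderiv_apply_eq_px_py]
  ext
  · rw [hd.fst.fderiv]; rfl
  · rw [hd.snd.fderiv]; rfl

theorem jacobian_ne_zero (hc : IsChartAt χ ξ s) {u : ℝ × ℝ} (hu : ∀ᶠ w in 𝓝 u, ξ (χ w) = w) :
    px (fun u => (χ u).1) u * py (fun u => (χ u).2) u -
      py (fun u => (χ u).1) u * px (fun u => (χ u).2) u ≠ 0 := by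
  refine det_ne_zero_of_injective fun v h1 h2 => hc.fderiv_injective hu ?_
  rw [hc.fderiv_eq, h1, h2]; rfl

theorem tendsto (hc : IsChartAt χ ξ s) : Tendsto χ (𝓝 s) (𝓝 0) := by
  have := hc.contDiff.continuous.tendsto s
  rwa [hc.map_base] at this

theorem tendsto_inv (hc : IsChartAt χ ξ s) : Tendsto ξ (𝓝 0) (𝓝 s) := by
  have := hc.contDiff_inv.continuous.tendsto 0
  rwa [hc.inv_zero] at this

theorem eventually_eq_base (hc : IsChartAt χ ξ s) : ∀ᶠ u in 𝓝 s, χ u = 0 → u = s := by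
  filter_upwards [hc.left_inv] with u hu h
  rw [← hu, h, hc.inv_zero]

theorem tendsto_fst (hc : IsChartAt χ ξ s) : Tendsto (fun u => (χ u).1) (𝓝 s) (𝓝 0) :=
  (continuous_fst.tendsto' (0 : ℝ × ℝ) 0 rfl).comp hc.tendsto

end IsChartAt

/-! ### Curves tangent to the first axis of a chart -/

/-- Near `s`, the set `A` is a smooth curve, which in the chart `χ` is tangent to the first axis
and has the equation `y = k x² + ⋯`. -/
def IsGraphCurve (χ : ℝ × ℝ → ℝ × ℝ) (s : ℝ × ℝ) (A : Set (ℝ × ℝ)) (k : ℝ) : Prop :=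
  ∃ c : ℝ → ℝ, ContDiff ℝ ∞ c ∧ c 0 = 0 ∧ deriv c 0 = 0 ∧ deriv (deriv c) 0 = 2 * k ∧
    ∀ᶠ u in 𝓝 s, u ∈ A ↔ (χ u).2 = c (χ u).1

/-- The coefficient comes from differentiating G(t, c(t)) = 0 twice at the origin, where G_x = 0
forces c' = 0 and leaves G_xx + G_y c'' = 0. -/
theorem exists_graph {G : ℝ × ℝ → ℝ} (hG : ContDiff ℝ ∞ G) (h0 : G 0 = 0) (hx : px G 0 = 0)
    (hy : py G 0 ≠ 0) : ∃ c : ℝ → ℝ, ContDiff ℝ ∞ c ∧ c 0 = 0 ∧ deriv c 0 = 0 ∧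
      deriv (deriv c) 0 = -px (px G) 0 / py G 0 ∧ ∀ᶠ p in 𝓝 0, G p = 0 ↔ p.2 = c p.1 := by
  obtain ⟨c, hc, hc0, hGc⟩ := exists_implicit hG 0 0 h0 hy
  have hev : (fun t => G (t, c t)) =ᶠ[𝓝 0] fun _ => 0 := by
    have ht : Tendsto (fun t => (t, c t)) (𝓝 0) (𝓝 ((0 : ℝ), (0 : ℝ))) :=
      (continuous_id.prodMk hc.continuous).tendsto' _ _ (by simp [hc0])
    filter_upwards [ht.eventually hGc] with t ht
    exact ht.2 rfl
  have h1 := hev.deriv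
  have h2 := h1.deriv
  have h1' := h1.self_of_nhds
  have h2' := h2.self_of_nhds
  rw [deriv_deriv_curve (a := fun t => t) hG contDiff_id hc] at h2'
  rw [deriv_curve (a := fun t => t) hG contDiff_id hc] at h1'
  have hz : ((0 : ℝ), (0 : ℝ)) = 0 := rfl
  simp [hc0, hz, hx, hy] at h1' h2'
  refine ⟨c, hc, hc0, h1', ?_, hGc⟩
  rw [h1'] at h2'
  rw [eq_div_iff hy]
  simp at h2'
  linarith

/-- The last hypothesis says that G(x, kx²) has no quadratic term. It determines k, as G_y ≠ 0. -/
theorem IsGraphCurve.of_eventually_zero {χ ξ : ℝ × ℝ → ℝ × ℝ} {s : ℝ × ℝ}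
    (hχ : IsChartAt χ ξ s) {G : ℝ × ℝ → ℝ} (hG : ContDiff ℝ ∞ G) (h0 : G 0 = 0) (hx : px G 0 = 0)
    (hy : py G 0 ≠ 0) {A : Set (ℝ × ℝ)} (hA : ∀ᶠ u in 𝓝 s, u ∈ A ↔ G (χ u) = 0) {k : ℝ}
    (hk : px (px G) 0 + 2 * k * py G 0 = 0) :
    IsGraphCurve χ s A k := by
  obtain ⟨c, hc, hc0, hc1, hc2, hGc⟩ := exists_graph hG h0 hx hy
  refine ⟨c, hc, hc0, hc1, ?_, ?_⟩
  · rw [hc2, div_eq_iff hy]; linarith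
  · filter_upwards [hA, hχ.tendsto.eventually hGc] with u h1 h2
    rw [h1, h2]

namespace IsGraphCurve

variable {χ ξ : ℝ × ℝ → ℝ × ℝ} {s : ℝ × ℝ} {A : Set (ℝ × ℝ)} {k : ℝ}

theorem congr (hA : IsGraphCurve χ s A k) {B : Set (ℝ × ℝ)} (h : ∀ᶠ u in 𝓝 s, u ∈ B ↔ u ∈ A) :
    IsGraphCurve χ s B k := by
  obtain ⟨c, hc, hc0, hc1, hc2, hu⟩ := hA
  refine ⟨c, hc, hc0, hc1, hc2, ?_⟩
  filter_upwards [h, hu] with u h1 h2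
  rw [h1, h2]

/-- The parametrization of the curve by the first coordinate of the chart. -/
theorem exists_parametrization (hχ : IsChartAt χ ξ s) (hA : IsGraphCurve χ s A k) :
    ∃ (α : ℝ → ℝ × ℝ) (c : ℝ → ℝ), ParametrizesAt α A s ∧ ContDiff ℝ ∞ α ∧ ContDiff ℝ ∞ c ∧
      c 0 = 0 ∧ deriv c 0 = 0 ∧ deriv (deriv c) 0 = 2 * k ∧
      ∀ᶠ t in 𝓝 0, χ (α t) = (t, c t) := by
  obtain ⟨c, hc, hc0, hc1, hc2, hu⟩ := hA
  have hp : ContDiff ℝ ∞ fun t => (t, c t) := contDiff_id.prodMk hc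
  have hα : ContDiff ℝ ∞ fun t => ξ (t, c t) := hχ.contDiff_inv.comp hp
  have hα0 : ξ (0, c 0) = s := by rw [hc0]; exact hχ.inv_zero
  have hχα : ∀ᶠ t in 𝓝 0, χ (ξ (t, c t)) = (t, c t) := by
    have ht : Tendsto (fun t => (t, c t)) (𝓝 0) (𝓝 (0 : ℝ × ℝ)) :=
      hp.continuous.tendsto' _ _ (by simp [hc0])
    exact ht.eventually hχ.right_inv
  refine ⟨fun t => ξ (t, c t), c, ⟨hα.smoothNear 0, hα0, ?_, ?_⟩, hα, hc, hc0, hc1, hc2, hχα⟩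
  · intro h
    have h1 : HasDerivAt (fun t => χ (ξ (t, c t))) 0 0 := by
      have hd := (hα.differentiable (by simp) 0).hasDerivAt
      rw [h] at hd
      have h1 := (hχ.contDiff.differentiable (by simp) (ξ (0, c 0))).hasFDerivAt.comp_hasDerivAt
        (0 : ℝ) hd
      rwa [map_zero] at h1
    have h2 : HasDerivAt (fun t => χ (ξ (t, c t))) (1, deriv c 0) 0 :=
      ((hasDerivAt_id (0 : ℝ)).prodMk (hc.hasDerivAt' 0)).congr_of_eventuallyEq hχα
    simpa using congrArg Prod.fst (h1.unique h2)
  · obtain ⟨δ, hδ, hball⟩ := Metric.eventually_nhds_iff.1 hχα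
    -- Taking ε below δ makes the coordinate formula for the parametrization valid on the whole arc.
    filter_upwards [Ioo_mem_nhdsGT hδ] with ε hε
    have hX : ∀ᶠ u in 𝓝 s, (χ u).1 ∈ Set.Ioo (-ε) ε :=
      hχ.tendsto_fst.eventually (Ioo_mem_nhds (by linarith [hε.1]) hε.1)
    filter_upwards [hu, hX, hχ.left_inv] with u h1 h2 h3
    rw [h1]
    constructor
    · intro h
      refine ⟨(χ u).1, h2, ?_⟩
      change ξ ((χ u).1, c (χ u).1) = u
      rw [← h, Prod.mk.eta, h3]
    · rintro ⟨t, ht, rfl⟩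
      have := hball (y := t) (by
        rw [dist_zero_right, Real.norm_eq_abs]
        exact (abs_lt.2 ht).trans hε.2)
      simp only [this]

theorem eventually_mem_of_parametrizesAt {α : ℝ → ℝ × ℝ} (hα : ParametrizesAt α A s) :
    ∀ᶠ t in 𝓝 0, α t ∈ A := by
  obtain ⟨h1, h2, -, h4⟩ := hα
  obtain ⟨ε, hev, hε⟩ := (h4.and self_mem_nhdsWithin).exists
  have hc : Tendsto α (𝓝 0) (𝓝 s) := by
    have := h1.contDiffAt.continuousAt
    rwa [ContinuousAt, h2] at this
  have hε : (0 : ℝ) < ε := hε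
  filter_upwards [hc.eventually hev, Ioo_mem_nhds (neg_lt_zero.2 hε) hε] with t h ht
  exact h.2 ⟨t, ht, rfl⟩

/-- Reduces a statement about the curve near `s` to a statement in one variable. Off `s` the first
coordinate is nonzero, because the curve is a graph over it. -/
theorem eventually_ne_base_imp {P : ℝ × ℝ → Prop} (hχ : IsChartAt χ ξ s)
    (hA : IsGraphCurve χ s A k)
    (h : ∀ c : ℝ → ℝ, ContDiff ℝ ∞ c → c 0 = 0 → deriv c 0 = 0 → deriv (deriv c) 0 = 2 * k →
      ∀ᶠ x in 𝓝 0, x ≠ 0 → P (x, c x)) :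
    ∀ᶠ u in 𝓝 s, u ∈ A → u ≠ s → P (χ u) := by
  obtain ⟨c, hc, hc0, hc1, hc2, hu⟩ := hA
  filter_upwards [hu, hχ.tendsto_fst.eventually (h c hc hc0 hc1 hc2), hχ.eventually_eq_base]
    with u h1 h2 h3 hA hs
  have h4 := h1.1 hA
  have h5 : (χ u).1 ≠ 0 := fun h => hs (h3 (by ext <;> simp [h4, h, hc0]))
  have := h2 h5
  rwa [← h4] at this

/-- Along y = kx² + ⋯ the function G vanishes to first order at the origin and has second derivative
G_xx + 2k G_y. -/
theorem eventually_pos (hχ : IsChartAt χ ξ s) (hA : IsGraphCurve χ s A k) {G : ℝ × ℝ → ℝ}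
    (hG : ContDiff ℝ ∞ G) (h0 : G 0 = 0) (hx : px G 0 = 0)
    (hpos : 0 < px (px G) 0 + 2 * k * py G 0) :
    ∀ᶠ u in 𝓝 s, u ∈ A → u ≠ s → 0 < G (χ u) := by
  refine hA.eventually_ne_base_imp hχ (P := fun p => 0 < G p) fun c hc hc0 hc1 hc2 => ?_
  have hz : ((0 : ℝ), (0 : ℝ)) = 0 := rfl
  refine eventually_pos_of_deriv_deriv_pos (f := fun x => G (x, c x))
    (hG.comp (contDiff_id.prodMk hc)) (by simp [hc0, hz, h0]) ?_ ?_
  · rw [deriv_curve (a := fun t => t) hG contDiff_id hc]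
    simp [hc0, hz, hx, hc1]
  · rw [deriv_deriv_curve (a := fun t => t) hG contDiff_id hc]
    simp [hc0, hz, hx, hc1, hc2]
    linarith

theorem eventually_neg (hχ : IsChartAt χ ξ s) (hA : IsGraphCurve χ s A k) {G : ℝ × ℝ → ℝ}
    (hG : ContDiff ℝ ∞ G) (h0 : G 0 = 0) (hx : px G 0 = 0)
    (hneg : px (px G) 0 + 2 * k * py G 0 < 0) :
    ∀ᶠ u in 𝓝 s, u ∈ A → u ≠ s → G (χ u) < 0 := by
  have e1 : px (fun p => -G p) = fun p => -px G p := by funext p; simp [px, fderiv_fun_neg]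
  have e2 : py (fun p => -G p) = fun p => -py G p := by funext p; simp [py, fderiv_fun_neg]
  have e3 : px (fun p => -px G p) = fun p => -px (px G) p := by
    funext p; conv_lhs => rw [px, fderiv_fun_neg]
    rfl
  have := hA.eventually_pos hχ (G := fun p => -G p) hG.neg (by simp [h0]) (by simp [e1, hx])
    (by rw [e1, e2, e3]; linarith)
  simpa using this

/-- The curve has points other than `s` arbitrarily near `s`. -/
theorem frequently_mem (hχ : IsChartAt χ ξ s) (hA : IsGraphCurve χ s A k) :
    ∃ᶠ u in 𝓝 s, u ∈ A ∧ u ≠ s := by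
  obtain ⟨α, c, hα, hαs, -, hc0, -, -, h⟩ := hA.exists_parametrization hχ
  have hc : Tendsto α (𝓝[≠] 0) (𝓝 s) :=
    (hαs.continuous.tendsto' _ _ hα.2.1).mono_left nhdsWithin_le_nhds
  refine hc.frequently (Eventually.frequently ?_)
  filter_upwards [(eventually_mem_of_parametrizesAt hα).filter_mono nhdsWithin_le_nhds,
    h.filter_mono nhdsWithin_le_nhds, self_mem_nhdsWithin] with t h1 h2 h3
  refine ⟨h1, fun h4 => h3 ?_⟩
  rw [h4, hχ.map_base] at h2
  exact (congrArg Prod.fst h2).symm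

theorem eventually_not_mem (hχ : IsChartAt χ ξ s) (hA : IsGraphCurve χ s A k)
    {B : Set (ℝ × ℝ)} {l : ℝ} (hB : IsGraphCurve χ s B l) (hkl : k ≠ l) :
    ∀ᶠ u in 𝓝 s, u ∈ A → u ≠ s → u ∉ B := by
  obtain ⟨b, hb, hb0, hb1, hb2, hu⟩ := hB
  have : ∀ᶠ u in 𝓝 s, u ∈ A → u ≠ s → (χ u).2 ≠ b (χ u).1 := by
    refine hA.eventually_ne_base_imp hχ (P := fun p => p.2 ≠ b p.1) fun c hc hc0 hc1 hc2 => ?_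
    rcases lt_or_gt_of_ne hkl with h | h
    · filter_upwards [eventually_lt_of_deriv_deriv_lt hc hb (hc0.trans hb0.symm)
        (hc1.trans hb1.symm) (by linarith)] with x hx hne
      exact (hx hne).ne
    · filter_upwards [eventually_lt_of_deriv_deriv_lt hb hc (hb0.trans hc0.symm)
        (hb1.trans hc1.symm) (by linarith)] with x hx hne
      exact (hx hne).ne'
  filter_upwards [this, hu] with u h1 h2 hA hs hB
  exact h1 hA hs (h2.1 hB)

end IsGraphCurve

/-- All the graphs are tangent at the origin, so the one with the larger coefficient lies above the
other on both sides. The two open sides of the middle graph then separate the lower curve from the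
upper one. -/
theorem IsGraphCurve.orderedAt {χ ξ : ℝ × ℝ → ℝ × ℝ} {s : ℝ × ℝ} (hχ : IsChartAt χ ξ s) {n : ℕ}
    {A : Fin n → Set (ℝ × ℝ)} {k : Fin n → ℝ} (hA : ∀ i, IsGraphCurve χ s (A i) (k i))
    (hk : StrictMono k) : OrderedAt s A := by
  intro i j l hij hjl
  obtain ⟨a, ha, ha0, ha1, ha2, hau⟩ := hA i
  obtain ⟨b, hb, hb0, hb1, hb2, hbu⟩ := hA j
  obtain ⟨c, hc, hc0, hc1, hc2, hcu⟩ := hA l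
  have hab := hχ.tendsto_fst.eventually (eventually_lt_of_deriv_deriv_lt ha hb (ha0.trans hb0.symm)
    (ha1.trans hb1.symm) (by linarith [hk hij]))
  have hbc := hχ.tendsto_fst.eventually (eventually_lt_of_deriv_deriv_lt hb hc (hb0.trans hc0.symm)
    (hb1.trans hc1.symm) (by linarith [hk hjl]))
  have c1 : Continuous fun u => (χ u).2 := hχ.contDiff.continuous.snd
  have c2 : Continuous fun u => b (χ u).1 := hb.continuous.comp hχ.contDiff.continuous.fst
  refine ⟨_, (hau.and <| hbu.and <| hcu.and <| hab.and <| hbc.and hχ.eventually_eq_base),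
    {u | (χ u).2 < b (χ u).1}, {u | b (χ u).1 < (χ u).2}, isOpen_lt c1 c2, isOpen_lt c2 c1, ?_,
    ?_, ?_, ?_⟩
  · rw [Set.disjoint_left]
    intro u h1 h2
    exact lt_asymm (show (χ u).2 < b (χ u).1 from h1) h2
  · rintro u ⟨⟨-, h, -⟩, hu⟩
    exact lt_or_gt_of_ne fun h1 => hu (h.2 h1)
  · rintro u ⟨⟨hu, h1, -, -, h2, -, h3⟩, hs⟩
    have h4 := h1.1 hu
    have h5 : (χ u).1 ≠ 0 := fun h => hs (h3 (by ext <;> simp [h4, h, ha0]))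
    change (χ u).2 < _
    rw [h4]
    exact h2 h5
  · rintro u ⟨⟨hu, -, -, h1, -, h2, h3⟩, hs⟩
    have h4 := h1.1 hu
    have h5 : (χ u).1 ≠ 0 := fun h => hs (h3 (by ext <;> simp [h4, h, hc0]))
    change _ < (χ u).2
    rw [h4]
    exact h2 h5

/-! ### Tangent lines of Legendrian lifts -/

theorem contactLift_congr {α β : ℝ → ℝ × ℝ} (e : ℝ × ℝ) (h : α =ᶠ[𝓝 0] β) :
    contactLift e α =ᶠ[𝓝 0] contactLift e β := by
  filter_upwards [h, h.deriv] with t h1 h2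
  simp only [contactLift, h1, h2]

theorem deriv_pair {a b : ℝ → ℝ} (ha : ContDiff ℝ ∞ a) (hb : ContDiff ℝ ∞ b) (t : ℝ) :
    deriv (fun t => (a t, b t)) t = (deriv a t, deriv b t) :=
  ((ha.hasDerivAt' t).prodMk (hb.hasDerivAt' t)).deriv

/-- The lift of a curve with velocity `m • e` has the slope given by the second derivative. -/
theorem hasDerivAt_contactLift {a b : ℝ → ℝ} (ha : ContDiff ℝ ∞ a) (hb : ContDiff ℝ ∞ b)
    {e : ℝ × ℝ} (he : e ≠ 0) {m : ℝ} (hm : m ≠ 0) (ha1 : deriv a 0 = m * e.1)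
    (hb1 : deriv b 0 = m * e.2) :
    HasDerivAt (contactLift e fun t => (a t, b t))
      (m • e, (e.1 * deriv (deriv b) 0 - e.2 * deriv (deriv a) 0) / (m * (e.1 ^ 2 + e.2 ^ 2))) 0 := by
  have hn : 0 < e.1 ^ 2 + e.2 ^ 2 := by
    rcases eq_or_ne e.1 0 with h1 | h1
    · have h2 : e.2 ≠ 0 := fun h2 => he (by ext <;> simp [h1, h2])
      positivity
    · positivity
  have hN := ((hb.deriv_infty.hasDerivAt' 0).const_mul e.1).fun_sub
    ((ha.deriv_infty.hasDerivAt' 0).const_mul e.2)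
  have hM := ((ha.deriv_infty.hasDerivAt' 0).const_mul e.1).fun_add
    ((hb.deriv_infty.hasDerivAt' 0).const_mul e.2)
  have hM0 : e.1 * deriv a 0 + e.2 * deriv b 0 ≠ 0 := by
    rw [ha1, hb1]
    have : e.1 * (m * e.1) + e.2 * (m * e.2) = m * (e.1 ^ 2 + e.2 ^ 2) := by ring
    rw [this]
    exact mul_ne_zero hm hn.ne'
  have h1 := ((ha.hasDerivAt' 0).prodMk (hb.hasDerivAt' 0)).prodMk (hN.fun_div hM hM0)
  have hval : (e.1 * deriv (deriv b) 0 - e.2 * deriv (deriv a) 0) / (m * (e.1 ^ 2 + e.2 ^ 2)) =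
      ((e.1 * deriv (deriv b) 0 - e.2 * deriv (deriv a) 0) *
        (e.1 * deriv a 0 + e.2 * deriv b 0) - (e.1 * deriv b 0 - e.2 * deriv a 0) *
        (e.1 * deriv (deriv a) 0 + e.2 * deriv (deriv b) 0)) /
        (e.1 * deriv a 0 + e.2 * deriv b 0) ^ 2 := by
    rw [eq_div_iff (pow_ne_zero 2 hM0), ha1, hb1]
    have hn' := hn.ne'
    field_simp
    ring
  have hfun : contactLift e (fun t => (a t, b t)) = fun t => ((a t, b t),
      (e.1 * deriv b t - e.2 * deriv a t) / (e.1 * deriv a t + e.2 * deriv b t)) := by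
    funext t
    rw [contactLift, deriv_pair ha hb, cross]
  rw [hfun, hval, show m • e = (deriv a 0, deriv b 0) by ext <;> simp [ha1, hb1]]
  exact h1

/-- The chain rule to order two, for a curve that is a graph in the chart but carries an arbitrary
parametrization. -/
theorem deriv_deriv_comp {c x : ℝ → ℝ} (hc : ContDiff ℝ ∞ c) (hx : ContDiff ℝ ∞ x) :
    deriv (fun t => c (x t)) = (fun t => deriv c (x t) * deriv x t) ∧
    deriv (deriv (fun t => c (x t))) = fun t =>
      deriv (deriv c) (x t) * deriv x t ^ 2 + deriv c (x t) * deriv (deriv x) t := by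
  have h1 : deriv (fun t => c (x t)) = fun t => deriv c (x t) * deriv x t := funext fun t =>
    ((hc.hasDerivAt' (x t)).comp t (hx.hasDerivAt' t)).deriv
  refine ⟨h1, ?_⟩
  rw [h1]
  funext t
  have h2 : HasDerivAt (fun t => deriv c (x t)) (deriv (deriv c) (x t) * deriv x t) t :=
    (hc.deriv_infty.hasDerivAt' (x t)).comp t (hx.hasDerivAt' t)
  rw [(h2.fun_mul (hx.deriv_infty.hasDerivAt' t)).deriv]
  ring

/-- The tangent lines of the Legendrian lifts of curves tangent to the first axis of a chart: their
slopes depend affinely on the coefficient `k`. -/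
theorem exists_slope_contactLift {χ ξ : ℝ × ℝ → ℝ × ℝ} {s : ℝ × ℝ} (hχ : IsChartAt χ ξ s)
    {e : ℝ × ℝ} (he : e ≠ 0) (hχe : (fderiv ℝ χ s e).2 = 0) :
    ∃ a b : ℝ, b ≠ 0 ∧ ∀ (A : Set (ℝ × ℝ)) (k : ℝ) (α : ℝ → ℝ × ℝ), IsGraphCurve χ s A k →
      ParametrizesAt α A s → ∃ m : ℝ, m ≠ 0 ∧
        HasDerivAt (contactLift e α) (m • e, m * (a + b * k)) 0 := by
  set X : ℝ × ℝ → ℝ := fun u => (χ u).1 with hX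
  set Y : ℝ × ℝ → ℝ := fun u => (χ u).2 with hY
  have hXs : ContDiff ℝ ∞ X := hχ.contDiff.fst
  have hYs : ContDiff ℝ ∞ Y := hχ.contDiff.snd
  have hJ := hχ.jacobian_ne_zero hχ.left_inv.eventually_nhds.self_of_nhds
  rw [hχ.fderiv_eq] at hχe
  simp only [← hX, ← hY] at hχe hJ
  have hn : 0 < e.1 ^ 2 + e.2 ^ 2 := by
    rcases eq_or_ne e.1 0 with h1 | h1
    · have h2 : e.2 ≠ 0 := fun h2 => he (by ext <;> simp [h1, h2])
      positivity
    · positivity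
  set n := e.1 ^ 2 + e.2 ^ 2 with hnd
  -- The differential of the second coordinate kills `e`, hence is β times the cross product with
  -- `e`. The Jacobian of the chart is then β times `x₁`, so both factors are nonzero.
  set β := (py Y s * e.1 - px Y s * e.2) / n with hβ
  have hY1 : px Y s = -β * e.2 := by
    rw [hβ]; field_simp; rw [hnd]; linear_combination e.1 * hχe
  have hY2 : py Y s = β * e.1 := by
    rw [hβ]; field_simp; rw [hnd]; linear_combination e.2 * hχe
  have hβ0 : β ≠ 0 := by
    intro h
    rw [hY1, hY2, h] at hJ
    simp at hJ
  set x₁ := px X s * e.1 + py X s * e.2 with hx₁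
  have hx₁0 : x₁ ≠ 0 := by
    intro h
    refine hJ ?_
    rw [hY1, hY2]
    linear_combination β * h
  set q := px (px Y) s * e.1 ^ 2 + 2 * px (py Y) s * e.1 * e.2 + py (py Y) s * e.2 ^ 2 with hq
  refine ⟨-q / (β * n), 2 * x₁ ^ 2 / (β * n), by positivity, fun A k α hA hα => ?_⟩
  obtain ⟨γ, hγ, hγα⟩ := hα.1.exists_contDiff
  set a : ℝ → ℝ := fun t => (γ t).1 with ha
  set b : ℝ → ℝ := fun t => (γ t).2 with hb
  have has : ContDiff ℝ ∞ a := hγ.fst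
  have hbs : ContDiff ℝ ∞ b := hγ.snd
  have hab : (fun t => (a t, b t)) =ᶠ[𝓝 0] α := hγα
  have hs0 : (a 0, b 0) = s := hab.self_of_nhds.trans hα.2.1
  obtain ⟨c, hc, hc0, hc1, hc2, hu⟩ := hA
  have hmem := IsGraphCurve.eventually_mem_of_parametrizesAt hα
  have hcont : Tendsto α (𝓝 0) (𝓝 s) := by
    have := hα.1.contDiffAt.continuousAt
    rwa [ContinuousAt, hα.2.1] at this
  have heq : (fun t => Y (a t, b t)) =ᶠ[𝓝 0] fun t => c (X (a t, b t)) := by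
    filter_upwards [hmem, hcont.eventually hu, hab] with t h1 h2 h3
    rw [show (a t, b t) = α t from h3]
    exact h2.1 h1
  have hXab : ContDiff ℝ ∞ fun t => X (a t, b t) := hXs.comp (has.prodMk hbs)
  have h1 := heq.deriv.self_of_nhds
  have h2 := heq.deriv.deriv.self_of_nhds
  have hXs0 : X s = 0 := by simp [hX, hχ.map_base]
  rw [(deriv_deriv_comp hc hXab).2, deriv_deriv_curve hYs has hbs] at h2
  rw [(deriv_deriv_comp hc hXab).1, deriv_curve hYs has hbs] at h1
  rw [deriv_curve hXs has hbs] at h2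
  simp only [hs0, hXs0, hc1, hc2, zero_mul, add_zero] at h1 h2
  set m := (deriv a 0 * e.1 + deriv b 0 * e.2) / n with hm
  rw [hY1, hY2] at h1
  have h1' : e.1 * deriv b 0 - e.2 * deriv a 0 = 0 := by
    have : β * (e.1 * deriv b 0 - e.2 * deriv a 0) = 0 := by linarith
    exact (mul_eq_zero.1 this).resolve_left hβ0
  have ha1 : deriv a 0 = m * e.1 := by
    rw [hm]; field_simp; rw [hnd]; linear_combination (-e.2) * h1'
  have hb1 : deriv b 0 = m * e.2 := by
    rw [hm]; field_simp; rw [hnd]; linear_combination (e.1) * h1'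
  have hm0 : m ≠ 0 := by
    intro h
    apply hα.2.2.1
    rw [← hab.deriv_eq, deriv_pair has hbs, ha1, hb1, h]
    simp
  refine ⟨m, hm0, ?_⟩
  have h3 := (hasDerivAt_contactLift has hbs he hm0 ha1 hb1).congr_of_eventuallyEq
    (contactLift_congr e hab.symm)
  rw [ha1, hb1, hY1, hY2] at h2
  -- Second derivative at 0 of Y = c(X) along the curve: the Hessian of Y contributes m²q, the
  -- acceleration contributes β e × α'', and the right side is 2k(m x₁)². Dividing by the
  -- normalization of the slope shows that it is affine in k.
  have h4 : β * (e.1 * deriv (deriv b) 0 - e.2 * deriv (deriv a) 0) =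
      m ^ 2 * (2 * k * x₁ ^ 2 - q) := by
    rw [hx₁, hq]; linear_combination h2
  have h5 : m * (-q / (β * n) + 2 * x₁ ^ 2 / (β * n) * k) =
      (e.1 * deriv (deriv b) 0 - e.2 * deriv (deriv a) 0) / (m * (e.1 ^ 2 + e.2 ^ 2)) := by
    rw [← hnd]
    field_simp
    linear_combination -h4
  rw [h5]
  exact h3

/-- The cross-ratio of the tangent lines of the Legendrian lifts in terms of the coefficients of
the curves. -/
theorem crossRatio_contactLift {χ ξ : ℝ × ℝ → ℝ × ℝ} {s : ℝ × ℝ} (hχ : IsChartAt χ ξ s)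
    {e : ℝ × ℝ} (he : e ≠ 0) (hχe : (fderiv ℝ χ s e).2 = 0) {A B D : Set (ℝ × ℝ)} {i j k : ℝ}
    (hA : IsGraphCurve χ s A i) (hB : IsGraphCurve χ s B j) (hD : IsGraphCurve χ s D k)
    (hjk : j ≠ k) {α β δ : ℝ → ℝ × ℝ} (hα : ParametrizesAt α A s) (hβ : ParametrizesAt β B s)
    (hδ : ParametrizesAt δ D s) :
    ∃ l m n : ℝ × ℝ, HasDerivAt (contactLift e α) (l.1 • e, l.2) 0 ∧
      HasDerivAt (contactLift e β) (m.1 • e, m.2) 0 ∧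
      HasDerivAt (contactLift e δ) (n.1 • e, n.2) 0 ∧ cross m n ≠ 0 ∧
      crossRatio l m n (0, 1) = (k - i) / (k - j) := by
  obtain ⟨a, b, hb, h⟩ := exists_slope_contactLift hχ he hχe
  obtain ⟨l, hl, hl'⟩ := h A i α hA hα
  obtain ⟨m, hm, hm'⟩ := h B j β hB hβ
  obtain ⟨n, hn, hn'⟩ := h D k δ hD hδ
  have hkj : k - j ≠ 0 := sub_ne_zero.2 hjk.symm
  have hmn : m * (n * (a + b * k)) - m * (a + b * j) * n = m * n * (b * (k - j)) := by ring
  refine ⟨(l, l * (a + b * i)), (m, m * (a + b * j)), (n, n * (a + b * k)), hl', hm', hn', ?_, ?_⟩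
  · simp only [cross]
    rw [hmn]
    positivity
  · simp only [crossRatio, cross]
    rw [hmn]
    field_simp
    ring

theorem HasDerivAt.contactLift_unique {e : ℝ × ℝ} (he : e ≠ 0) {α : ℝ → ℝ × ℝ} {l m : ℝ × ℝ}
    (hl : HasDerivAt (contactLift e α) (l.1 • e, l.2) 0)
    (hm : HasDerivAt (contactLift e α) (m.1 • e, m.2) 0) : l = m := by
  have h := Prod.ext_iff.1 (hl.unique hm)
  exact Prod.ext (smul_left_injective ℝ he h.1) h.2

/-! ### The dual surface as a graph -/

/-- The graph of `f` in homogeneous coordinates. -/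
def graphPlane (f : ℝ × ℝ → ℝ) (p : ℝ × ℝ) : Fin 4 → ℝ := ![p.1, p.2, f p, 1]

/-- The tangent plane of the graph of `f`. -/
noncomputable def graphPoint (f : ℝ × ℝ → ℝ) (p : ℝ × ℝ) : Fin 4 → ℝ :=
  ![px f p, py f p, -1, f p - p.1 * px f p - p.2 * py f p]

noncomputable def hess (f : ℝ × ℝ → ℝ) (p v w : ℝ × ℝ) : ℝ :=
  px (px f) p * v.1 * w.1 + px (py f) p * (v.1 * w.2 + v.2 * w.1) + py (py f) p * v.2 * w.2

noncomputable def hessDet (f : ℝ × ℝ → ℝ) (p : ℝ × ℝ) : ℝ :=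
  px (px f) p * py (py f) p - px (py f) p ^ 2

noncomputable def cubicForm (f : ℝ × ℝ → ℝ) (p v : ℝ × ℝ) : ℝ :=
  px (px (px f)) p * v.1 ^ 3 + 3 * px (px (py f)) p * v.1 ^ 2 * v.2 +
    3 * px (py (py f)) p * v.1 * v.2 ^ 2 + py (py (py f)) p * v.2 ^ 3

/-- A front whose dual is, in suitable projective coordinates and in the chart `χ`, the graph
of `f`. -/
structure Front.IsDualGraph (T : Front) (s : ℝ × ℝ) (χ ξ : ℝ × ℝ → ℝ × ℝ) (f lam mu : ℝ × ℝ → ℝ)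
    (L L' : (Fin 4 → ℝ) →L[ℝ] (Fin 4 → ℝ)) : Prop where
  chart : IsChartAt χ ξ s
  mem : s ∈ T.dom
  left_inv : ∀ u ∈ T.dom, ξ (χ u) = u
  right_inv : ∀ u ∈ T.dom, ∀ᶠ p in 𝓝 (χ u), χ (ξ p) = p
  contDiff : ContDiff ℝ ∞ f
  contDiff_lam : ContDiff ℝ ∞ lam
  contDiff_mu : ContDiff ℝ ∞ mu
  lam_ne : ∀ u ∈ T.dom, lam u ≠ 0
  mu_ne : ∀ u ∈ T.dom, mu u ≠ 0
  pairing : ∀ p q, L' p ⬝ᵥ L q = p ⬝ᵥ q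
  plane_eq : ∀ u ∈ T.dom, T.plane u = lam u • L' (graphPlane f (χ u))
  point_eq : ∀ u ∈ T.dom, T.point u = mu u • L (graphPoint f (χ u))

theorem hasDerivAt_vec4 {a b c d : ℝ → ℝ} {a' b' c' d' t : ℝ} (ha : HasDerivAt a a' t)
    (hb : HasDerivAt b b' t) (hc : HasDerivAt c c' t) (hd : HasDerivAt d d' t) :
    HasDerivAt (fun t => ![a t, b t, c t, d t]) ![a', b', c', d'] t := by
  rw [hasDerivAt_pi]
  intro i
  fin_cases i <;> simpa

theorem hasDerivAt_graphPlane {f : ℝ × ℝ → ℝ} (hf : ContDiff ℝ ∞ f) {p : ℝ → ℝ × ℝ} {w : ℝ × ℝ}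
    {t : ℝ} (hp : HasDerivAt p w t) : HasDerivAt (fun t => graphPlane f (p t))
      ![w.1, w.2, px f (p t) * w.1 + py f (p t) * w.2, 0] t :=
  hasDerivAt_vec4 hp.fst hp.snd (hasDerivAt_curve (hf.differentiable (by simp) _) rfl hp)
    (hasDerivAt_const t 1)

theorem hasDerivAt_graphPoint {f : ℝ × ℝ → ℝ} (hf : ContDiff ℝ ∞ f) {p : ℝ → ℝ × ℝ} {w : ℝ × ℝ}
    {t : ℝ} (hp : HasDerivAt p w t) : HasDerivAt (fun t => graphPoint f (p t))
      ![px (px f) (p t) * w.1 + px (py f) (p t) * w.2,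
        px (py f) (p t) * w.1 + py (py f) (p t) * w.2, 0,
        -((p t).1 * (px (px f) (p t) * w.1 + px (py f) (p t) * w.2) +
          (p t).2 * (px (py f) (p t) * w.1 + py (py f) (p t) * w.2))] t := by
  have h0 := hasDerivAt_curve (hf.differentiable (by simp) _) rfl hp
  have h1 := hasDerivAt_curve (hf.px.differentiable (by simp) _) rfl hp
  have h2 := hasDerivAt_curve (hf.py.differentiable (by simp) _) rfl hp
  rw [py_px hf] at h1
  have hp1 : HasDerivAt (fun t => (p t).1) w.1 t := hp.fst
  have hp2 : HasDerivAt (fun t => (p t).2) w.2 t := hp.snd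
  have h3 := (h0.fun_sub (hp1.fun_mul h1)).fun_sub (hp2.fun_mul h2)
  refine (hasDerivAt_vec4 h1 h2 (hasDerivAt_const t (-1)) h3).congr_deriv ?_
  congr 4
  ring

theorem contDiff_vec4 {E : Type*} [NormedAddCommGroup E] [NormedSpace ℝ E] {a b c d : E → ℝ}
    (ha : ContDiff ℝ ∞ a) (hb : ContDiff ℝ ∞ b)
    (hc : ContDiff ℝ ∞ c) (hd : ContDiff ℝ ∞ d) :
    ContDiff ℝ ∞ (fun t => ![a t, b t, c t, d t]) := by
  rw [contDiff_pi]
  intro i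
  fin_cases i <;> simpa

theorem contDiff_graphPlane {f : ℝ × ℝ → ℝ} (hf : ContDiff ℝ ∞ f) :
    ContDiff ℝ ∞ (graphPlane f) := contDiff_vec4 contDiff_fst contDiff_snd hf contDiff_const

theorem contDiff_graphPoint {f : ℝ × ℝ → ℝ} (hf : ContDiff ℝ ∞ f) :
    ContDiff ℝ ∞ (graphPoint f) := contDiff_vec4 hf.px hf.py contDiff_const
  ((hf.sub (contDiff_fst.mul hf.px)).sub (contDiff_snd.mul hf.py))

/-! ### Fundamental forms of a front and of its dual in the graph chart. -/

namespace Front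

theorem eventually_mem_dom (T : Front) {u : ℝ × ℝ} (hu : u ∈ T.dom) : ∀ᶠ w in 𝓝 u, w ∈ T.dom :=
  T.isOpen_dom.mem_nhds hu

theorem differentiableAt_point (T : Front) {u : ℝ × ℝ} (hu : u ∈ T.dom) :
    DifferentiableAt ℝ T.point u :=
  (T.smooth_point.contDiffAt (T.isOpen_dom.mem_nhds hu)).differentiableAt (by simp)

theorem differentiableAt_plane (T : Front) {u : ℝ × ℝ} (hu : u ∈ T.dom) :
    DifferentiableAt ℝ T.plane u := T.dual.differentiableAt_point hu

theorem differentiableAt_fderiv_point (T : Front) {u : ℝ × ℝ} (hu : u ∈ T.dom) :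
    DifferentiableAt ℝ (fderiv ℝ T.point) u :=
  ((T.smooth_point.contDiffAt (T.isOpen_dom.mem_nhds hu)).fderiv_right (m := ∞)
    (by simp)).differentiableAt (by simp)

theorem hasDerivAt_dotProduct {p q : ℝ → Fin 4 → ℝ} {p' q' : Fin 4 → ℝ} {t : ℝ}
    (hp : HasDerivAt p p' t) (hq : HasDerivAt q q' t) :
    HasDerivAt (fun t => p t ⬝ᵥ q t) (p' ⬝ᵥ q t + p t ⬝ᵥ q') t := by
  have := HasDerivAt.fun_sum (u := Finset.univ)
    (fun (i : Fin 4) _ => (hasDerivAt_pi.1 hp i).fun_mul (hasDerivAt_pi.1 hq i))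
  simpa only [dotProduct, Finset.sum_add_distrib] using this

theorem hasDerivAt_line (u v : ℝ × ℝ) : HasDerivAt (fun t : ℝ => u + t • v) v 0 := by
  simpa using ((hasDerivAt_id (0 : ℝ)).smul_const v).const_add u

/-- Obtained by differentiating the Legendre condition. In this form points and planes play
symmetric roles, so it also computes the second form of the dual. -/
theorem secondForm_eq (T : Front) {u : ℝ × ℝ} (hu : u ∈ T.dom) (v w : ℝ × ℝ) :
    T.secondForm u v w = -(fderiv ℝ T.plane u v ⬝ᵥ fderiv ℝ T.point u w) := by
  have hl := hasDerivAt_line u v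
  have hl0 : u + (0 : ℝ) • v = u := by simp
  have h1 : HasDerivAt (fun t : ℝ => T.plane (u + t • v)) (fderiv ℝ T.plane u v) 0 :=
    HasFDerivAt.comp_hasDerivAt (0 : ℝ) (by rw [hl0]; exact (T.differentiableAt_plane hu).hasFDerivAt)
      hl
  have h2 : HasDerivAt (fun t : ℝ => fderiv ℝ T.point (u + t • v))
      (fderiv ℝ (fderiv ℝ T.point) u v) 0 :=
    HasFDerivAt.comp_hasDerivAt (0 : ℝ)
      (by rw [hl0]; exact (T.differentiableAt_fderiv_point hu).hasFDerivAt) hl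
  have h3 : HasDerivAt (fun t : ℝ => fderiv ℝ T.point (u + t • v) w)
      (fderiv ℝ (fderiv ℝ T.point) u v w) 0 := by
    simpa using h2.clm_apply (hasDerivAt_const (0 : ℝ) w)
  have h4 := hasDerivAt_dotProduct h1 h3
  have h5 : (fun t : ℝ => T.plane (u + t • v) ⬝ᵥ fderiv ℝ T.point (u + t • v) w) =ᶠ[𝓝 0]
      fun _ => 0 := by
    have ht : Tendsto (fun t : ℝ => u + t • v) (𝓝 0) (𝓝 u) := by
      have := hl.continuousAt
      rwa [ContinuousAt, hl0] at this
    filter_upwards [ht.eventually (T.eventually_mem_dom hu)] with t h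
    exact T.legendrian _ h w
  have h6 := h4.unique ((hasDerivAt_const (0 : ℝ) (0 : ℝ)).congr_of_eventuallyEq h5)
  rw [hl0] at h6
  rw [secondForm]
  linarith

namespace IsDualGraph

variable {T : Front} {s : ℝ × ℝ} {χ ξ : ℝ × ℝ → ℝ × ℝ} {f lam mu : ℝ × ℝ → ℝ}
  {L L' : (Fin 4 → ℝ) →L[ℝ] (Fin 4 → ℝ)}

/-- The two coordinate changes are contragredient, so the nondegenerate dot product makes each of
them injective. -/
theorem L_injective (h : T.IsDualGraph s χ ξ f lam mu L L') : Function.Injective L := by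
  intro p q hpq
  refine dotProduct_eq _ _ fun w => ?_
  rw [dotProduct_comm, ← h.pairing, hpq, h.pairing, dotProduct_comm]

theorem L'_injective (h : T.IsDualGraph s χ ξ f lam mu L L') : Function.Injective L' := by
  intro p q hpq
  refine dotProduct_eq _ _ fun w => ?_
  rw [← h.pairing, hpq, h.pairing]

theorem hasDerivAt_plane (h : T.IsDualGraph s χ ξ f lam mu L L') {γ : ℝ → ℝ × ℝ} {v : ℝ × ℝ}
    {t : ℝ} (hγ : HasDerivAt γ v t) (ht : γ t ∈ T.dom) (w : ℝ × ℝ)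
    (hw : fderiv ℝ χ (γ t) v = w) :
    ∃ a : ℝ, HasDerivAt (fun t => T.plane (γ t)) (a • L' (graphPlane f (χ (γ t))) + lam (γ t) •
      L' ![w.1, w.2, px f (χ (γ t)) * w.1 + py f (χ (γ t)) * w.2, 0]) t := by
  have h1 : HasDerivAt (fun t => χ (γ t)) w t := by
    rw [← hw]
    exact (h.chart.contDiff.differentiable (by simp) _).hasFDerivAt.comp_hasDerivAt t hγ
  have h2 := hasDerivAt_graphPlane h.contDiff h1
  have h3 : HasDerivAt (fun t => L' (graphPlane f (χ (γ t)))) _ t :=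
    L'.hasFDerivAt.comp_hasDerivAt t h2
  have h4 : HasDerivAt (fun t => lam (γ t)) _ t :=
    (h.contDiff_lam.differentiable (by simp) _).hasFDerivAt.comp_hasDerivAt t hγ
  have h5 := h4.fun_smul h3
  refine ⟨fderiv ℝ lam (γ t) v, ?_⟩
  rw [add_comm]
  refine h5.congr_of_eventuallyEq ?_
  filter_upwards [hγ.continuousAt.eventually (T.eventually_mem_dom ht)] with r hr
  exact h.plane_eq _ hr

theorem hasDerivAt_point (h : T.IsDualGraph s χ ξ f lam mu L L') {γ : ℝ → ℝ × ℝ} {v : ℝ × ℝ}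
    {t : ℝ} (hγ : HasDerivAt γ v t) (ht : γ t ∈ T.dom) (w : ℝ × ℝ)
    (hw : fderiv ℝ χ (γ t) v = w) :
    ∃ a : ℝ, HasDerivAt (fun t => T.point (γ t)) (a • L (graphPoint f (χ (γ t))) + mu (γ t) •
      L ![px (px f) (χ (γ t)) * w.1 + px (py f) (χ (γ t)) * w.2,
        px (py f) (χ (γ t)) * w.1 + py (py f) (χ (γ t)) * w.2, 0,
        -((χ (γ t)).1 * (px (px f) (χ (γ t)) * w.1 + px (py f) (χ (γ t)) * w.2) +
          (χ (γ t)).2 * (px (py f) (χ (γ t)) * w.1 + py (py f) (χ (γ t)) * w.2))]) t := by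
  have h1 : HasDerivAt (fun t => χ (γ t)) w t := by
    rw [← hw]
    exact (h.chart.contDiff.differentiable (by simp) _).hasFDerivAt.comp_hasDerivAt t hγ
  have h2 := hasDerivAt_graphPoint h.contDiff h1
  have h3 : HasDerivAt (fun t => L (graphPoint f (χ (γ t)))) _ t :=
    L.hasFDerivAt.comp_hasDerivAt t h2
  have h4 : HasDerivAt (fun t => mu (γ t)) _ t :=
    (h.contDiff_mu.differentiable (by simp) _).hasFDerivAt.comp_hasDerivAt t hγ
  have h5 := h4.fun_smul h3
  refine ⟨fderiv ℝ mu (γ t) v, ?_⟩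
  rw [add_comm]
  refine h5.congr_of_eventuallyEq ?_
  filter_upwards [hγ.continuousAt.eventually (T.eventually_mem_dom ht)] with r hr
  exact h.point_eq _ hr

theorem fderiv_plane (h : T.IsDualGraph s χ ξ f lam mu L L') {u : ℝ × ℝ} (hu : u ∈ T.dom)
    (v w : ℝ × ℝ) (hw : fderiv ℝ χ u v = w) : ∃ a : ℝ, fderiv ℝ T.plane u v =
      a • L' (graphPlane f (χ u)) + lam u •
        L' ![w.1, w.2, px f (χ u) * w.1 + py f (χ u) * w.2, 0] := by
  have hl := hasDerivAt_line u v
  have hl0 : u + (0 : ℝ) • v = u := by simp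
  obtain ⟨a, ha⟩ := h.hasDerivAt_plane hl (by rwa [hl0]) w (by rwa [hl0])
  rw [hl0] at ha
  exact ⟨a, (HasFDerivAt.comp_hasDerivAt (0 : ℝ)
    (by rw [hl0]; exact (T.differentiableAt_plane hu).hasFDerivAt) hl).unique ha⟩

theorem fderiv_point (h : T.IsDualGraph s χ ξ f lam mu L L') {u : ℝ × ℝ} (hu : u ∈ T.dom)
    (v w : ℝ × ℝ) (hw : fderiv ℝ χ u v = w) : ∃ a : ℝ, fderiv ℝ T.point u v =
      a • L (graphPoint f (χ u)) + mu u •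
      L ![px (px f) (χ u) * w.1 + px (py f) (χ u) * w.2,
        px (py f) (χ u) * w.1 + py (py f) (χ u) * w.2, 0,
        -((χ u).1 * (px (px f) (χ u) * w.1 + px (py f) (χ u) * w.2) +
          (χ u).2 * (px (py f) (χ u) * w.1 + py (py f) (χ u) * w.2))] := by
  have hl := hasDerivAt_line u v
  have hl0 : u + (0 : ℝ) • v = u := by simp
  obtain ⟨a, ha⟩ := h.hasDerivAt_point hl (by rwa [hl0]) w (by rwa [hl0])
  rw [hl0] at ha
  exact ⟨a, (HasFDerivAt.comp_hasDerivAt (0 : ℝ)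
    (by rw [hl0]; exact (T.differentiableAt_point hu).hasFDerivAt) hl).unique ha⟩

/-- By the contragredient pairing the frame disappears. The terms along the plane and the point
themselves drop out by incidence and tangency, and the Hessian of `f` is left. -/
theorem fderiv_plane_dotProduct_fderiv_point (h : T.IsDualGraph s χ ξ f lam mu L L')
    {u : ℝ × ℝ} (hu : u ∈ T.dom) (v w : ℝ × ℝ) :
    fderiv ℝ T.plane u v ⬝ᵥ fderiv ℝ T.point u w =
      lam u * mu u * hess f (χ u) (fderiv ℝ χ u v) (fderiv ℝ χ u w) := by
  obtain ⟨a, ha⟩ := h.fderiv_plane hu v _ rfl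
  obtain ⟨b, hb⟩ := h.fderiv_point hu w _ rfl
  rw [ha, hb]
  simp only [add_dotProduct, dotProduct_add, smul_dotProduct, dotProduct_smul, h.pairing]
  simp only [dotProduct, graphPlane, graphPoint, Fin.sum_univ_four, smul_eq_mul, hess]
  simp
  ring

theorem secondForm_eq (h : T.IsDualGraph s χ ξ f lam mu L L') {u : ℝ × ℝ} (hu : u ∈ T.dom)
    (v w : ℝ × ℝ) : T.secondForm u v w =
      -(lam u * mu u * hess f (χ u) (fderiv ℝ χ u v) (fderiv ℝ χ u w)) := by
  rw [T.secondForm_eq hu, h.fderiv_plane_dotProduct_fderiv_point hu]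

theorem dual_secondForm_eq (h : T.IsDualGraph s χ ξ f lam mu L L') {u : ℝ × ℝ} (hu : u ∈ T.dom)
    (v w : ℝ × ℝ) : T.dual.secondForm u v w =
      -(lam u * mu u * hess f (χ u) (fderiv ℝ χ u v) (fderiv ℝ χ u w)) := by
  rw [T.dual.secondForm_eq hu]
  have := h.fderiv_plane_dotProduct_fderiv_point hu w v
  rw [dotProduct_comm] at this
  change -(fderiv ℝ T.point u v ⬝ᵥ fderiv ℝ T.plane u w) = _
  rw [this]
  simp only [hess]
  ring

/-- Both discriminants carry the same square factor. Hence the front at its regular points and the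
dual surface are elliptic, or hyperbolic, for the same parameters. -/
theorem disc_eq (h : T.IsDualGraph s χ ξ f lam mu L L') {u : ℝ × ℝ} (hu : u ∈ T.dom) :
    ∃ k : ℝ, k ≠ 0 ∧ T.disc u = k ^ 2 * hessDet f (χ u) ∧
      T.dual.disc u = k ^ 2 * hessDet f (χ u) := by
  have hev : ∀ᶠ w in 𝓝 u, ξ (χ w) = w := by
    filter_upwards [T.eventually_mem_dom hu] with w hw
    exact h.left_inv w hw
  refine ⟨lam u * mu u * _,
    mul_ne_zero (mul_ne_zero (h.lam_ne u hu) (h.mu_ne u hu)) (h.chart.jacobian_ne_zero hev), ?_, ?_⟩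
  · simp only [disc, h.secondForm_eq hu, h.chart.fderiv_eq, hess, hessDet]
    ring
  · simp only [disc, h.dual_secondForm_eq hu, h.chart.fderiv_eq, hess, hessDet]
    ring

end IsDualGraph

end Front

/-! ### Calculus of partial derivatives and the normal jet at a godron. -/

theorem px_mul {f g : ℝ × ℝ → ℝ} (hf : ContDiff ℝ ∞ f) (hg : ContDiff ℝ ∞ g) :
    px (fun p => f p * g p) = fun p => px f p * g p + f p * px g p := by
  funext p
  rw [px, fderiv_fun_mul (hf.differentiable (by simp) p) (hg.differentiable (by simp) p)]
  simp [px]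
  ring

theorem py_mul {f g : ℝ × ℝ → ℝ} (hf : ContDiff ℝ ∞ f) (hg : ContDiff ℝ ∞ g) :
    py (fun p => f p * g p) = fun p => py f p * g p + f p * py g p := by
  funext p
  rw [py, fderiv_fun_mul (hf.differentiable (by simp) p) (hg.differentiable (by simp) p)]
  simp [py]
  ring

theorem px_add {f g : ℝ × ℝ → ℝ} (hf : ContDiff ℝ ∞ f) (hg : ContDiff ℝ ∞ g) :
    px (fun p => f p + g p) = fun p => px f p + px g p := by
  funext p
  rw [px, fderiv_fun_add (hf.differentiable (by simp) p) (hg.differentiable (by simp) p)]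
  rfl

theorem py_add {f g : ℝ × ℝ → ℝ} (hf : ContDiff ℝ ∞ f) (hg : ContDiff ℝ ∞ g) :
    py (fun p => f p + g p) = fun p => py f p + py g p := by
  funext p
  rw [py, fderiv_fun_add (hf.differentiable (by simp) p) (hg.differentiable (by simp) p)]
  rfl

theorem px_sub {f g : ℝ × ℝ → ℝ} (hf : ContDiff ℝ ∞ f) (hg : ContDiff ℝ ∞ g) :
    px (fun p => f p - g p) = fun p => px f p - px g p := by
  funext p
  rw [px, fderiv_fun_sub (hf.differentiable (by simp) p) (hg.differentiable (by simp) p)]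
  rfl

theorem py_sub {f g : ℝ × ℝ → ℝ} (hf : ContDiff ℝ ∞ f) (hg : ContDiff ℝ ∞ g) :
    py (fun p => f p - g p) = fun p => py f p - py g p := by
  funext p
  rw [py, fderiv_fun_sub (hf.differentiable (by simp) p) (hg.differentiable (by simp) p)]
  rfl

/-- The relevant part of the Taylor expansion `y²/2 - x² y + ρ x⁴/2 + ⋯` at a godron. -/
structure IsGodronJet (f : ℝ × ℝ → ℝ) (ρ : ℝ) : Prop where
  zero : f 0 = 0
  x : px f 0 = 0
  y : py f 0 = 0
  xx : px (px f) 0 = 0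
  xy : px (py f) 0 = 0
  yy : py (py f) 0 = 1
  xxx : px (px (px f)) 0 = 0
  xxy : px (px (py f)) 0 = -2
  xxxx : px (px (px (px f))) 0 = 12 * ρ

theorem contDiff_hessDet {f : ℝ × ℝ → ℝ} (hf : ContDiff ℝ ∞ f) : ContDiff ℝ ∞ (hessDet f) :=
  (hf.px.px.mul hf.py.py).sub (hf.py.px.pow 2)

/-- For the leading part, f_xx f_yy - f_xy² is (6ρx² - 2y) - 4x², whence the parabolic coefficient
3ρ - 2. -/
theorem IsGodronJet.hessDet {f : ℝ × ℝ → ℝ} {ρ : ℝ} (h : IsGodronJet f ρ) (hf : ContDiff ℝ ∞ f) :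
    hessDet f 0 = 0 ∧ px (hessDet f) 0 = 0 ∧ py (hessDet f) 0 = -2 ∧
      px (px (hessDet f)) 0 = 12 * ρ - 8 := by
  have e : _root_.hessDet f = fun p => px (px f) p * py (py f) p - px (py f) p * px (py f) p := by
    funext p; rw [_root_.hessDet, sq]
  have hA := hf.px.px
  have hB := hf.py.py
  have hC := hf.py.px
  have e1 : px (_root_.hessDet f) = fun p => (px (px (px f)) p * py (py f) p +
      px (px f) p * px (py (py f)) p) - (px (px (py f)) p * px (py f) p +
        px (py f) p * px (px (py f)) p) := by
    rw [e, px_sub (hA.mul hB) (hC.mul hC), px_mul hA hB, px_mul hC hC]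
  have e2 : py (_root_.hessDet f) = fun p => (px (px (py f)) p * py (py f) p +
      px (px f) p * py (py (py f)) p) - (px (py (py f)) p * px (py f) p +
        px (py f) p * px (py (py f)) p) := by
    rw [e, py_sub (hA.mul hB) (hC.mul hC), py_mul hA hB, py_mul hC hC, py_px hf.px, py_px hf,
      py_px hf.py]
  refine ⟨by simp [e, h.xx, h.xy], by simp [e1, h.xxx, h.xx, h.xy],
    by simp [e2, h.xxy, h.yy, h.xx, h.xy], ?_⟩
  rw [e1, px_sub ((hA.px.mul hB).add (hA.mul hB.px)) ((hC.px.mul hC).add (hC.mul hC.px)),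
    px_add (hA.px.mul hB) (hA.mul hB.px), px_add (hC.px.mul hC) (hC.mul hC.px),
    px_mul hA.px hB, px_mul hA hB.px, px_mul hC.px hC, px_mul hC hC.px]
  simp [h.xx, h.xy, h.yy, h.xxx, h.xxy, h.xxxx]
  ring

/-! ### Derivatives of curves in homogeneous coordinates. -/

theorem deriv_smul_curve {E : Type*} [NormedAddCommGroup E] [NormedSpace ℝ E] {m : ℝ → ℝ}
    {q : ℝ → E} (hm : ContDiff ℝ ∞ m) (hq : ContDiff ℝ ∞ q) :
    deriv (fun t => m t • q t) = fun t => m t • deriv q t + deriv m t • q t :=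
  funext fun t => deriv_fun_smul (hm.differentiable (by simp) t) (hq.differentiable (by simp) t)

theorem deriv_deriv_smul_curve {E : Type*} [NormedAddCommGroup E] [NormedSpace ℝ E] {m : ℝ → ℝ}
    {q : ℝ → E} (hm : ContDiff ℝ ∞ m) (hq : ContDiff ℝ ∞ q) :
    deriv (deriv (fun t => m t • q t)) = fun t =>
      m t • deriv (deriv q) t + (2 * deriv m t) • deriv q t + deriv (deriv m) t • q t := by
  rw [deriv_smul_curve hm hq]
  funext t
  have h1 : ContDiff ℝ ∞ fun t => m t • deriv q t := hm.smul hq.deriv_infty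
  have h2 : ContDiff ℝ ∞ fun t => deriv m t • q t := hm.deriv_infty.smul hq
  rw [deriv_fun_add (h1.differentiable (by simp) t) (h2.differentiable (by simp) t),
    deriv_smul_curve hm hq.deriv_infty, deriv_smul_curve hm.deriv_infty hq]
  simp only
  module

theorem deriv_deriv_deriv_smul_curve {E : Type*} [NormedAddCommGroup E] [NormedSpace ℝ E]
    {m : ℝ → ℝ} {q : ℝ → E} (hm : ContDiff ℝ ∞ m) (hq : ContDiff ℝ ∞ q) :
    deriv (deriv (deriv (fun t => m t • q t))) = fun t =>
      m t • deriv (deriv (deriv q)) t + (3 * deriv m t) • deriv (deriv q) t +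
      (3 * deriv (deriv m) t) • deriv q t + deriv (deriv (deriv m)) t • q t := by
  rw [deriv_smul_curve hm hq]
  funext t
  have h1 : ContDiff ℝ ∞ fun t => m t • deriv q t := hm.smul hq.deriv_infty
  have h2 : ContDiff ℝ ∞ fun t => deriv m t • q t := hm.deriv_infty.smul hq
  have e : deriv (fun t => m t • deriv q t + deriv m t • q t) = fun t =>
      deriv (fun t => m t • deriv q t) t + deriv (fun t => deriv m t • q t) t := funext fun t =>
    deriv_fun_add (h1.differentiable (by simp) t) (h2.differentiable (by simp) t)
  rw [e, deriv_fun_add (h1.deriv_infty.differentiable (by simp) t)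
    (h2.deriv_infty.differentiable (by simp) t), deriv_deriv_smul_curve hm hq.deriv_infty,
    deriv_deriv_smul_curve hm.deriv_infty hq]
  simp only
  module

theorem deriv_clm_curve {E F : Type*} [NormedAddCommGroup E] [NormedSpace ℝ E]
    [NormedAddCommGroup F] [NormedSpace ℝ F] (L : E →L[ℝ] F) {q : ℝ → E} (hq : ContDiff ℝ ∞ q) :
    deriv (fun t => L (q t)) = fun t => L (deriv q t) := funext fun t =>
  (L.hasFDerivAt.comp_hasDerivAt t (hq.differentiable (by simp) t).hasDerivAt).deriv

theorem deriv_vec4 {a b c d : ℝ → ℝ} (ha : ContDiff ℝ ∞ a) (hb : ContDiff ℝ ∞ b)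
    (hc : ContDiff ℝ ∞ c) (hd : ContDiff ℝ ∞ d) :
    deriv (fun t => ![a t, b t, c t, d t]) =
      fun t => ![deriv a t, deriv b t, deriv c t, deriv d t] := funext fun t =>
  (hasDerivAt_vec4 (ha.hasDerivAt' t) (hb.hasDerivAt' t) (hc.hasDerivAt' t)
    (hd.hasDerivAt' t)).deriv

/-- Derivatives of the tangent plane along the curve `y = k x² + ⋯`. -/
theorem IsGodronJet.deriv_graphPoint {f : ℝ × ℝ → ℝ} {ρ k : ℝ} (h : IsGodronJet f ρ)
    (hf : ContDiff ℝ ∞ f) {c : ℝ → ℝ} (hc : ContDiff ℝ ∞ c) (hc0 : c 0 = 0) (hc1 : deriv c 0 = 0)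
    (hc2 : deriv (deriv c) 0 = 2 * k) :
    let Q := fun t => graphPoint f (t, c t)
    Q 0 = ![0, 0, -1, 0] ∧ deriv Q 0 = 0 ∧ deriv (deriv Q) 0 = ![0, 2 * k - 2, 0, 0] ∧
      ∃ b : ℝ, deriv (deriv (deriv Q)) 0 = ![12 * (ρ - k), b, 0, 0] := by
  intro Q
  have hz : ((0 : ℝ), (0 : ℝ)) = 0 := rfl
  set q₁ := fun t => px f (t, c t) with hq₁
  set q₂ := fun t => py f (t, c t) with hq₂
  have h1s : ContDiff ℝ ∞ q₁ := hf.px.comp (contDiff_id.prodMk hc)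
  have h2s : ContDiff ℝ ∞ q₂ := hf.py.comp (contDiff_id.prodMk hc)
  -- The last coordinate is the Legendre transform of f, so its derivative involves only the
  -- derivatives of f_x and f_y, with coefficients vanishing at the origin. This is why it
  -- contributes nothing up to order three.
  have hd : deriv Q = fun t => ![deriv q₁ t, deriv q₂ t, 0, -(t * deriv q₁ t + c t * deriv q₂ t)] := by
    funext t
    have h1 := hasDerivAt_graphPoint hf ((hasDerivAt_id t).prodMk (hc.hasDerivAt' t))
    refine h1.deriv.trans ?_
    rw [hq₁, hq₂, deriv_curve (a := fun t => t) hf.px contDiff_id hc,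
      deriv_curve (a := fun t => t) hf.py contDiff_id hc]
    simp [py_px hf]
  have a1 := h1s.deriv_infty
  have a2 := h2s.deriv_infty
  have a3 := a1.deriv_infty
  have a4 := a2.deriv_infty
  have e1 : deriv (fun t => -(t * deriv q₁ t + c t * deriv q₂ t)) = fun t =>
      -(deriv q₁ t + t * deriv (deriv q₁) t + deriv c t * deriv q₂ t +
        c t * deriv (deriv q₂) t) := funext fun t => by
    rw [(((hasDerivAt_id' t).fun_mul (a1.hasDerivAt' t)).fun_add
      ((hc.hasDerivAt' t).fun_mul (a2.hasDerivAt' t))).fun_neg.deriv]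
    ring
  have e2 : deriv (fun t => -(deriv q₁ t + t * deriv (deriv q₁) t + deriv c t * deriv q₂ t +
        c t * deriv (deriv q₂) t)) 0 = -(2 * deriv (deriv q₁) 0 + deriv (deriv c) 0 * deriv q₂ 0 +
          2 * deriv c 0 * deriv (deriv q₂) 0 + c 0 * deriv (deriv (deriv q₂)) 0) := by
    rw [((((a1.hasDerivAt' 0).fun_add ((hasDerivAt_id' (0 : ℝ)).fun_mul (a3.hasDerivAt' 0))).fun_add
      ((hc.deriv_infty.hasDerivAt' 0).fun_mul (a2.hasDerivAt' 0))).fun_add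
      ((hc.hasDerivAt' 0).fun_mul (a4.hasDerivAt' 0))).fun_neg.deriv]
    ring
  have s4 : ContDiff ℝ ∞ (fun t => -(t * deriv q₁ t + c t * deriv q₂ t)) := by fun_prop
  have s5 : ContDiff ℝ ∞ (fun t => -(deriv q₁ t + t * deriv (deriv q₁) t + deriv c t * deriv q₂ t +
        c t * deriv (deriv q₂) t)) := by
    have := hc.deriv_infty
    fun_prop
  have hd2 : deriv (deriv Q) = fun t => ![deriv (deriv q₁) t, deriv (deriv q₂) t, 0,
      -(deriv q₁ t + t * deriv (deriv q₁) t + deriv c t * deriv q₂ t +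
        c t * deriv (deriv q₂) t)] := by
    rw [hd, deriv_vec4 a1 a2 contDiff_const s4, e1]
    simp
  have hd3 : deriv (deriv (deriv Q)) 0 = ![deriv (deriv (deriv q₁)) 0, deriv (deriv (deriv q₂)) 0,
      0, -(2 * deriv (deriv q₁) 0 + deriv (deriv c) 0 * deriv q₂ 0 +
          2 * deriv c 0 * deriv (deriv q₂) 0 + c 0 * deriv (deriv (deriv q₂)) 0)] := by
    rw [hd2, deriv_vec4 a3 a4 contDiff_const s5]
    simp only [e2, deriv_const]
  have v1 : deriv q₁ 0 = 0 := by
    rw [hq₁, deriv_curve (a := fun t => t) hf.px contDiff_id hc]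
    simp [hc0, hc1, hz, h.xx]
  have v2 : deriv (deriv q₁) 0 = 0 := by
    rw [hq₁, deriv_deriv_curve (a := fun t => t) hf.px contDiff_id hc]
    simp [hc0, hc1, hz, h.xx, h.xxx, py_px hf, h.xy]
  have v3 : deriv (deriv (deriv q₁)) 0 = 12 * (ρ - k) := by
    rw [hq₁, deriv_deriv_deriv_curve (a := fun t => t) hf.px contDiff_id hc]
    simp [hc0, hc1, hc2, hz, h.xx, h.xxx, py_px hf, h.xy, h.xxxx, h.xxy]
    ring
  have w1 : deriv q₂ 0 = 0 := by
    rw [hq₂, deriv_curve (a := fun t => t) hf.py contDiff_id hc]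
    simp [hc0, hc1, hz, h.xy]
  have w2 : deriv (deriv q₂) 0 = 2 * k - 2 := by
    rw [hq₂, deriv_deriv_curve (a := fun t => t) hf.py contDiff_id hc]
    simp [hc0, hc1, hc2, hz, h.xxy, h.yy]
    ring
  refine ⟨?_, ?_, ?_, deriv (deriv (deriv q₂)) 0, ?_⟩
  · simp [Q, graphPoint, hc0, hz, h.x, h.y, h.zero]
  · rw [hd]
    simp only [v1, w1]
    simp
  · rw [hd2]
    simp [v1, v2, w1, w2, hc0]
  · rw [hd3]
    simp [v2, v3, w1, w2, hc0, hc1]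

/-! ### The front read off from the graph of its dual. -/

namespace Front.IsDualGraph

variable {T : Front} {s : ℝ × ℝ} {χ ξ : ℝ × ℝ → ℝ × ℝ} {f lam mu : ℝ × ℝ → ℝ}
  {L L' : (Fin 4 → ℝ) →L[ℝ] (Fin 4 → ℝ)}

theorem fderiv_surjective (h : T.IsDualGraph s χ ξ f lam mu L L') {u : ℝ × ℝ} (hu : u ∈ T.dom)
    (w : ℝ × ℝ) : ∃ v, fderiv ℝ χ u v = w := by
  have h1 : HasFDerivAt (fun p => χ (ξ p)) ((fderiv ℝ χ u).comp (fderiv ℝ ξ (χ u))) (χ u) := by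
    refine HasFDerivAt.comp (χ u) ?_
      (h.chart.contDiff_inv.differentiable (by simp) (χ u)).hasFDerivAt
    rw [h.left_inv u hu]
    exact (h.chart.contDiff.differentiable (by simp) u).hasFDerivAt
  have h2 : HasFDerivAt (fun p => χ (ξ p)) (ContinuousLinearMap.id ℝ (ℝ × ℝ)) (χ u) :=
    (hasFDerivAt_id _).congr_of_eventuallyEq (h.right_inv u hu)
  exact ⟨fderiv ℝ ξ (χ u) w,
    congrArg (fun L : ℝ × ℝ →L[ℝ] ℝ × ℝ => L w) (h1.unique h2)⟩

theorem fderiv_injective (h : T.IsDualGraph s χ ξ f lam mu L L') {u : ℝ × ℝ} (hu : u ∈ T.dom)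
    {v : ℝ × ℝ} (hv : fderiv ℝ χ u v = 0) : v = 0 := by
  refine h.chart.fderiv_injective ?_ hv
  filter_upwards [T.eventually_mem_dom hu] with w hw
  exact h.left_inv w hw

/-- In these coordinates the point is given by the gradient of f together with its Legendre
transform, so its differential is injective exactly when the Hessian is nondegenerate. -/
theorem isRegular_iff (h : T.IsDualGraph s χ ξ f lam mu L L') {u : ℝ × ℝ} (hu : u ∈ T.dom) :
    T.IsRegular u ↔ hessDet f (χ u) ≠ 0 := by
  constructor
  · rintro ⟨-, hr⟩
    have : px (px f) (χ u) * py (py f) (χ u) - px (py f) (χ u) * px (py f) (χ u) ≠ 0 := by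
      refine det_ne_zero_of_injective fun w h1 h2 => ?_
      obtain ⟨v, hv⟩ := h.fderiv_surjective hu w
      obtain ⟨a, ha⟩ := h.fderiv_point hu v w hv
      have : v = 0 := by
        refine hr v ⟨a / mu u, ?_⟩
        have hz : (![0, 0, 0, 0] : Fin 4 → ℝ) = 0 := by ext i; fin_cases i <;> rfl
        rw [ha, h.point_eq u hu, h1, h2]
        simp only [mul_zero, add_zero, neg_zero, hz, map_zero, smul_zero, smul_smul]
        rw [div_mul_cancel₀ _ (h.mu_ne u hu)]
      rw [← hv, this, map_zero]
    rwa [hessDet, sq]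
  · intro hd
    refine ⟨hu, fun v ⟨b, hb⟩ => ?_⟩
    obtain ⟨a, ha⟩ := h.fderiv_point hu v _ rfl
    rw [hb, h.point_eq u hu, ← map_smul, ← map_smul, ← map_smul, ← map_smul, ← map_add] at ha
    have h1 := h.L_injective ha
    have i0 := congrFun h1 0
    have i1 := congrFun h1 1
    have i2 := congrFun h1 2
    simp [graphPoint] at i0 i1 i2
    have hm := h.mu_ne u hu
    have e : b * mu u = a := by linarith
    rw [← mul_assoc, e, left_eq_add, mul_eq_zero, or_iff_right hm] at i0 i1
    have hw : fderiv ℝ χ u v = 0 := by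
      rw [hessDet] at hd
      ext
      · refine (mul_eq_zero.1 ?_).resolve_left hd
        linear_combination py (py f) (χ u) * i0 - px (py f) (χ u) * i1
      · refine (mul_eq_zero.1 ?_).resolve_left hd
        linear_combination px (px f) (χ u) * i1 - px (py f) (χ u) * i0
    exact h.fderiv_injective hu hw

theorem dual_isRegular (h : T.IsDualGraph s χ ξ f lam mu L L') {u : ℝ × ℝ} (hu : u ∈ T.dom) :
    T.dual.IsRegular u := by
  refine ⟨hu, fun v ⟨b, hb⟩ => ?_⟩
  obtain ⟨a, ha⟩ := h.fderiv_plane hu v _ rfl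
  change fderiv ℝ T.plane u v = b • T.plane u at hb
  rw [hb, h.plane_eq u hu, ← map_smul, ← map_smul, ← map_smul, ← map_smul, ← map_add] at ha
  have h1 := h.L'_injective ha
  have i0 := congrFun h1 0
  have i1 := congrFun h1 1
  have i2 := congrFun h1 3
  simp [graphPlane] at i0 i1 i2
  have hm := h.lam_ne u hu
  rw [← mul_assoc, i2, left_eq_add, mul_eq_zero, or_iff_right hm] at i0 i1
  exact h.fderiv_injective hu (Prod.ext i0 i1)

theorem projEq_plane_iff (h : T.IsDualGraph s χ ξ f lam mu L L') {u w : ℝ × ℝ} (hu : u ∈ T.dom)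
    (hw : w ∈ T.dom) : ProjEq (T.plane u) (T.plane w) ↔ u = w := by
  constructor
  · rintro ⟨c, -, hcw⟩
    rw [h.plane_eq u hu, h.plane_eq w hw, ← map_smul, ← map_smul, ← map_smul] at hcw
    have h1 := h.L'_injective hcw
    have i0 := congrFun h1 0
    have i1 := congrFun h1 1
    have i2 := congrFun h1 3
    simp [graphPlane] at i0 i1 i2
    have hm := h.lam_ne w hw
    rw [← mul_assoc, ← i2] at i0 i1
    have : χ w = χ u := Prod.ext (mul_left_cancel₀ hm i0) (mul_left_cancel₀ hm i1)
    rw [← h.left_inv u hu, ← this, h.left_inv w hw]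
  · rintro rfl
    exact ⟨1, one_ne_zero, (one_smul ℝ _).symm⟩

/-- The third coordinate is normalized to -1, so proportional vectors are equal. -/
theorem graphPoint_eq_of_projEq (h : T.IsDualGraph s χ ξ f lam mu L L') {u w : ℝ × ℝ}
    (hu : u ∈ T.dom) (hw : w ∈ T.dom) (huw : ProjEq (T.point u) (T.point w)) :
    graphPoint f (χ u) = graphPoint f (χ w) := by
  obtain ⟨c, -, hcw⟩ := huw
  rw [h.point_eq u hu, h.point_eq w hw, ← map_smul, ← map_smul, ← map_smul] at hcw
  have h1 := h.L_injective hcw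
  have i2 := congrFun h1 2
  simp [graphPoint] at i2
  rw [smul_smul, ← i2] at h1
  exact (smul_right_injective _ (h.mu_ne w hw) h1).symm

theorem isElliptic_iff (h : T.IsDualGraph s χ ξ f lam mu L L') {u : ℝ × ℝ} (hu : u ∈ T.dom) :
    T.IsElliptic u ↔ 0 < hessDet f (χ u) := by
  obtain ⟨k, hk, h1, -⟩ := h.disc_eq hu
  have : 0 < k ^ 2 := by positivity
  rw [IsElliptic, h.isRegular_iff hu, h1, mul_pos_iff_of_pos_left this]
  exact ⟨fun h => h.2, fun h => ⟨h.ne', h⟩⟩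

theorem isHyperbolic_iff (h : T.IsDualGraph s χ ξ f lam mu L L') {u : ℝ × ℝ} (hu : u ∈ T.dom) :
    T.IsHyperbolic u ↔ hessDet f (χ u) < 0 := by
  obtain ⟨k, hk, h1, -⟩ := h.disc_eq hu
  have : 0 < k ^ 2 := by positivity
  rw [IsHyperbolic, h.isRegular_iff hu, h1, mul_neg_iff]
  constructor
  · rintro ⟨-, h | h⟩
    · exact h.2
    · exact absurd this h.1.not_gt
  · exact fun h => ⟨h.ne, Or.inl ⟨this, h⟩⟩

theorem mem_cuspidalEdge_iff (h : T.IsDualGraph s χ ξ f lam mu L L') {u : ℝ × ℝ}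
    (hu : u ∈ T.dom) : u ∈ T.cuspidalEdge ↔ hessDet f (χ u) = 0 := by
  rw [cuspidalEdge, Set.mem_ofPred_eq, h.isRegular_iff hu, not_not]
  exact and_iff_right hu

theorem dual_isParabolic_iff (h : T.IsDualGraph s χ ξ f lam mu L L') {u : ℝ × ℝ}
    (hu : u ∈ T.dom) : T.dual.IsParabolic u ↔ hessDet f (χ u) = 0 := by
  obtain ⟨k, hk, -, h1⟩ := h.disc_eq hu
  rw [IsParabolic, h1, and_iff_right (h.dual_isRegular hu), mul_eq_zero, or_iff_right (by positivity)]

/-- In the adapted frame the point at `s` is (0, 0, -1, 0) up to a factor. A plane contains it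
exactly when its third coordinate, which is f, vanishes. -/
theorem mem_contour_iff (h : T.IsDualGraph s χ ξ f lam mu L L') {ρ : ℝ} (hj : IsGodronJet f ρ)
    {u : ℝ × ℝ} (hu : u ∈ T.dom) : u ∈ T.contour s ↔ f (χ u) = 0 := by
  have hP : graphPoint f 0 = ![0, 0, -1, 0] := by
    simp [graphPoint, hj.zero, hj.x, hj.y]
  rw [contour, Set.mem_ofPred_eq, and_iff_right hu, h.plane_eq u hu, h.point_eq s h.mem,
    h.chart.map_base, hP, smul_dotProduct, dotProduct_smul, h.pairing, smul_eq_mul, smul_eq_mul,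
    mul_eq_zero, or_iff_right (h.lam_ne u hu), mul_eq_zero, or_iff_right (h.mu_ne s h.mem)]
  simp [graphPlane, dotProduct, Fin.sum_univ_four]

/-- Derivatives of the point along a curve tangent to the asymptotic direction. -/
theorem deriv_point_curve (h : T.IsDualGraph s χ ξ f lam mu L L') {ρ k : ℝ} (hj : IsGodronJet f ρ)
    {α : ℝ → ℝ × ℝ} {c : ℝ → ℝ} (hα : ContDiff ℝ ∞ α) (hαs : α 0 = s) (hc : ContDiff ℝ ∞ c)
    (hc0 : c 0 = 0) (hc1 : deriv c 0 = 0) (hc2 : deriv (deriv c) 0 = 2 * k)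
    (hχα : ∀ᶠ t in 𝓝 0, χ (α t) = (t, c t)) :
    T.point (α 0) = L ![0, 0, -mu s, 0] ∧
    (∃ a, deriv (fun t => T.point (α t)) 0 = L ![0, 0, a, 0]) ∧
    (∃ a, deriv (deriv (fun t => T.point (α t))) 0 = L ![0, mu s * (2 * k - 2), a, 0]) ∧
    ∃ a b, deriv (deriv (deriv (fun t => T.point (α t)))) 0 =
      L ![mu s * (12 * (ρ - k)), b, a, 0] := by
  obtain ⟨hQ0, hQ1, hQ2, b, hQ3⟩ := hj.deriv_graphPoint h.contDiff hc hc0 hc1 hc2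
  set Q := fun t => graphPoint f (t, c t) with hQ
  have hQs : ContDiff ℝ ∞ Q := (contDiff_graphPoint h.contDiff).comp (contDiff_id.prodMk hc)
  have hLQ : ContDiff ℝ ∞ fun t => L (Q t) := L.contDiff.comp hQs
  have hm : ContDiff ℝ ∞ fun t => mu (α t) := h.contDiff_mu.comp hα
  have hev : (fun t => T.point (α t)) =ᶠ[𝓝 0] fun t => mu (α t) • L (Q t) := by
    have hd : ∀ᶠ t in 𝓝 0, α t ∈ T.dom :=
      (hα.continuous.tendsto' _ _ hαs).eventually (T.eventually_mem_dom h.mem)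
    filter_upwards [hχα, hd] with t h1 h2
    rw [h.point_eq _ h2, h1]
  have d1 := hev.deriv
  have d2 := d1.deriv
  have d3 := d2.deriv
  rw [show T.point (α 0) = mu (α 0) • L (Q 0) from hev.self_of_nhds, d1.self_of_nhds, d2.self_of_nhds, d3.self_of_nhds,
    deriv_deriv_deriv_smul_curve hm hLQ, deriv_deriv_smul_curve hm hLQ, deriv_smul_curve hm hLQ,
    deriv_clm_curve L hQs, deriv_clm_curve L hQs.deriv_infty,
    deriv_clm_curve L hQs.deriv_infty.deriv_infty]
  simp only [hQ0, hQ1, hQ2, hQ3, hαs]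
  refine ⟨?_, ⟨-deriv (fun t => mu (α t)) 0, ?_⟩,
    ⟨-deriv (deriv (fun t => mu (α t))) 0, ?_⟩, ⟨-deriv (deriv (deriv (fun t => mu (α t)))) 0,
      mu s * b + 3 * deriv (fun t => mu (α t)) 0 * (2 * k - 2), ?_⟩⟩
  · rw [← map_smul]; simp
  · rw [← map_smul, ← map_smul, ← map_add]; simp
  · rw [← map_smul, ← map_smul, ← map_smul, ← map_add, ← map_add]; simp
  · rw [← map_smul, ← map_smul, ← map_smul, ← map_smul, ← map_add, ← map_add, ← map_add]
    simp

/-- Modulo the point itself, the acceleration is a multiple of (0, 2k - 2, 0, 0), and the first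
component of the third derivative is a multiple of ρ - k. Hence the two conditions k ≠ 1 and k ≠ ρ.
-/
theorem isCusp (h : T.IsDualGraph s χ ξ f lam mu L L') {ρ k : ℝ} (hj : IsGodronJet f ρ)
    {α : ℝ → ℝ × ℝ} {c : ℝ → ℝ} (hα : ContDiff ℝ ∞ α) (hαs : α 0 = s) (hc : ContDiff ℝ ∞ c)
    (hc0 : c 0 = 0) (hc1 : deriv c 0 = 0) (hc2 : deriv (deriv c) 0 = 2 * k)
    (hχα : ∀ᶠ t in 𝓝 0, χ (α t) = (t, c t)) (hk : k ≠ 1) :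
    T.IsCusp α ∧ (k ≠ ρ → T.IsSemicubicCusp α) := by
  obtain ⟨h0, ⟨a₁, h1⟩, ⟨a₂, h2⟩, a₃, b, h3⟩ :=
    h.deriv_point_curve hj hα hαs hc hc0 hc1 hc2 hχα
  have hm := h.mu_ne s h.mem
  have hk1 : 2 * k - 2 ≠ 0 := fun h => hk (by linarith)
  have hv : ∃ a : ℝ, deriv (fun t => T.point (α t)) 0 = a • T.point (α 0) := by
    refine ⟨-a₁ / mu s, ?_⟩
    rw [h0, h1, ← map_smul]
    congr 1
    ext i
    fin_cases i <;> simp [hm]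
  refine ⟨⟨hv, ?_⟩, fun hkρ => ⟨hv, ?_⟩⟩
  · simp only [iteratedDeriv_succ, iteratedDeriv_zero]
    rw [h0, h2, LinearIndependent.pair_iff]
    intro x y hxy
    rw [← map_smul, ← map_smul, ← map_add] at hxy
    have := h.L_injective (hxy.trans (map_zero L).symm)
    have i1 := congrFun this 1
    have i2 := congrFun this 2
    simp [hm, hk1] at i1 i2
    simpa [i1, hm] using i2
  · have hk2 : ρ - k ≠ 0 := sub_ne_zero.2 hkρ.symm
    simp only [iteratedDeriv_succ, iteratedDeriv_zero]
    rw [h0, h2, h3, Fintype.linearIndependent_iff]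
    intro g hg
    simp only [Fin.sum_univ_three] at hg
    have : L (g 0 • ![0, 0, -mu s, 0] + g 1 • ![0, mu s * (2 * k - 2), a₂, 0] +
        g 2 • ![mu s * (12 * (ρ - k)), b, a₃, 0]) = L 0 := by
      rw [map_zero, map_add, map_add, map_smul, map_smul, map_smul]
      exact hg
    have := h.L_injective this
    have i0 := congrFun this 0
    have i1 := congrFun this 1
    have i2 := congrFun this 2
    simp [hm, hk2] at i0
    simp [hm, hk1, i0] at i1
    simp [hm, i0, i1] at i2
    intro i
    fin_cases i
    · exact i2
    · exact i1
    · exact i0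

/-- All accelerations lie on one line modulo the base point, with coordinates proportional to k - 1.
The sign of the quotient tells whether two cusps point the same way. -/
theorem exists_smul_add_eq (h : T.IsDualGraph s χ ξ f lam mu L L') {ρ k l : ℝ}
    (hj : IsGodronJet f ρ) {α β : ℝ → ℝ × ℝ} {c d : ℝ → ℝ}
    (hα : ContDiff ℝ ∞ α) (hαs : α 0 = s) (hc : ContDiff ℝ ∞ c)
    (hc0 : c 0 = 0) (hc1 : deriv c 0 = 0) (hc2 : deriv (deriv c) 0 = 2 * k)
    (hχα : ∀ᶠ t in 𝓝 0, χ (α t) = (t, c t))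
    (hβ : ContDiff ℝ ∞ β) (hβs : β 0 = s) (hd : ContDiff ℝ ∞ d)
    (hd0 : d 0 = 0) (hd1 : deriv d 0 = 0) (hd2 : deriv (deriv d) 0 = 2 * l)
    (hχβ : ∀ᶠ t in 𝓝 0, χ (β t) = (t, d t)) (hl : l ≠ 1) :
    ∃ a : ℝ, iteratedDeriv 2 (fun t => T.point (α t)) 0 = ((k - 1) / (l - 1)) •
      iteratedDeriv 2 (fun t => T.point (β t)) 0 + a • T.point (β 0) := by
  obtain ⟨-, -, ⟨a₁, h1⟩, -⟩ := h.deriv_point_curve hj hα hαs hc hc0 hc1 hc2 hχα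
  obtain ⟨h0, -, ⟨a₂, h2⟩, -⟩ := h.deriv_point_curve hj hβ hβs hd hd0 hd1 hd2 hχβ
  have hm := h.mu_ne s h.mem
  have hl' : l - 1 ≠ 0 := sub_ne_zero.2 hl
  refine ⟨((k - 1) / (l - 1) * a₂ - a₁) / mu s, ?_⟩
  simp only [iteratedDeriv_succ, iteratedDeriv_zero]
  rw [h1, h2, h0, ← map_smul, ← map_smul, ← map_add]
  congr 1
  ext i
  fin_cases i
  · simp
  · simp; field_simp
  · simp; field_simp; ring
  · simp

end Front.IsDualGraph

/-! ### Flecnodal points -/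

/-- The value and the first three derivatives of the curve `F` at `0` lie in `W`. -/
def JetIn {E : Type*} [NormedAddCommGroup E] [NormedSpace ℝ E] (W : Submodule ℝ E) (F : ℝ → E) :
    Prop :=
  F 0 ∈ W ∧ deriv F 0 ∈ W ∧ deriv (deriv F) 0 ∈ W ∧ deriv (deriv (deriv F)) 0 ∈ W

section JetIn

variable {E : Type*} [NormedAddCommGroup E] [NormedSpace ℝ E] {W : Submodule ℝ E} {F G : ℝ → E}

theorem jetIn_iff : (∀ i ≤ 3, iteratedDeriv i F 0 ∈ W) ↔ JetIn W F := by
  constructor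
  · intro h
    refine ⟨?_, ?_, ?_, ?_⟩
    · simpa using h 0 (by norm_num)
    · simpa [iteratedDeriv_one] using h 1 (by norm_num)
    · simpa [iteratedDeriv_succ, iteratedDeriv_zero] using h 2 (by norm_num)
    · simpa [iteratedDeriv_succ, iteratedDeriv_zero] using h 3 (by norm_num)
  · rintro ⟨h0, h1, h2, h3⟩ i hi
    interval_cases i
    · simpa using h0
    · simpa [iteratedDeriv_one] using h1
    · simpa [iteratedDeriv_succ, iteratedDeriv_zero] using h2
    · simpa [iteratedDeriv_succ, iteratedDeriv_zero] using h3

theorem JetIn.congr (h : JetIn W F) (hFG : F =ᶠ[𝓝 0] G) : JetIn W G := by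
  obtain ⟨h0, h1, h2, h3⟩ := h
  refine ⟨?_, ?_, ?_, ?_⟩
  · rwa [← hFG.self_of_nhds]
  · rwa [← hFG.deriv.self_of_nhds]
  · rwa [← hFG.deriv.deriv.self_of_nhds]
  · rwa [← hFG.deriv.deriv.deriv.self_of_nhds]

/-- Rescaling homogeneous coordinates acts on the 3-jet by a triangular matrix with diagonal entries
m(0), so contact with a line is a projective notion. -/
theorem jetIn_smul_iff {m : ℝ → ℝ} (hm : ContDiff ℝ ∞ m) (hF : ContDiff ℝ ∞ F) (h0 : m 0 ≠ 0) :
    JetIn W (fun t => m t • F t) ↔ JetIn W F := by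
  rw [JetIn, deriv_deriv_deriv_smul_curve hm hF, deriv_deriv_smul_curve hm hF,
    deriv_smul_curve hm hF]
  constructor
  · rintro ⟨h0', h1, h2, h3⟩
    simp only at h0' h1 h2 h3
    have a0 : F 0 ∈ W := (W.smul_mem_iff h0).1 h0'
    have a1 : deriv F 0 ∈ W :=
      (W.smul_mem_iff h0).1 ((W.add_mem_iff_left (W.smul_mem _ a0)).1 h1)
    have a2 : deriv (deriv F) 0 ∈ W :=
      (W.smul_mem_iff h0).1 ((W.add_mem_iff_left (W.smul_mem _ a1)).1
        ((W.add_mem_iff_left (W.smul_mem _ a0)).1 h2))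
    have a3 : deriv (deriv (deriv F)) 0 ∈ W :=
      (W.smul_mem_iff h0).1 ((W.add_mem_iff_left (W.smul_mem _ a2)).1
        ((W.add_mem_iff_left (W.smul_mem _ a1)).1 ((W.add_mem_iff_left (W.smul_mem _ a0)).1 h3)))
    exact ⟨a0, a1, a2, a3⟩
  · rintro ⟨a0, a1, a2, a3⟩
    exact ⟨W.smul_mem _ a0, W.add_mem (W.smul_mem _ a1) (W.smul_mem _ a0),
      W.add_mem (W.add_mem (W.smul_mem _ a2) (W.smul_mem _ a1)) (W.smul_mem _ a0),
      W.add_mem (W.add_mem (W.add_mem (W.smul_mem _ a3) (W.smul_mem _ a2)) (W.smul_mem _ a1))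
        (W.smul_mem _ a0)⟩

end JetIn

/-- Applied to a line with high contact: it is spanned by the position and the velocity, so the
higher derivatives are combinations of these two. -/
theorem exists_smul_add_smul_of_finrank_eq_two {V : Type*} [AddCommGroup V] [Module ℝ V]
    {W : Submodule ℝ V} (hW : Module.finrank ℝ W = 2) {u v w : V}
    (huv : LinearIndependent ℝ ![u, v]) (hu : u ∈ W) (hv : v ∈ W) (hw : w ∈ W) :
    ∃ x y : ℝ, w = x • u + y • v := by
  have : FiniteDimensional ℝ W := Module.finite_of_finrank_eq_succ hW
  have h1 : Submodule.span ℝ (Set.range ![u, v]) ≤ W := by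
    rw [Submodule.span_le]
    rintro _ ⟨i, rfl⟩
    fin_cases i
    · exact hu
    · exact hv
  have h2 := Submodule.eq_of_le_of_finrank_eq h1 (by rw [finrank_span_eq_card huv, hW]; simp)
  rw [← h2] at hw
  simp only [Matrix.range_cons, Matrix.range_empty, Set.union_empty, Set.singleton_union] at hw
  obtain ⟨x, y, h⟩ := Submodule.mem_span_pair.1 hw
  exact ⟨x, y, h.symm⟩

theorem deriv_dotProduct {p q : ℝ → Fin 4 → ℝ} (hp : ContDiff ℝ ∞ p) (hq : ContDiff ℝ ∞ q) :
    deriv (fun t => p t ⬝ᵥ q t) = fun t => deriv p t ⬝ᵥ q t + p t ⬝ᵥ deriv q t := funext fun t =>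
  (Front.hasDerivAt_dotProduct (hp.differentiable (by simp) t).hasDerivAt
    (hq.differentiable (by simp) t).hasDerivAt).deriv

theorem contDiff_dotProduct {p q : ℝ → Fin 4 → ℝ} (hp : ContDiff ℝ ∞ p) (hq : ContDiff ℝ ∞ q) :
    ContDiff ℝ ∞ (fun t => p t ⬝ᵥ q t) := by
  rw [contDiff_pi] at hp hq
  exact ContDiff.sum fun i _ => (hp i).mul (hq i)

theorem deriv_deriv_dotProduct {p q : ℝ → Fin 4 → ℝ} (hp : ContDiff ℝ ∞ p) (hq : ContDiff ℝ ∞ q) :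
    deriv (deriv (fun t => p t ⬝ᵥ q t)) = fun t => deriv (deriv p) t ⬝ᵥ q t +
      2 * (deriv p t ⬝ᵥ deriv q t) + p t ⬝ᵥ deriv (deriv q) t := by
  rw [deriv_dotProduct hp hq]
  funext t
  have h1 := contDiff_dotProduct hp.deriv_infty hq
  have h2 := contDiff_dotProduct hp hq.deriv_infty
  rw [deriv_fun_add (h1.differentiable (by simp) t) (h2.differentiable (by simp) t),
    deriv_dotProduct hp.deriv_infty hq, deriv_dotProduct hp hq.deriv_infty]
  ring

theorem deriv_apply {F : ℝ → Fin 4 → ℝ} (hF : ContDiff ℝ ∞ F) (i : Fin 4) :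
    deriv (fun t => F t i) = fun t => deriv F t i := funext fun t =>
  (hasDerivAt_pi.1 (hF.differentiable (by simp) t).hasDerivAt i).deriv

theorem deriv_add_cube {a : ℝ → ℝ} (ha : ContDiff ℝ ∞ a) (z : ℝ) :
    let b := fun t => a t + t ^ 3 * z
    ContDiff ℝ ∞ b ∧ b 0 = a 0 ∧ deriv b 0 = deriv a 0 ∧ deriv (deriv b) 0 = deriv (deriv a) 0 ∧
      deriv (deriv (deriv b)) 0 = deriv (deriv (deriv a)) 0 + 6 * z := by
  intro b
  have e1 : deriv b = fun t => deriv a t + 3 * t ^ 2 * z := funext fun t => by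
    rw [((ha.hasDerivAt' t).fun_add ((hasDerivAt_pow 3 t).mul_const z)).deriv]
    norm_num
  have e2 : deriv (deriv b) = fun t => deriv (deriv a) t + 6 * t * z := funext fun t => by
    rw [e1, ((ha.deriv_infty.hasDerivAt' t).fun_add
      (((hasDerivAt_pow 2 t).const_mul 3).mul_const z)).deriv]
    push_cast
    ring
  have e3 : deriv (deriv (deriv b)) = fun t => deriv (deriv (deriv a)) t + 6 * z :=
    funext fun t => by
      rw [e2, ((ha.deriv_infty.deriv_infty.hasDerivAt' t).fun_add
        (((hasDerivAt_id' t).const_mul 6).mul_const z)).deriv]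
      norm_num
  refine ⟨ha.add ((contDiff_id.pow 3).mul contDiff_const), by simp [b], by simp [e1], by simp [e2],
    by simp [e3]⟩

/-- Changing a plane curve at the third order changes only the third derivative of its image. -/
theorem deriv_comp_add_cube {F : ℝ × ℝ → Fin 4 → ℝ} (hF : ContDiff ℝ ∞ F) {a b : ℝ → ℝ}
    (ha : ContDiff ℝ ∞ a) (hb : ContDiff ℝ ∞ b) (z : ℝ × ℝ) :
    let P := fun t => F (a t, b t)
    let R := fun t => F (a t + t ^ 3 * z.1, b t + t ^ 3 * z.2)
    R 0 = P 0 ∧ deriv R 0 = deriv P 0 ∧ deriv (deriv R) 0 = deriv (deriv P) 0 ∧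
      deriv (deriv (deriv R)) 0 =
        deriv (deriv (deriv P)) 0 + (6 : ℝ) • fderiv ℝ F (a 0, b 0) z := by
  intro P R
  obtain ⟨has, a0, a1, a2, a3⟩ := deriv_add_cube ha z.1
  obtain ⟨hbs, b0, b1, b2, b3⟩ := deriv_add_cube hb z.2
  have hP : ContDiff ℝ ∞ P := hF.comp (ha.prodMk hb)
  have hR : ContDiff ℝ ∞ R := hF.comp (has.prodMk hbs)
  have hFi : ∀ i, ContDiff ℝ ∞ fun p => F p i := contDiff_pi.1 hF
  refine ⟨?_, ?_, ?_, ?_⟩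
  · simp [R, P]
  · ext i
    rw [← congrFun (deriv_apply hR i) 0, ← congrFun (deriv_apply hP i) 0,
      deriv_curve (hFi i) ha hb, deriv_curve (hFi i) has hbs]
    simp only [a0, a1, b0, b1]
  · ext i
    rw [← congrFun (deriv_apply hR.deriv_infty i) 0, ← congrFun (deriv_apply hP.deriv_infty i) 0,
      ← deriv_apply hR, ← deriv_apply hP,
      deriv_deriv_curve (hFi i) ha hb, deriv_deriv_curve (hFi i) has hbs]
    simp only [a0, a1, a2, b0, b1, b2]
  · ext i
    rw [Pi.add_apply, Pi.smul_apply, ← congrFun (deriv_apply hR.deriv_infty.deriv_infty i) 0,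
      ← congrFun (deriv_apply hP.deriv_infty.deriv_infty i) 0,
      ← deriv_apply hR.deriv_infty, ← deriv_apply hP.deriv_infty,
      ← deriv_apply hR, ← deriv_apply hP,
      deriv_deriv_deriv_curve (hFi i) ha hb, deriv_deriv_deriv_curve (hFi i) has hbs]
    have h6 : fderiv ℝ F (a 0, b 0) z i = px (fun p => F p i) (a 0, b 0) * z.1 +
        py (fun p => F p i) (a 0, b 0) * z.2 := by
      rw [← fderiv_apply_eq_px_py,
        (hasFDerivAt_pi'.1 (hF.differentiable (by simp) (a 0, b 0)).hasFDerivAt i).fderiv]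
      rfl
    simp only [a0, a1, a2, a3, b0, b1, b2, b3, h6, smul_eq_mul]
    ring

namespace Front

/-- A line with four-point contact gives a line with four-point contact with the dual surface. -/
theorem IsFlecnodal.dual {T : Front} {u : ℝ × ℝ} (h : T.IsFlecnodal u) (hr : T.dual.IsRegular u)
    (hnd : ∀ v ≠ 0, ∃ z, fderiv ℝ T.plane u z ⬝ᵥ fderiv ℝ T.point u v ≠ 0) :
    T.dual.IsFlecnodal u := by
  obtain ⟨⟨hu, hreg⟩, γ, hγs, hγ0, hγ1, W, hW, hjet⟩ := h
  rw [jetIn_iff] at hjet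
  obtain ⟨η, hη, hηγ⟩ := hγs.exists_contDiff
  obtain ⟨q, hq, hqT⟩ := (T.smooth_point.smoothNear T.isOpen_dom hu).exists_contDiff
  obtain ⟨p, hp, hpT⟩ := (T.smooth_plane.smoothNear T.isOpen_dom hu).exists_contDiff
  have hη0 : η 0 = u := hηγ.self_of_nhds.trans hγ0
  have hηc : Tendsto η (𝓝 0) (𝓝 u) := hη.continuous.tendsto' _ _ hη0
  set v := deriv η 0 with hv
  have hv0 : v ≠ 0 := by rwa [hv, hηγ.deriv_eq]
  set Q := fun t => q (η t) with hQ
  set P := fun t => p (η t) with hP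
  have hQs : ContDiff ℝ ∞ Q := hq.comp hη
  have hPs : ContDiff ℝ ∞ P := hp.comp hη
  have hQd : ∀ t, deriv Q t = fderiv ℝ q (η t) (deriv η t) := fun t =>
    ((hq.differentiable (by simp) (η t)).hasFDerivAt.comp_hasDerivAt t
      (hη.differentiable (by simp) t).hasDerivAt).deriv
  have hPd : ∀ t, deriv P t = fderiv ℝ p (η t) (deriv η t) := fun t =>
    ((hp.differentiable (by simp) (η t)).hasFDerivAt.comp_hasDerivAt t
      (hη.differentiable (by simp) t).hasDerivAt).deriv
  have hfq : fderiv ℝ q u = fderiv ℝ T.point u := hqT.fderiv_eq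
  have hfp : fderiv ℝ p u = fderiv ℝ T.plane u := hpT.fderiv_eq
  have hqu : q u = T.point u := hqT.self_of_nhds
  have hpu : p u = T.plane u := hpT.self_of_nhds
  have hjet' : JetIn W Q := by
    refine hjet.congr ?_
    filter_upwards [hηγ, hηc.eventually hqT] with t h1 h2
    rw [← h1]
    exact h2.symm
  have hPQ' : (fun t => P t ⬝ᵥ deriv Q t) =ᶠ[𝓝 0] fun _ => 0 := by
    filter_upwards [hηc.eventually (hqT.fderiv (𝕜 := ℝ)), hηc.eventually hpT,
      hηc.eventually (T.eventually_mem_dom hu)] with t h1 h2 h3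
    rw [hQd, h1, show P t = _ from h2]
    exact T.legendrian _ h3 _
  have hP'Q : (fun t => deriv P t ⬝ᵥ Q t) =ᶠ[𝓝 0] fun _ => 0 := by
    filter_upwards [hηc.eventually (hpT.fderiv (𝕜 := ℝ)), hηc.eventually hqT,
      hηc.eventually (T.eventually_mem_dom hu)] with t h1 h2 h3
    rw [hPd, h1, show Q t = _ from h2, dotProduct_comm]
    exact T.dual_legendrian _ h3 _
  have a1 := hPQ'.deriv.self_of_nhds
  have a2 := hPQ'.deriv.deriv.self_of_nhds
  have b1 := hP'Q.deriv.self_of_nhds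
  have b2 := hP'Q.deriv.deriv.self_of_nhds
  rw [deriv_deriv_dotProduct hPs hQs.deriv_infty] at a2
  rw [deriv_dotProduct hPs hQs.deriv_infty] at a1
  rw [deriv_deriv_dotProduct hPs.deriv_infty hQs] at b2
  rw [deriv_dotProduct hPs.deriv_infty hQs] at b1
  simp only [deriv_const'] at a1 a2 b1 b2
  have a0 := hPQ'.self_of_nhds
  have b0 := hP'Q.self_of_nhds
  simp only at a0 b0
  have c0 : P 0 ⬝ᵥ Q 0 = 0 := by
    rw [hP, hQ]; simp only [hη0, hpu, hqu]; exact T.incident u hu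
  have hind : LinearIndependent ℝ ![Q 0, deriv Q 0] := by
    rw [LinearIndependent.pair_iff]
    intro x y hxy
    have hy : y = 0 := by
      by_contra hy
      refine hv0 (hreg v ⟨-x / y, ?_⟩)
      have e1 : deriv Q 0 = fderiv ℝ T.point u v := by rw [hQd, hη0, hfq]
      have e2 : Q 0 = T.point u := by rw [hQ]; simp only [hη0, hqu]
      rw [← e1, ← e2]
      have : y • deriv Q 0 = -(x • Q 0) := by rw [← add_eq_zero_iff_eq_neg, add_comm]; exact hxy
      rw [div_eq_inv_mul, mul_smul, neg_smul, ← this, smul_smul, inv_mul_cancel₀ hy, one_smul]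
    refine ⟨?_, hy⟩
    rw [hy, zero_smul, add_zero] at hxy
    refine (smul_eq_zero.1 hxy).resolve_right ?_
    rw [hQ]; simp only [hη0, hqu]
    exact T.point_ne u hu
  -- The second and third derivatives of Q are combinations of Q and Q'. Substituting them in the
  -- derivatives of P ⬝ Q' = 0 and P' ⬝ Q = 0 shows that P, P' and P'' annihilate the line, and that
  -- P''' annihilates Q. Only P''' ⬝ Q' may be nonzero.
  obtain ⟨x₂, y₂, hQ2⟩ := exists_smul_add_smul_of_finrank_eq_two hW hind hjet'.1 hjet'.2.1
    hjet'.2.2.1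
  obtain ⟨x₃, y₃, hQ3⟩ := exists_smul_add_smul_of_finrank_eq_two hW hind hjet'.1 hjet'.2.1
    hjet'.2.2.2
  simp only [hQ2, hQ3, dotProduct_add, dotProduct_smul, a0, b0, c0, smul_eq_mul] at a1 a2 b2
  have k1 : deriv P 0 ⬝ᵥ deriv Q 0 = 0 := by linarith
  have k2 : deriv (deriv P) 0 ⬝ᵥ Q 0 = 0 := by linarith
  rw [k1] at a2 b2
  have k3 : deriv (deriv P) 0 ⬝ᵥ deriv Q 0 = 0 := by linarith
  have k4 : deriv (deriv (deriv P)) 0 ⬝ᵥ Q 0 = 0 := by linarith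
  obtain ⟨z₀, hz₀⟩ := hnd v hv0
  set κ := fderiv ℝ T.plane u z₀ ⬝ᵥ fderiv ℝ T.point u v with hκ
  -- The parameter curve is modified by t³z. This adds six times the derivative of the plane along z
  -- to P''', which leaves P''' ⬝ Q unchanged by the dual Legendre condition. The factor -1/(6κ)
  -- makes P''' ⬝ Q' vanish.
  set z := (-(deriv (deriv (deriv P)) 0 ⬝ᵥ deriv Q 0) / (6 * κ)) • z₀ with hz
  obtain ⟨r0, r1, r2, r3⟩ := deriv_comp_add_cube hp hη.fst hη.snd z
  set R := fun t => p ((η t).1 + t ^ 3 * z.1, (η t).2 + t ^ 3 * z.2) with hR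
  change R 0 = P 0 at r0
  change deriv R 0 = deriv P 0 at r1
  change deriv (deriv R) 0 = deriv (deriv P) 0 at r2
  change deriv (deriv (deriv R)) 0 = deriv (deriv (deriv P)) 0 + (6 : ℝ) • fderiv ℝ p (η 0) z at r3
  have hzs : ContDiff ℝ ∞ fun t : ℝ => ((η t).1 + t ^ 3 * z.1, (η t).2 + t ^ 3 * z.2) :=
    (deriv_add_cube hη.fst z.1).1.prodMk (deriv_add_cube hη.snd z.2).1
  have hz0 : ((η 0).1 + (0 : ℝ) ^ 3 * z.1, (η 0).2 + (0 : ℝ) ^ 3 * z.2) = u := by simp [hη0]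
  -- The line of the dual space is the annihilator of the original line, the kernel of the matrix
  -- with rows Q and Q'.
  refine ⟨hr, fun t => ((η t).1 + t ^ 3 * z.1, (η t).2 + t ^ 3 * z.2), hzs.smoothNear 0, hz0, ?_,
    LinearMap.ker (Matrix.mulVecLin (Matrix.of ![Q 0, deriv Q 0])), ?_, ?_⟩
  · have h1 := deriv_pair (deriv_add_cube hη.fst z.1).1 (deriv_add_cube hη.snd z.2).1 0
    rw [h1, (deriv_add_cube hη.fst z.1).2.2.1, (deriv_add_cube hη.snd z.2).2.2.1,
      ← deriv_pair hη.fst hη.snd]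
    exact hv0
  · have h1 : (Matrix.of ![Q 0, deriv Q 0]).rank = 2 := by
      have := LinearIndependent.rank_matrix (M := Matrix.of ![Q 0, deriv Q 0]) hind
      simpa using this
    have h2 := LinearMap.finrank_range_add_finrank_ker
      (Matrix.mulVecLin (Matrix.of ![Q 0, deriv Q 0]))
    rw [← Matrix.rank, h1] at h2
    simp at h2
    omega
  · rw [jetIn_iff]
    have hmem : ∀ w : Fin 4 → ℝ, w ⬝ᵥ Q 0 = 0 → w ⬝ᵥ deriv Q 0 = 0 →
        w ∈ LinearMap.ker (Matrix.mulVecLin (Matrix.of ![Q 0, deriv Q 0])) := by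
      intro w h1 h2
      rw [LinearMap.mem_ker, Matrix.mulVecLin_apply]
      ext i
      fin_cases i
      · simpa [Matrix.mulVec, dotProduct_comm] using h1
      · simpa [Matrix.mulVec, dotProduct_comm] using h2
    have hjR : JetIn (LinearMap.ker (Matrix.mulVecLin (Matrix.of ![Q 0, deriv Q 0]))) R := by
      refine ⟨?_, ?_, ?_, ?_⟩
      · rw [r0]; exact hmem _ c0 a0
      · rw [r1]; exact hmem _ b0 k1
      · rw [r2]; exact hmem _ k2 k3
      · rw [r3, hη0, hfp]
        refine hmem _ ?_ ?_
        · rw [add_dotProduct, k4, smul_dotProduct, dotProduct_comm (fderiv ℝ T.plane u z)]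
          have : Q 0 ⬝ᵥ fderiv ℝ T.plane u z = 0 := by
            rw [hQ]; simp only [hη0, hqu]; exact T.dual_legendrian u hu z
          rw [this]; simp
        · have e1 : deriv Q 0 = fderiv ℝ T.point u v := by rw [hQd, hη0, hfq]
          rw [add_dotProduct, smul_dotProduct, hz, map_smul, smul_dotProduct]
          conv_lhs => rw [e1]
          rw [← hκ, ← e1, smul_eq_mul, smul_eq_mul]
          field_simp
          ring
    refine hjR.congr ?_
    have : Tendsto (fun t : ℝ => ((η t).1 + t ^ 3 * z.1, (η t).2 + t ^ 3 * z.2)) (𝓝 0) (𝓝 u) :=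
      hzs.continuous.tendsto' _ _ hz0
    filter_upwards [this.eventually hpT] with t ht
    exact ht

end Front

/-- In a direction (1, m) the cubic form is solved for m = M(p) by the implicit function theorem,
since f_xxy ≠ 0. Substituting M in the quadratic form gives the equation. To leading order M = 2ρx
on the axis y = 0, and the result is y = (2ρ² - ρ)x². -/
theorem IsGodronJet.exists_flecnodal_equation {f : ℝ × ℝ → ℝ} {ρ : ℝ} (h : IsGodronJet f ρ)
    (hf : ContDiff ℝ ∞ f) : ∃ G : ℝ × ℝ → ℝ, ContDiff ℝ ∞ G ∧ G 0 = 0 ∧ px G 0 = 0 ∧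
      py G 0 = -2 ∧ px (px G) 0 = 8 * ρ ^ 2 - 4 * ρ ∧
      ∀ᶠ p in 𝓝 0, (∃ v : ℝ × ℝ, v ≠ 0 ∧ hess f p v v = 0 ∧ cubicForm f p v = 0) ↔ G p = 0 := by
  set A := px (px (px f)) with hA
  set B := px (px (py f)) with hB
  set C := px (py (py f)) with hC
  set D := py (py (py f)) with hD
  have hAs : ContDiff ℝ ∞ A := hf.px.px.px
  have hBs : ContDiff ℝ ∞ B := hf.py.px.px
  have hCs : ContDiff ℝ ∞ C := hf.py.py.px
  have hDs : ContDiff ℝ ∞ D := hf.py.py.py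
  have hA0 : A 0 = 0 := h.xxx
  have hB0 : B 0 = -2 := h.xxy
  have hAx : px A 0 = 12 * ρ := h.xxxx
  set E : (ℝ × ℝ) × ℝ → ℝ := fun q => cubicForm f q.1 (1, q.2) with hE
  have hEs : ContDiff ℝ ∞ E := by
    simp only [hE, cubicForm, ← hA, ← hB, ← hC, ← hD]
    have h1 := hAs.comp (contDiff_fst (E := ℝ × ℝ) (F := ℝ))
    have h2 := hBs.comp (contDiff_fst (E := ℝ × ℝ) (F := ℝ))
    have h3 := hCs.comp (contDiff_fst (E := ℝ × ℝ) (F := ℝ))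
    have h4 := hDs.comp (contDiff_fst (E := ℝ × ℝ) (F := ℝ))
    simp only [Function.comp_def] at h1 h2 h3 h4
    fun_prop
  have hE0 : E (0, 0) = 0 := by simp [hE, cubicForm, ← hA, hA0]
  have hE1 : fderiv ℝ E (0, 0) (0, 1) ≠ 0 := by
    have h1 : HasDerivAt (fun t : ℝ => E (0, t)) (fderiv ℝ E (0, 0) (0, 1)) 0 :=
      (hEs.differentiable (by simp) (0, 0)).hasFDerivAt.comp_hasDerivAt (0 : ℝ)
        ((hasDerivAt_const (0 : ℝ) (0 : ℝ × ℝ)).prodMk (hasDerivAt_id (0 : ℝ)))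
    have h2 : HasDerivAt (fun t : ℝ => E (0, t)) (3 * B 0) 0 := by
      have e : (fun t : ℝ => E (0, t)) = fun t => A 0 + 3 * B 0 * t + 3 * C 0 * t ^ 2 +
          D 0 * t ^ 3 := by
        funext t
        simp only [hE, cubicForm, ← hA, ← hB, ← hC, ← hD]
        ring
      rw [e]
      have := (((((hasDerivAt_id' (0 : ℝ)).const_mul (3 * B 0)).const_add (A 0)).fun_add
        ((hasDerivAt_pow 2 (0 : ℝ)).const_mul (3 * C 0))).fun_add
        ((hasDerivAt_pow 3 (0 : ℝ)).const_mul (D 0)))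
      simpa using this
    rw [h1.unique h2, hB0]
    norm_num
  obtain ⟨M, hM, hM0, hEM⟩ := exists_implicit hEs 0 0 hE0 hE1
  set G : ℝ × ℝ → ℝ := fun p => (px (px f) p + 2 * (px (py f) p * M p)) +
    py (py f) p * (M p * M p) with hG
  have hMM := hM.mul hM
  have h1s := hf.px.px
  have h2s := hf.py.px
  have h3s := hf.py.py
  have h2M := h2s.mul hM
  have h2M2 : ContDiff ℝ ∞ fun p => 2 * (px (py f) p * M p) := contDiff_const.mul h2M
  have px2 : ∀ {g : ℝ × ℝ → ℝ}, ContDiff ℝ ∞ g → px (fun p => 2 * g p) = fun p => 2 * px g p :=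
    fun {g} hg => by
      rw [px_mul contDiff_const hg]
      funext p
      simp [px]
  have py2 : ∀ {g : ℝ × ℝ → ℝ}, ContDiff ℝ ∞ g → py (fun p => 2 * g p) = fun p => 2 * py g p :=
    fun {g} hg => by
      rw [py_mul contDiff_const hg]
      funext p
      simp [py]
  have gx : px G = fun p => A p + 2 * (B p * M p + px (py f) p * px M p) +
      (C p * (M p * M p) + py (py f) p * (px M p * M p + M p * px M p)) := by
    rw [hG, px_add (h1s.add h2M2) (h3s.mul hMM), px_add h1s h2M2, px2 h2M, px_mul h2s hM,
      px_mul h3s hMM, px_mul hM hM]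
  have gy : py G = fun p => B p + 2 * (C p * M p + px (py f) p * py M p) +
      (D p * (M p * M p) + py (py f) p * (py M p * M p + M p * py M p)) := by
    rw [hG, py_add (h1s.add h2M2) (h3s.mul hMM), py_add h1s h2M2, py2 h2M, py_mul h2s hM,
      py_mul h3s hMM, py_mul hM hM, py_px hf.px, py_px hf, py_px hf.py]
  -- The identity E(p, M(p)) = 0 differentiated in x at the origin reads 12ρ - 6 M_x = 0.
  have hMx : px M 0 = 2 * ρ := by
    set φ : ℝ × ℝ → ℝ := fun p => E (p, M p) with hφ
    have e : φ = fun p => ((A p + B p * (3 * M p)) + C p * (3 * (M p * M p))) +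
        D p * (M p * (M p * M p)) := by
      funext p
      simp only [hφ, hE, cubicForm, ← hA, ← hB, ← hC, ← hD]
      ring
    have h3M : ContDiff ℝ ∞ fun p => 3 * M p := contDiff_const.mul hM
    have h3MM : ContDiff ℝ ∞ fun p => 3 * (M p * M p) := contDiff_const.mul hMM
    have hMMM := hM.mul hMM
    have h0 : px φ 0 = px A 0 + B 0 * (3 * px M 0) := by
      rw [e, px_add ((hAs.add (hBs.mul h3M)).add (hCs.mul h3MM)) (hDs.mul hMMM),
        px_add (hAs.add (hBs.mul h3M)) (hCs.mul h3MM), px_add hAs (hBs.mul h3M),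
        px_mul hBs h3M, px_mul hCs h3MM, px_mul hDs hMMM, px_mul contDiff_const hM,
        px_mul contDiff_const hMM, px_mul hM hMM, px_mul hM hM]
      have hc : px (fun _ => (3 : ℝ)) 0 = 0 := by simp [px]
      simp [hM0, hc]
    have h1 : px φ 0 = 0 := by
      have ht : Tendsto (fun p => (p, M p)) (𝓝 (0 : ℝ × ℝ)) (𝓝 ((0 : ℝ × ℝ), (0 : ℝ))) :=
        (continuous_id.prodMk hM.continuous).tendsto' _ _ (by simp [hM0])
      have : φ =ᶠ[𝓝 0] fun _ => 0 := by
        filter_upwards [ht.eventually hEM] with p hp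
        exact hp.2 rfl
      rw [px, this.fderiv_eq]
      simp
    rw [h1] at h0
    rw [hAx, hB0] at h0
    linarith
  have hGs : ContDiff ℝ ∞ G := (h1s.add h2M2).add (h3s.mul hMM)
  refine ⟨G, hGs, ?_, ?_, ?_, ?_, ?_⟩
  · simp [hG, h.xx, hM0]
  · simp [gx, hM0, h.xy, hA0]
  · simp [gy, hM0, h.xy, hB0]
  · have hMX := hM.px
    have u1 := hBs.mul hM
    have u2 := h2s.mul hMX
    have u3 : ContDiff ℝ ∞ fun p => 2 * (B p * M p + px (py f) p * px M p) :=
      contDiff_const.mul (u1.add u2)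
    have u4 := hCs.mul hMM
    have u5 := (hMX.mul hM).add (hM.mul hMX)
    rw [gx, px_add (hAs.add u3) (u4.add (h3s.mul u5)), px_add hAs u3, px2 (u1.add u2),
      px_add u1 u2, px_add u4 (h3s.mul u5), px_mul hBs hM, px_mul h2s hMX, px_mul hCs hMM,
      px_mul h3s u5, px_add (hMX.mul hM) (hM.mul hMX), px_mul hMX hM, px_mul hM hMX, px_mul hM hM]
    have h3 : px (px (py f)) 0 = -2 := h.xxy
    simp only [hM0, hAx, h3, hB0, hMx, h.xy, h.yy]
    ring
  · obtain ⟨δ, hδ, hball⟩ := Metric.eventually_nhds_iff.1 hEM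
    have ht : Tendsto (fun p => (p, M p)) (𝓝 (0 : ℝ × ℝ)) (𝓝 ((0 : ℝ × ℝ), (0 : ℝ))) :=
      (continuous_id.prodMk hM.continuous).tendsto' _ _ (by simp [hM0])
    have c1 : ∀ᶠ p in 𝓝 0, |px (px f) p| < δ ^ 2 / 8 := by
      have : Tendsto (fun p => |px (px f) p|) (𝓝 0) (𝓝 0) :=
        h1s.continuous.abs.tendsto' _ _ (by simp [h.xx])
      exact this.eventually (gt_mem_nhds (by positivity))
    have c2 : ∀ᶠ p in 𝓝 0, |px (py f) p| < δ / 8 := by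
      have : Tendsto (fun p => |px (py f) p|) (𝓝 0) (𝓝 0) :=
        h2s.continuous.abs.tendsto' _ _ (by simp [h.xy])
      exact this.eventually (gt_mem_nhds (by positivity))
    have c3 : ∀ᶠ p in 𝓝 0, 1 / 2 < py (py f) p := by
      have : Tendsto (py (py f)) (𝓝 0) (𝓝 1) := h3s.continuous.tendsto' _ _ h.yy
      exact this.eventually (lt_mem_nhds (by norm_num))
    filter_upwards [ht.eventually hEM, c1, c2, c3, Metric.ball_mem_nhds (0 : ℝ × ℝ) hδ]
      with p h0 h1 h2 h3 h4
    constructor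
    · rintro ⟨v, hv, hh, hcub⟩
      -- The direction (0, 1) is not isotropic, as f_yy stays near 1; every candidate can therefore
      -- be normalized to (1, m).
      have hv1 : v.1 ≠ 0 := by
        intro hv1
        simp only [hess, hv1, mul_zero, zero_mul, zero_add, mul_eq_zero] at hh
        have : v.2 = 0 := by
          rcases hh with (hh | hh) | hh
          · linarith
          · exact hh
          · exact hh
        exact hv (Prod.ext hv1 this)
      set m := v.2 / v.1 with hm
      have hv2 : v.2 = m * v.1 := by rw [hm, div_mul_cancel₀ _ hv1]
      have hh' : px (px f) p + 2 * px (py f) p * m + py (py f) p * m ^ 2 = 0 := by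
        have : v.1 ^ 2 * (px (px f) p + 2 * px (py f) p * m + py (py f) p * m ^ 2) = 0 := by
          rw [← hh, hess, hv2]; ring
        exact (mul_eq_zero.1 this).resolve_left (by positivity)
      have hcub' : E (p, m) = 0 := by
        have : v.1 ^ 3 * E (p, m) = 0 := by
          rw [← hcub]
          simp only [hE, cubicForm]
          rw [hv2]; ring
        exact (mul_eq_zero.1 this).resolve_left (by positivity)
      -- An asymptotic slope near the origin is small, because f_xx and f_xy are small while f_yy >
      -- 1/2. This puts (p, m) inside the domain of the implicit function, so no common direction is
      -- missed.
      have hmδ : |m| < δ := by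
        by_contra! hmδ
        have i1 : -(δ ^ 2 / 8) < px (px f) p := (abs_lt.1 h1).1
        have i2 : |px (py f) p * m| ≤ δ / 8 * |m| := by
          rw [abs_mul]
          exact mul_le_mul_of_nonneg_right h2.le (abs_nonneg _)
        have i3 := (abs_le.1 i2).1
        have i4 : 1 / 2 * |m| ^ 2 ≤ py (py f) p * m ^ 2 := by
          rw [sq_abs]
          exact mul_le_mul_of_nonneg_right h3.le (sq_nonneg _)
        nlinarith
      have hdist : dist (p, m) ((0 : ℝ × ℝ), (0 : ℝ)) < δ := by
        rw [Prod.dist_eq]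
        exact max_lt h4 (by simpa using hmδ)
      have hmM : m = M p := (hball hdist).1 hcub'
      rw [hmM] at hh'
      simp only [hG]
      linarith
    · intro hGp
      refine ⟨(1, M p), fun h => one_ne_zero (congrArg Prod.fst h), ?_, h0.2 rfl⟩
      simp only [hG] at hGp
      simp only [hess]
      linarith

/-! ### Closures of curves -/

/-- Flecnodal points and pairs of coinciding points are controlled only away from `s`. There the set
agrees locally with a closed zero set, and `s` is added by the closure because it is an accumulation
point. -/
theorem eventually_mem_closure_iff {s : ℝ × ℝ} {B : Set (ℝ × ℝ)} {g : ℝ × ℝ → ℝ}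
    (hg : Continuous g) (hg0 : g s = 0) (hB : ∀ᶠ u in 𝓝 s, u ≠ s → (u ∈ B ↔ g u = 0))
    (hf : ∃ᶠ u in 𝓝 s, g u = 0 ∧ u ≠ s) : ∀ᶠ u in 𝓝 s, u ∈ closure B ↔ g u = 0 := by
  filter_upwards [hB.eventually_nhds, hB] with u h1 h2
  rcases eq_or_ne u s with rfl | hus
  · refine iff_of_true (mem_closure_iff_frequently.2 ?_) hg0
    exact (hf.and_eventually hB).mono fun u h => (h.2 h.1.2).2 h.1.1
  · constructor
    · intro hu
      have h3 : ∃ᶠ w in 𝓝 u, g w = 0 :=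
        ((mem_closure_iff_frequently.1 hu).and_eventually
          (h1.and (isOpen_ne.mem_nhds hus))).mono fun w h => (h.2.1 h.2.2).1 h.1
      have : u ∈ closure {w | g w = 0} := mem_closure_iff_frequently.2 h3
      rwa [(isClosed_eq hg continuous_const).closure_eq] at this
    · exact fun h => subset_closure ((h2 hus).2 h)

namespace Front.IsDualGraph

variable {T : Front} {s : ℝ × ℝ} {χ ξ : ℝ × ℝ → ℝ × ℝ} {f lam mu : ℝ × ℝ → ℝ}
  {L L' : (Fin 4 → ℝ) →L[ℝ] (Fin 4 → ℝ)}

/-- The usual Taylor criterion for a graph: a line has four-point contact if the quadratic and cubic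
terms of f both vanish in its direction. -/
theorem dual_isFlecnodal_iff (h : T.IsDualGraph s χ ξ f lam mu L L') {u : ℝ × ℝ}
    (hu : u ∈ T.dom) : T.dual.IsFlecnodal u ↔
      ∃ v : ℝ × ℝ, v ≠ 0 ∧ hess f (χ u) v v = 0 ∧ cubicForm f (χ u) v = 0 := by
  have hf := h.contDiff
  have hF : ∀ {a b : ℝ → ℝ}, ContDiff ℝ ∞ a → ContDiff ℝ ∞ b →
      let P := fun t => graphPlane f (a t, b t)
      let F := fun t => f (a t, b t)
      let R := fun t => L' (P t)
      R 0 = L' ![a 0, b 0, F 0, 1] ∧ deriv R 0 = L' ![deriv a 0, deriv b 0, deriv F 0, 0] ∧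
      deriv (deriv R) 0 = L' ![deriv (deriv a) 0, deriv (deriv b) 0, deriv (deriv F) 0, 0] ∧
      deriv (deriv (deriv R)) 0 = L' ![deriv (deriv (deriv a)) 0, deriv (deriv (deriv b)) 0,
        deriv (deriv (deriv F)) 0, 0] := by
    intro a b ha hb P F R
    have hP : ContDiff ℝ ∞ P := (contDiff_graphPlane hf).comp (ha.prodMk hb)
    have hFs : ContDiff ℝ ∞ F := hf.comp (ha.prodMk hb)
    have e1 : deriv P = fun t => ![deriv a t, deriv b t, deriv F t, deriv (fun _ : ℝ => (1 : ℝ)) t] :=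
      deriv_vec4 ha hb hFs contDiff_const
    simp only [deriv_const] at e1
    have e2 : deriv (deriv P) = fun t => ![deriv (deriv a) t, deriv (deriv b) t,
        deriv (deriv F) t, deriv (fun _ : ℝ => (0 : ℝ)) t] := by
      rw [e1]
      exact deriv_vec4 ha.deriv_infty hb.deriv_infty hFs.deriv_infty contDiff_const
    simp only [deriv_const] at e2
    have e3 : deriv (deriv (deriv P)) = fun t => ![deriv (deriv (deriv a)) t,
        deriv (deriv (deriv b)) t, deriv (deriv (deriv F)) t, deriv (fun _ : ℝ => (0 : ℝ)) t] := by
      rw [e2]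
      exact deriv_vec4 ha.deriv_infty.deriv_infty hb.deriv_infty.deriv_infty
        hFs.deriv_infty.deriv_infty contDiff_const
    simp only [deriv_const] at e3
    have d1 : deriv R = fun t => L' (deriv P t) := deriv_clm_curve L' hP
    have d2 : deriv (deriv R) = fun t => L' (deriv (deriv P) t) := by
      rw [d1]; exact deriv_clm_curve L' hP.deriv_infty
    have d3 : deriv (deriv (deriv R)) = fun t => L' (deriv (deriv (deriv P)) t) := by
      rw [d2]; exact deriv_clm_curve L' hP.deriv_infty.deriv_infty
    exact ⟨rfl, by rw [d1, e1], by rw [d2, e2], by rw [d3, e3]⟩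
  have hind : ∀ x y z w₁ w₂ w₃ : ℝ, (w₁ ≠ 0 ∨ w₂ ≠ 0) →
      LinearIndependent ℝ ![L' ![x, y, z, 1], L' ![w₁, w₂, w₃, 0]] := by
    intro x y z w₁ w₂ w₃ hw
    rw [LinearIndependent.pair_iff]
    intro c d hcd
    rw [← map_smul, ← map_smul, ← map_add] at hcd
    have := h.L'_injective (hcd.trans (map_zero L').symm)
    have i0 := congrFun this 0
    have i1 := congrFun this 1
    have i3 := congrFun this 3
    simp at i0 i1 i3
    subst i3
    simp at i0 i1
    tauto
  constructor
  · rintro ⟨-, γ, hγs, hγ0, hγ1, W, hW, hjet⟩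
    rw [jetIn_iff] at hjet
    obtain ⟨η, hη, hηγ⟩ := hγs.exists_contDiff
    have hη0 : η 0 = u := hηγ.self_of_nhds.trans hγ0
    have hηc : Tendsto η (𝓝 0) (𝓝 u) := hη.continuous.tendsto' _ _ hη0
    have hv0 : deriv η 0 ≠ 0 := by rwa [hηγ.deriv_eq]
    have hχη : ContDiff ℝ ∞ fun t => χ (η t) := h.chart.contDiff.comp hη
    set a := fun t => (χ (η t)).1 with ha
    set b := fun t => (χ (η t)).2 with hb
    have has : ContDiff ℝ ∞ a := hχη.fst
    have hbs : ContDiff ℝ ∞ b := hχη.snd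
    have hw : fderiv ℝ χ u (deriv η 0) = (deriv a 0, deriv b 0) := by
      rw [← deriv_pair has hbs, ← hη0]
      exact ((h.chart.contDiff.differentiable (by simp) _).hasFDerivAt.comp_hasDerivAt (0 : ℝ)
        (hη.differentiable (by simp) 0).hasDerivAt).deriv.symm
    have hw0 : (deriv a 0, deriv b 0) ≠ 0 := by
      rw [← hw]
      exact fun h0 => hv0 (h.fderiv_injective hu h0)
    have hab : (a 0, b 0) = χ u := by rw [← hη0]
    have hjet' : JetIn W fun t => L' (graphPlane f (a t, b t)) := by
      refine (jetIn_smul_iff (m := fun t => lam (η t)) (h.contDiff_lam.comp hη)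
        (L'.contDiff.comp ((contDiff_graphPlane hf).comp (has.prodMk hbs))) ?_).1 ?_
      · rw [hη0]; exact h.lam_ne u hu
      · refine hjet.congr ?_
        filter_upwards [hηγ, hηc.eventually (T.eventually_mem_dom hu)] with t h1 h2
        rw [← h1]
        exact h.plane_eq _ h2
    obtain ⟨e0, e1, e2, e3⟩ := hF has hbs
    obtain ⟨j0, j1, j2, j3⟩ := hjet'
    rw [e0] at j0
    rw [e1] at j1
    rw [e2] at j2
    rw [e3] at j3
    have hor : deriv a 0 ≠ 0 ∨ deriv b 0 ≠ 0 := by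
      by_contra! hc
      exact hw0 (Prod.ext hc.1 hc.2)
    have hli := hind (a 0) (b 0) (f (a 0, b 0)) _ _ (deriv (fun t => f (a t, b t)) 0) hor
    obtain ⟨x₂, y₂, k2⟩ := exists_smul_add_smul_of_finrank_eq_two hW hli j0 j1 j2
    obtain ⟨x₃, y₃, k3⟩ := exists_smul_add_smul_of_finrank_eq_two hW hli j0 j1 j3
    rw [← map_smul, ← map_smul, ← map_add] at k2 k3
    have k2 := h.L'_injective k2
    have k3 := h.L'_injective k3
    have k20 := congrFun k2 0
    have k21 := congrFun k2 1
    have k22 := congrFun k2 2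
    have k23 := congrFun k2 3
    have k30 := congrFun k3 0
    have k31 := congrFun k3 1
    have k32 := congrFun k3 2
    have k33 := congrFun k3 3
    simp at k20 k21 k22 k23 k30 k31 k32 k33
    subst k23 k33
    rw [deriv_deriv_curve hf has hbs, deriv_curve hf has hbs] at k22
    rw [deriv_deriv_deriv_curve hf has hbs, deriv_curve hf has hbs] at k32
    simp only [hab, zero_mul, zero_add] at k20 k21 k22 k30 k31 k32
    rw [k20, k21] at k22 k32
    rw [k30, k31] at k32
    have g2 : hess f (χ u) (deriv a 0, deriv b 0) (deriv a 0, deriv b 0) = 0 := by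
      simp only [hess]; linear_combination k22
    refine ⟨_, hw0, g2, ?_⟩
    simp only [hess] at g2
    simp only [cubicForm]
    -- Here α'' = y₂ α', so the mixed term of the third derivative is 3y₂ times the quadratic form
    -- in the direction α', which is already zero.
    linear_combination k32 - 3 * y₂ * g2
  · rintro ⟨v, hv, h2, h3⟩
    set p := χ u with hp
    -- Along a straight segment of the chart the second and third derivatives of the graph are the
    -- quadratic and cubic forms in direction v, so they vanish.
    set a : ℝ → ℝ := fun t => p.1 + t * v.1 with ha
    set b : ℝ → ℝ := fun t => p.2 + t * v.2 with hb
    have has : ContDiff ℝ ∞ a := by fun_prop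
    have hbs : ContDiff ℝ ∞ b := by fun_prop
    have a1 : deriv a = fun _ => v.1 := funext fun t =>
      (((hasDerivAt_id' t).mul_const v.1).const_add p.1).deriv.trans (one_mul _)
    have b1 : deriv b = fun _ => v.2 := funext fun t =>
      (((hasDerivAt_id' t).mul_const v.2).const_add p.2).deriv.trans (one_mul _)
    have a2 : deriv (deriv a) = fun _ => 0 := by rw [a1]; simp
    have b2 : deriv (deriv b) = fun _ => 0 := by rw [b1]; simp
    have a3 : deriv (deriv (deriv a)) = fun _ => 0 := by rw [a2]; simp
    have b3 : deriv (deriv (deriv b)) = fun _ => 0 := by rw [b2]; simp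
    have hab0 : (a 0, b 0) = p := by simp [ha, hb]
    have hγ : ContDiff ℝ ∞ fun t => ξ (a t, b t) := h.chart.contDiff_inv.comp (has.prodMk hbs)
    have hγ0 : ξ (a 0, b 0) = u := by rw [hab0]; exact h.left_inv u hu
    have hc : Tendsto (fun t => (a t, b t)) (𝓝 0) (𝓝 p) :=
      (has.prodMk hbs).continuous.tendsto' _ _ hab0
    have hχγ : (fun t => χ (ξ (a t, b t))) =ᶠ[𝓝 0] fun t => (a t, b t) :=
      hc.eventually (h.right_inv u hu)
    have hor : v.1 ≠ 0 ∨ v.2 ≠ 0 := by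
      by_contra! hc
      exact hv (Prod.ext hc.1 hc.2)
    set F := fun t => f (a t, b t) with hFdef
    have hli := hind p.1 p.2 (f p) v.1 v.2 (deriv F 0) hor
    refine ⟨h.dual_isRegular hu, _, hγ.smoothNear 0, hγ0, ?_,
      Submodule.span ℝ (Set.range ![L' ![p.1, p.2, f p, 1], L' ![v.1, v.2, deriv F 0, 0]]),
      by rw [finrank_span_eq_card hli]; simp, ?_⟩
    · intro h0
      have h1 : HasDerivAt (fun t => χ (ξ (a t, b t))) 0 0 := by
        have hd := (hγ.differentiable (by simp) 0).hasDerivAt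
        rw [h0] at hd
        have h1 := (h.chart.contDiff.differentiable (by simp)
          (ξ (a 0, b 0))).hasFDerivAt.comp_hasDerivAt (0 : ℝ) hd
        rwa [map_zero] at h1
      have h4 := h1.deriv
      rw [hχγ.deriv_eq, deriv_pair has hbs, a1, b1] at h4
      exact hv h4
    · rw [jetIn_iff]
      have hj : JetIn (Submodule.span ℝ
          (Set.range ![L' ![p.1, p.2, f p, 1], L' ![v.1, v.2, deriv F 0, 0]]))
          fun t => L' (graphPlane f (a t, b t)) := by
        obtain ⟨e0, e1, e2, e3⟩ := hF has hbs
        have f2 : deriv (deriv F) 0 = 0 := by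
          rw [hFdef, deriv_deriv_curve hf has hbs]
          simp only [a2, b2, hab0]
          simp only [a1, b1]
          simp only [hess] at h2
          linear_combination h2
        have f3 : deriv (deriv (deriv F)) 0 = 0 := by
          rw [hFdef, deriv_deriv_deriv_curve hf has hbs]
          simp only [a3, b3, hab0]
          simp only [a2, b2]
          simp only [a1, b1]
          simp only [cubicForm] at h3
          linear_combination h3
        have hz : (![0, 0, 0, 0] : Fin 4 → ℝ) = 0 := by ext i; fin_cases i <;> rfl
        refine ⟨?_, ?_, ?_, ?_⟩
        · rw [e0]
          refine Submodule.subset_span ⟨0, ?_⟩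
          simp only [hab0]
          simp [ha, hb]
        · rw [e1]
          refine Submodule.subset_span ⟨1, ?_⟩
          simp [a1, b1, hFdef]
        · rw [e2, f2]
          simp [a2, b2, hz]
        · rw [e3, f3]
          simp [a3, b3, hz]
      refine ((jetIn_smul_iff (m := fun t => lam (ξ (a t, b t))) (h.contDiff_lam.comp hγ)
        (L'.contDiff.comp ((contDiff_graphPlane hf).comp (has.prodMk hbs))) ?_).2 hj).congr ?_
      · rw [hγ0]; exact h.lam_ne u hu
      · have hγc : Tendsto (fun t => ξ (a t, b t)) (𝓝 0) (𝓝 u) :=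
          hγ.continuous.tendsto' _ _ hγ0
        filter_upwards [hχγ, hγc.eventually (T.eventually_mem_dom hu)] with t h1 h4
        change _ = T.plane _
        rw [h.plane_eq _ h4, h1]
        rfl

/-- Duality of four-point contact is applied in both directions, the bidual being the front itself.
Nondegeneracy of the Hessian supplies the vector needed to correct the third-order term. -/
theorem isFlecnodal_iff (h : T.IsDualGraph s χ ξ f lam mu L L') {u : ℝ × ℝ} (hu : u ∈ T.dom) :
    T.IsFlecnodal u ↔ hessDet f (χ u) ≠ 0 ∧
      ∃ v : ℝ × ℝ, v ≠ 0 ∧ hess f (χ u) v v = 0 ∧ cubicForm f (χ u) v = 0 := by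
  rw [← h.dual_isFlecnodal_iff hu]
  have hnd : hessDet f (χ u) ≠ 0 → ∀ v ≠ 0,
      ∃ z, fderiv ℝ T.plane u z ⬝ᵥ fderiv ℝ T.point u v ≠ 0 := by
    intro hd v hv
    by_contra! hz
    have hw : ∀ w, hess f (χ u) w (fderiv ℝ χ u v) = 0 := by
      intro w
      obtain ⟨z, rfl⟩ := h.fderiv_surjective hu w
      have := hz z
      rw [h.fderiv_plane_dotProduct_fderiv_point hu] at this
      exact (mul_eq_zero.1 this).resolve_left (mul_ne_zero (h.lam_ne u hu) (h.mu_ne u hu))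
    have h1 := hw (1, 0)
    have h2 := hw (0, 1)
    simp only [hess] at h1 h2
    refine hv (h.fderiv_injective hu (Prod.ext ?_ ?_))
    · refine (mul_eq_zero.1 ?_).resolve_left hd
      rw [hessDet]
      linear_combination py (py f) (χ u) * h1 - px (py f) (χ u) * h2
    · refine (mul_eq_zero.1 ?_).resolve_left hd
      rw [hessDet]
      linear_combination px (px f) (χ u) * h2 - px (py f) (χ u) * h1
  constructor
  · intro hF
    have hd := (h.isRegular_iff hu).1 hF.1
    exact ⟨hd, hF.dual (h.dual_isRegular hu) (hnd hd)⟩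
  · rintro ⟨hd, hF⟩
    have hr : T.dual.dual.IsRegular u := (h.isRegular_iff hu).2 hd
    refine hF.dual hr fun v hv => ?_
    obtain ⟨z, hz⟩ := hnd hd v hv
    by_contra! hc
    have hw : ∀ w, hess f (χ u) (fderiv ℝ χ u v) w = 0 := by
      intro w
      obtain ⟨z, rfl⟩ := h.fderiv_surjective hu w
      have := hc z
      change fderiv ℝ T.point u z ⬝ᵥ fderiv ℝ T.plane u v = 0 at this
      rw [dotProduct_comm, h.fderiv_plane_dotProduct_fderiv_point hu] at this
      exact (mul_eq_zero.1 this).resolve_left (mul_ne_zero (h.lam_ne u hu) (h.mu_ne u hu))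
    apply hz
    rw [h.fderiv_plane_dotProduct_fderiv_point hu]
    have := hw (fderiv ℝ χ u z)
    simp only [hess] at this ⊢
    rw [show ∀ x y z : ℝ, x = 0 → y * z * x = 0 from fun x y z hx => by rw [hx, mul_zero]]
    linarith

end Front.IsDualGraph

/-! ### Weighted expansion at a godron and branches of the contour. -/

theorem deriv_comp_axis {F : ℝ × ℝ → ℝ} (hF : ContDiff ℝ ∞ F) :
    deriv (fun t => F (t, 0)) = fun t => px F (t, 0) := by
  rw [deriv_curve (a := fun t => t) (b := fun _ => 0) hF contDiff_id contDiff_const]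
  simp

/-- The weighted expansion of a smooth function at a godron. -/
theorem IsGodronJet.exists_expansion {f : ℝ × ℝ → ℝ} {ρ : ℝ} (h : IsGodronJet f ρ)
    (hf : ContDiff ℝ ∞ f) : ∃ (A : ℝ × ℝ → ℝ) (B C : ℝ → ℝ), ContDiff ℝ ∞ A ∧ ContDiff ℝ ∞ B ∧
      ContDiff ℝ ∞ C ∧ A 0 = 1 / 2 ∧ B 0 = -1 ∧ C 0 = ρ / 2 ∧
      ∀ p, f p = p.2 ^ 2 * A p + p.1 ^ 2 * p.2 * B p.1 + p.1 ^ 4 * C p.1 := by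
  have hz : ((0 : ℝ), (0 : ℝ)) = 0 := rfl
  have hax : ContDiff ℝ ∞ fun t : ℝ => (t, (0 : ℝ)) := contDiff_id.prodMk contDiff_const
  have hf0 : ContDiff ℝ ∞ fun p : ℝ × ℝ => f (p.1, 0) := hf.comp (hax.comp contDiff_fst)
  obtain ⟨g, hg, hfg⟩ := (hf.sub hf0).exists_eq_snd_mul (by simp)
  have hg0 : ContDiff ℝ ∞ fun p : ℝ × ℝ => g (p.1, 0) := hg.comp (hax.comp contDiff_fst)
  obtain ⟨A, hA, hgA⟩ := (hg.sub hg0).exists_eq_snd_mul (by simp)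
  -- On the axis the Hadamard quotient is f_y(x, 0), whose Taylor coefficients are prescribed by the
  -- jet.
  have hgy : (fun t => g (t, 0)) = fun t => py f (t, 0) := by
    funext t
    have h1 := hasDerivAt_curve_pair hf (a := fun _ => t) (b := fun s => s) contDiff_const
      contDiff_id 0
    have hgt : ContDiff ℝ ∞ fun s => g (t, s) := hg.comp (contDiff_const.prodMk contDiff_id)
    have h2 := ((hasDerivAt_id' (0 : ℝ)).fun_mul (hgt.hasDerivAt' 0)).const_add (f (t, 0))
    have e : (fun s => f (t, s)) = fun s => f (t, 0) + s * g (t, s) := by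
      funext s
      have := hfg (t, s)
      simp only at this
      linarith
    rw [e] at h1
    have := h1.unique h2
    simp at this
    exact this.symm
  obtain ⟨B, hB, hgB, hB0⟩ := ContDiff.exists_eq_sq_mul (f := fun t => g (t, 0)) (hg.comp hax)
    ((congrFun hgy 0).trans h.y)
    (by rw [hgy, deriv_comp_axis hf.py]; exact h.xy)
  rw [hgy, deriv_comp_axis hf.py, deriv_comp_axis hf.py.px] at hB0
  obtain ⟨C, hC, hfC, hC0⟩ := ContDiff.exists_eq_pow_mul (f := fun t => f (t, 0)) (hf.comp hax) 4
    (fun i hi => by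
      interval_cases i
      · rw [iteratedDeriv_zero]; exact h.zero
      · rw [iteratedDeriv_one, deriv_comp_axis hf]; exact h.x
      · simp only [iteratedDeriv_succ, iteratedDeriv_zero]
        rw [deriv_comp_axis hf, deriv_comp_axis hf.px]; exact h.xx
      · simp only [iteratedDeriv_succ, iteratedDeriv_zero]
        rw [deriv_comp_axis hf, deriv_comp_axis hf.px, deriv_comp_axis hf.px.px]; exact h.xxx)
  simp only [iteratedDeriv_succ, iteratedDeriv_zero] at hC0
  rw [deriv_comp_axis hf, deriv_comp_axis hf.px, deriv_comp_axis hf.px.px,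
    deriv_comp_axis hf.px.px.px] at hC0
  simp only [hz, h.xxy] at hB0
  simp only [hz, h.xxxx, Nat.factorial] at hC0
  have hexp : ∀ p : ℝ × ℝ, f p = p.2 ^ 2 * A p + p.1 ^ 2 * p.2 * B p.1 + p.1 ^ 4 * C p.1 := by
    intro p
    have h1 := hfg p
    have h2 := hgA p
    have h3 := hgB p.1
    have h4 := hfC p.1
    linear_combination h1 + p.2 * h2 + p.2 * h3 + h4
  refine ⟨A, B, C, hA, hB, hC, ?_, by linarith, by push_cast at hC0; linarith, hexp⟩
  have hA0 : ContDiff ℝ ∞ fun s : ℝ => A (0, s) := hA.comp (contDiff_const.prodMk contDiff_id)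
  have h1 := iteratedDeriv_pow_mul_zero 2 hA0
  have e : (fun s : ℝ => s ^ 2 * A (0, s)) = fun s => f (0, s) := by
    funext s; rw [hexp]; simp
  rw [e] at h1
  simp only [iteratedDeriv_succ, iteratedDeriv_zero] at h1
  rw [deriv_deriv_curve (a := fun _ => 0) (b := fun s => s) hf contDiff_const contDiff_id] at h1
  simp [hz, h.yy] at h1
  linarith

/-- The 2-jet of y a + x² w, which is the shape of each factor of the contour equation. -/
theorem partials_of_weighted {a w : ℝ × ℝ → ℝ} (ha : ContDiff ℝ ∞ a) (hw : ContDiff ℝ ∞ w) :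
    let G : ℝ × ℝ → ℝ := fun p => p.2 * a p + p.1 * (p.1 * w p)
    ContDiff ℝ ∞ G ∧ G 0 = 0 ∧ px G 0 = 0 ∧ py G 0 = a 0 ∧ px (px G) 0 = 2 * w 0 := by
  intro G
  have h1 : ContDiff ℝ ∞ fun p : ℝ × ℝ => p.1 := contDiff_fst
  have h2 : ContDiff ℝ ∞ fun p : ℝ × ℝ => p.2 := contDiff_snd
  have x1 : px (fun p : ℝ × ℝ => p.1) = fun _ => 1 := funext fun p => by
    rw [px, fderiv_fst]; rfl
  have x2 : px (fun p : ℝ × ℝ => p.2) = fun _ => 0 := funext fun p => by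
    rw [px, fderiv_snd]; rfl
  have y1 : py (fun p : ℝ × ℝ => p.1) = fun _ => 0 := funext fun p => by
    rw [py, fderiv_fst]; rfl
  have y2 : py (fun p : ℝ × ℝ => p.2) = fun _ => 1 := funext fun p => by
    rw [py, fderiv_snd]; rfl
  have h1w := h1.mul hw
  have gx : px G = fun p => p.2 * px a p + p.1 * (w p + (w p + p.1 * px w p)) := by
    rw [px_add (h2.mul ha) (h1.mul h1w), px_mul h2 ha, px_mul h1 h1w, px_mul h1 hw, x1, x2]
    funext p; ring
  have gy : py G = fun p => a p + p.2 * py a p + p.1 * (p.1 * py w p) := by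
    rw [py_add (h2.mul ha) (h1.mul h1w), py_mul h2 ha, py_mul h1 h1w, py_mul h1 hw, y1, y2]
    funext p; ring
  have h3 : ContDiff ℝ ∞ fun p => w p + (w p + p.1 * px w p) := hw.add (hw.add (h1.mul hw.px))
  refine ⟨(h2.mul ha).add (h1.mul h1w), by simp [G], by simp [gx], by simp [gy], ?_⟩
  rw [gx, px_add (h2.mul ha.px) (h1.mul h3), px_mul h2 ha.px, px_mul h1 h3, x1, x2]
  simp
  ring

/-- The contour at a hyperbolic godron consists of two smooth branches. -/
theorem IsGodronJet.exists_branches {f : ℝ × ℝ → ℝ} {ρ : ℝ} (h : IsGodronJet f ρ)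
    (hf : ContDiff ℝ ∞ f) (hρ : ρ < 1) : ∃ G : Bool → ℝ × ℝ → ℝ,
      (∀ b, ContDiff ℝ ∞ (G b) ∧ G b 0 = 0 ∧ px (G b) 0 = 0 ∧ py (G b) 0 = 1) ∧
      px (px (G false)) 0 = -2 * (1 - √(1 - ρ)) ∧ px (px (G true)) 0 = -2 * (1 + √(1 - ρ)) ∧
      ∀ᶠ p in 𝓝 0, f p = 0 ↔ G false p = 0 ∨ G true p = 0 := by
  obtain ⟨A, B, C, hA, hB, hC, hA0, hB0, hC0, hexp⟩ := h.exists_expansion hf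
  have hB1 : ContDiff ℝ ∞ fun p : ℝ × ℝ => B p.1 := hB.comp contDiff_fst
  have hC1 : ContDiff ℝ ∞ fun p : ℝ × ℝ => C p.1 := hC.comp contDiff_fst
  -- The expansion is treated as a quadratic polynomial in y although A depends on y. Its
  -- discriminant is x⁴Δ with Δ(0) = 1 - ρ > 0, so √Δ is smooth near the origin.
  set Δ : ℝ × ℝ → ℝ := fun p => B p.1 ^ 2 - 4 * A p * C p.1 with hΔ
  have hΔs : ContDiff ℝ ∞ Δ := (hB1.pow 2).sub ((contDiff_const.mul hA).mul hC1)
  have hΔ0 : Δ 0 = 1 - ρ := by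
    simp only [hΔ, hA0, Prod.fst_zero, hB0, hC0]; ring
  have hpos : ∀ᶠ p in 𝓝 0, 0 < Δ p :=
    hΔs.continuous.continuousAt.eventually (lt_mem_nhds (by rw [hΔ0]; linarith))
  have hsm : SmoothNear (fun p => √(Δ p)) (0 : ℝ × ℝ) := by
    filter_upwards [hpos] with p hp
    exact hΔs.contDiffAt.sqrt hp.ne'
  obtain ⟨r, hr, hrΔ⟩ := hsm.exists_contDiff
  have hr0 : r 0 = √(1 - ρ) := hrΔ.self_of_nhds.trans (by simp only [hΔ0])
  have h2A : ContDiff ℝ ∞ fun p => 2 * A p := contDiff_const.mul hA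
  obtain ⟨p1, p2, p3, p4, p5⟩ := partials_of_weighted h2A (hB1.add hr)
  obtain ⟨m1, m2, m3, m4, m5⟩ := partials_of_weighted h2A (hB1.sub hr)
  refine ⟨fun b => bif b then fun p => p.2 * (2 * A p) + p.1 * (p.1 * (B p.1 - r p)) else
    fun p => p.2 * (2 * A p) + p.1 * (p.1 * (B p.1 + r p)), ?_, ?_, ?_, ?_⟩
  · rintro (_ | _)
    · exact ⟨p1, p2, p3, p4.trans (by simp only [hA0]; norm_num)⟩
    · exact ⟨m1, m2, m3, m4.trans (by simp only [hA0]; norm_num)⟩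
  · exact p5.trans (by simp only [Prod.fst_zero, hB0, hr0]; ring)
  · exact m5.trans (by simp only [Prod.fst_zero, hB0, hr0]; ring)
  · have hApos : ∀ᶠ p in 𝓝 0, 0 < A p :=
      hA.continuous.continuousAt.eventually (lt_mem_nhds (by rw [hA0]; norm_num))
    filter_upwards [hpos, hrΔ, hApos] with p h1 h2 h3
    have h4 : r p ^ 2 = Δ p := by rw [h2, Real.sq_sqrt h1.le]
    rw [cond_false, cond_true, ← mul_eq_zero]
    -- Completing the square factors 4A f, and A is nonzero near the origin.
    have : (p.2 * (2 * A p) + p.1 * (p.1 * (B p.1 + r p))) *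
        (p.2 * (2 * A p) + p.1 * (p.1 * (B p.1 - r p))) = 4 * A p * f p := by
      rw [hexp]
      simp only [hΔ] at h4
      linear_combination -p.1 ^ 4 * h4
    rw [this, mul_eq_zero, or_iff_right (by positivity)]

/-- With a negative discriminant, (2Ay + x²B)² = x⁴Δ on the zero set of f. This forces x = 0 and
then y = 0. -/
theorem IsGodronJet.eventually_ne_zero {f : ℝ × ℝ → ℝ} {ρ : ℝ} (h : IsGodronJet f ρ)
    (hf : ContDiff ℝ ∞ f) (hρ : 1 < ρ) : ∀ᶠ p in 𝓝 0, f p = 0 → p = 0 := by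
  obtain ⟨A, B, C, hA, hB, hC, hA0, hB0, hC0, hexp⟩ := h.exists_expansion hf
  have hB1 : ContDiff ℝ ∞ fun p : ℝ × ℝ => B p.1 := hB.comp contDiff_fst
  have hC1 : ContDiff ℝ ∞ fun p : ℝ × ℝ => C p.1 := hC.comp contDiff_fst
  set Δ : ℝ × ℝ → ℝ := fun p => B p.1 ^ 2 - 4 * A p * C p.1 with hΔ
  have hΔs : ContDiff ℝ ∞ Δ := (hB1.pow 2).sub ((contDiff_const.mul hA).mul hC1)
  have hΔ0 : Δ 0 = 1 - ρ := by
    simp only [hΔ, hA0, Prod.fst_zero, hB0, hC0]; ring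
  have hneg : ∀ᶠ p in 𝓝 0, Δ p < 0 :=
    hΔs.continuous.continuousAt.eventually (gt_mem_nhds (by rw [hΔ0]; linarith))
  have hApos : ∀ᶠ p in 𝓝 0, 0 < A p :=
    hA.continuous.continuousAt.eventually (lt_mem_nhds (by rw [hA0]; norm_num))
  filter_upwards [hneg, hApos] with p h1 h2 hp
  have h3 : (2 * A p * p.2 + p.1 ^ 2 * B p.1) ^ 2 = p.1 ^ 4 * Δ p := by
    have h4 := hexp p
    rw [hp] at h4
    simp only [hΔ]
    linear_combination -4 * A p * h4
  have hx : p.1 = 0 := by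
    by_contra hx
    have h5 : 0 < p.1 ^ 4 := by positivity
    have := sq_nonneg (2 * A p * p.2 + p.1 ^ 2 * B p.1)
    rw [h3] at this
    exact absurd (mul_neg_of_pos_of_neg h5 h1) (not_lt.2 this)
  rw [hx] at h3
  have hy : p.2 = 0 := by
    have : 2 * A p * p.2 = 0 := by simpa using h3
    simpa [h2.ne'] using this
  exact Prod.ext hx hy

/-! ### The swallowtail parametrization -/

/-- Coordinates on the source in which the coincidences of points of the front are those of the
standard swallowtail. -/
structure Front.IsSwallowtailChart (T : Front) (s : ℝ × ℝ) (h k : ℝ × ℝ → ℝ × ℝ) : Prop where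
  chart : IsChartAt h k s
  mem : s ∈ T.dom
  left_inv : ∀ u ∈ T.dom, k (h u) = u
  projEq_iff : ∀ u ∈ T.dom, ∀ w ∈ T.dom, ProjEq (T.point u) (T.point w) ↔
    standardSwallowtail (h u) = standardSwallowtail (h w)

/-- Two distinct parameters with the same image are two double roots of one monic quartic without
cubic term, hence opposite. The polynomial is then (x² - t²)², which gives a = -2t². -/
theorem standardSwallowtail_eq_iff {p q : ℝ × ℝ} (hpq : p ≠ q) :
    standardSwallowtail p = standardSwallowtail q ↔
      p.2 + 2 * p.1 ^ 2 = 0 ∧ q = (-p.1, p.2) := by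
  constructor
  · intro h
    have h0 := congrFun h 0
    have h1 := congrFun h 1
    have h2 := congrFun h 2
    simp [standardSwallowtail] at h0 h1 h2
    have ht : p.1 - q.1 ≠ 0 := fun ht => hpq (Prod.ext (sub_eq_zero.1 ht) h0)
    rw [← h0] at h1 h2
    have e1 : p.2 + 2 * (p.1 ^ 2 + p.1 * q.1 + q.1 ^ 2) = 0 := by
      refine (mul_eq_zero.1 ?_).resolve_left ht
      linear_combination -h1 / 2
    -- Modulo the relation already found, the difference of the last coordinates is the cube of the
    -- parameter difference times the sum of the parameters.
    have e2 : q.1 + p.1 = 0 := by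
      have : (p.1 - q.1) ^ 3 * (q.1 + p.1) = 0 := by
        linear_combination h2 - (p.1 - q.1) * (p.1 + q.1) * e1
      exact (mul_eq_zero.1 this).resolve_left (pow_ne_zero 3 ht)
    have e3 : q.1 = -p.1 := by linarith
    refine ⟨?_, Prod.ext e3 h0.symm⟩
    rw [e3] at e1
    linarith
  · rintro ⟨h1, rfl⟩
    have h2 : p.2 = -2 * p.1 ^ 2 := by linarith
    ext i
    fin_cases i
    · simp [standardSwallowtail]
    · simp [standardSwallowtail]; rw [h2]; ring
    · simp [standardSwallowtail]; ring

namespace Front.IsSwallowtailChart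

variable {T : Front} {s : ℝ × ℝ} {h k : ℝ × ℝ → ℝ × ℝ}

theorem contDiff_equation (hT : T.IsSwallowtailChart s h k) :
    ContDiff ℝ ∞ fun u => (h u).2 + 2 * (h u).1 ^ 2 :=
  hT.chart.contDiff.snd.add (contDiff_const.mul (hT.chart.contDiff.fst.pow 2))

theorem contDiff_parametrization (hT : T.IsSwallowtailChart s h k) :
    ContDiff ℝ ∞ fun t : ℝ => k (t, -2 * t ^ 2) :=
  hT.chart.contDiff_inv.comp (by fun_prop)

theorem tendsto_parametrization (hT : T.IsSwallowtailChart s h k) :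
    Tendsto (fun t : ℝ => k (t, -2 * t ^ 2)) (𝓝 0) (𝓝 s) :=
  hT.contDiff_parametrization.continuous.tendsto' _ _
    (by have := hT.chart.inv_zero; simpa [Prod.zero_eq_mk] using this)

theorem eventually_parametrization (hT : T.IsSwallowtailChart s h k) :
    ∀ᶠ t : ℝ in 𝓝 0, h (k (t, -2 * t ^ 2)) = (t, -2 * t ^ 2) := by
  have : Tendsto (fun t : ℝ => (t, -2 * t ^ 2)) (𝓝 0) (𝓝 (0 : ℝ × ℝ)) := by
    have hc : Continuous fun t : ℝ => (t, -2 * t ^ 2) := by fun_prop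
    exact hc.tendsto' _ _ (by simp)
  exact this.eventually hT.chart.right_inv

theorem frequently_equation (hT : T.IsSwallowtailChart s h k) :
    ∃ᶠ u in 𝓝 s, (h u).2 + 2 * (h u).1 ^ 2 = 0 ∧ u ≠ s := by
  refine (hT.tendsto_parametrization.mono_left
    (nhdsWithin_le_nhds (s := {0}ᶜ))).frequently (Eventually.frequently ?_)
  filter_upwards [hT.eventually_parametrization.filter_mono nhdsWithin_le_nhds,
    self_mem_nhdsWithin] with t h1 h2
  refine ⟨by rw [h1]; ring, fun h3 => h2 ?_⟩
  rw [h3, hT.chart.map_base] at h1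
  exact (congrArg Prod.fst h1).symm

/-- The partner of (t, -2t²) is (-t, -2t²), which also lies in the domain near `s`; t ≠ 0 makes the
two parameters distinct. -/
theorem eventually_mem_selfIntersection_iff (hT : T.IsSwallowtailChart s h k) :
    ∀ᶠ u in 𝓝 s, u ∈ T.selfIntersection ↔ (h u).2 + 2 * (h u).1 ^ 2 = 0 := by
  refine eventually_mem_closure_iff hT.contDiff_equation.continuous
    (by simp [hT.chart.map_base]) ?_ hT.frequently_equation
  have hcont : Continuous fun u => (-(h u).1, (h u).2) :=
    hT.chart.contDiff.continuous.fst.neg.prodMk hT.chart.contDiff.continuous.snd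
  have ht : Tendsto (fun u => (-(h u).1, (h u).2)) (𝓝 s) (𝓝 (0 : ℝ × ℝ)) :=
    hcont.tendsto' _ _ (by simp [hT.chart.map_base])
  filter_upwards [T.eventually_mem_dom hT.mem, ht.eventually hT.chart.right_inv,
    (hT.chart.tendsto_inv.comp ht).eventually (T.eventually_mem_dom hT.mem),
    hT.chart.eventually_eq_base] with u hu h1 h2 h3 hus
  constructor
  · rintro ⟨-, w, hw, hwu, hp⟩
    have hne : h u ≠ h w := fun he => hwu (by rw [← hT.left_inv u hu, he, hT.left_inv w hw])
    exact ((standardSwallowtail_eq_iff hne).1 ((hT.projEq_iff u hu w hw).1 hp)).1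
  · intro hg
    have ht0 : (h u).1 ≠ 0 := by
      intro ht0
      rw [ht0] at hg
      exact hus (h3 (Prod.ext ht0 (by simpa using hg)))
    have hne : h u ≠ (-(h u).1, (h u).2) := fun he => ht0 (by
      have := congrArg Prod.fst he
      simp only at this
      linarith)
    refine ⟨hu, k (-(h u).1, (h u).2), h2, fun he => hne ?_, ?_⟩
    · rw [← h1, he]
    · refine (hT.projEq_iff u hu _ h2).2 ?_
      simp only [Function.comp_apply, h1]
      exact (standardSwallowtail_eq_iff hne).2 ⟨hg, rfl⟩

end Front.IsSwallowtailChart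

/-- Only orders one and three are needed: one for the tangent direction of the double curve and one
for its coefficient. -/
theorem deriv_zero_of_even {e : ℝ → ℝ} (h : ∀ᶠ t in 𝓝 0, e (-t) = e t) :
    deriv e 0 = 0 ∧ deriv (deriv (deriv e)) 0 = 0 := by
  have h1 : ∀ n, Odd n → iteratedDeriv n e 0 = 0 := fun n hn => by
    have h2 := iteratedDeriv_comp_neg n e 0
    rw [Filter.EventuallyEq.iteratedDeriv_eq n h, hn.neg_one_pow] at h2
    simp at h2
    linarith
  refine ⟨by simpa [iteratedDeriv_one] using h1 1 (by decide), ?_⟩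
  have := h1 3 (by decide)
  simpa only [iteratedDeriv_succ, iteratedDeriv_zero] using this

/-! ### Coefficients of the special curves in the graph chart. -/

namespace Front.IsDualGraph

variable {T : Front} {s : ℝ × ℝ} {χ ξ h k : ℝ × ℝ → ℝ × ℝ} {f lam mu : ℝ × ℝ → ℝ}
  {L L' : (Fin 4 → ℝ) →L[ℝ] (Fin 4 → ℝ)} {ρ : ℝ}

theorem isGraphCurve_cuspidalEdge (hG : T.IsDualGraph s χ ξ f lam mu L L')
    (hj : IsGodronJet f ρ) : IsGraphCurve χ s T.cuspidalEdge (3 * ρ - 2) := by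
  obtain ⟨h0, h1, h2, h3⟩ := hj.hessDet hG.contDiff
  refine IsGraphCurve.of_eventually_zero hG.chart (contDiff_hessDet hG.contDiff) h0 h1
    (by rw [h2]; norm_num) ?_ (by rw [h2, h3]; ring)
  filter_upwards [T.eventually_mem_dom hG.mem] with u hu
  exact hG.mem_cuspidalEdge_iff hu

theorem dual_parabolicCurve (hG : T.IsDualGraph s χ ξ f lam mu L L') :
    T.dual.parabolicCurve = T.cuspidalEdge := by
  ext u
  constructor
  · intro hu
    have hd : u ∈ T.dom := hu.1.1
    exact (hG.mem_cuspidalEdge_iff hd).2 ((hG.dual_isParabolic_iff hd).1 hu)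
  · intro hu
    have hd : u ∈ T.dom := hu.1
    exact (hG.dual_isParabolic_iff hd).2 ((hG.mem_cuspidalEdge_iff hd).1 hu)

theorem isGraphCurve_flecnodalCurve (hG : T.IsDualGraph s χ ξ f lam mu L L')
    (hj : IsGodronJet f ρ) (hρ : ρ ≠ 1) : IsGraphCurve χ s T.flecnodalCurve (2 * ρ ^ 2 - ρ) ∧
      IsGraphCurve χ s T.dual.flecnodalCurve (2 * ρ ^ 2 - ρ) := by
  obtain ⟨G, hGs, h0, h1, h2, h3, h4⟩ := hj.exists_flecnodal_equation hG.contDiff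
  have hcont : Continuous fun u => G (χ u) := hGs.continuous.comp hG.chart.contDiff.continuous
  have hk : px (px G) 0 + 2 * (2 * ρ ^ 2 - ρ) * py G 0 = 0 := by rw [h2, h3]; ring
  have hS : IsGraphCurve χ s {u | G (χ u) = 0} (2 * ρ ^ 2 - ρ) :=
    IsGraphCurve.of_eventually_zero hG.chart hGs h0 h1 (by rw [h2]; norm_num)
      (Eventually.of_forall fun u => Iff.rfl) hk
  -- The coefficients differ by 2(ρ - 1)². Hence the zero set avoids the cuspidal edge away from
  -- `s`, and its points are regular points of the front, as the definition of a flecnodal point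
  -- requires.
  have hne : 2 * ρ ^ 2 - ρ ≠ 3 * ρ - 2 := by
    intro h
    have h5 : (ρ - 1) ^ 2 = 0 := by linarith
    exact hρ (by linarith [pow_eq_zero_iff (two_ne_zero) |>.1 h5])
  have hnP := hS.eventually_not_mem hG.chart (hG.isGraphCurve_cuspidalEdge hj) hne
  constructor
  · refine IsGraphCurve.congr hS (eventually_mem_closure_iff hcont (by simp [hG.chart.map_base, h0])
      ?_ (hS.frequently_mem hG.chart))
    filter_upwards [T.eventually_mem_dom hG.mem, hG.chart.tendsto.eventually h4, hnP]
      with u hu h5 h6 hus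
    rw [hG.isFlecnodal_iff hu, h5]
    refine and_iff_right_of_imp fun h7 h8 => ?_
    exact h6 h7 hus ((hG.mem_cuspidalEdge_iff hu).2 h8)
  · refine IsGraphCurve.congr hS (eventually_mem_closure_iff hcont (by simp [hG.chart.map_base, h0])
      ?_ (hS.frequently_mem hG.chart))
    filter_upwards [T.eventually_mem_dom hG.mem, hG.chart.tendsto.eventually h4]
      with u hu h5 hus
    rw [hG.dual_isFlecnodal_iff hu, h5]

/-- Bitangent planes of the dual surface are double points of the front. The plane is injective on
the domain, so distinct parameters already mean distinct points of the dual. -/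
theorem dual_conodalCurve (hG : T.IsDualGraph s χ ξ f lam mu L L') :
    T.dual.conodalCurve = T.selfIntersection := by
  rw [conodalCurve, selfIntersection]
  congr 1
  ext u
  constructor
  · rintro ⟨hu, w, hw, h1, h2⟩
    refine ⟨hu, w, hw, ?_, h2⟩
    rintro rfl
    exact h1 ((hG.projEq_plane_iff hu hw).2 rfl)
  · rintro ⟨hu, w, hw, h1, h2⟩
    exact ⟨hu, w, hw, fun h3 => h1 ((hG.projEq_plane_iff hu hw).1 h3).symm, h2⟩

/-- The double curve is parametrized by t, with t and -t having the same image, so f_x and f_y are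
even functions of t along it. The first derivative of f_y gives y' = 0, and the third derivative of
f_x gives 12ρx'³ - 6x'y'' = 0, hence the coefficient ρ. -/
theorem isGraphCurve_selfIntersection (hG : T.IsDualGraph s χ ξ f lam mu L L')
    (hj : IsGodronJet f ρ) (hT : T.IsSwallowtailChart s h k) :
    IsGraphCurve χ s T.selfIntersection ρ := by
  have hf := hG.contDiff
  set H₁ : ℝ × ℝ → ℝ := fun p => (h (ξ p)).1 with hH₁
  set H₂ : ℝ × ℝ → ℝ := fun p => (h (ξ p)).2 with hH₂
  have hs1 : ContDiff ℝ ∞ H₁ := (hT.chart.contDiff.comp hG.chart.contDiff_inv).fst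
  have hs2 : ContDiff ℝ ∞ H₂ := (hT.chart.contDiff.comp hG.chart.contDiff_inv).snd
  have h10 : H₁ 0 = 0 := by simp [hH₁, hG.chart.inv_zero, hT.chart.map_base]
  have h20 : H₂ 0 = 0 := by simp [hH₂, hG.chart.inv_zero, hT.chart.map_base]
  set δ : ℝ → ℝ × ℝ := fun t => χ (k (t, -2 * t ^ 2)) with hδ
  have hδs : ContDiff ℝ ∞ δ := hG.chart.contDiff.comp hT.contDiff_parametrization
  set x : ℝ → ℝ := fun t => (δ t).1 with hx
  set y : ℝ → ℝ := fun t => (δ t).2 with hy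
  have hxs : ContDiff ℝ ∞ x := hδs.fst
  have hys : ContDiff ℝ ∞ y := hδs.snd
  have hxy0 : (x 0, y 0) = 0 := by
    have := hT.chart.inv_zero
    simp only [Prod.zero_eq_mk] at this
    simp [hx, hy, hδ, this, hG.chart.map_base]
  have hξδ : ∀ᶠ t in 𝓝 0, ξ (x t, y t) = k (t, -2 * t ^ 2) :=
    hT.tendsto_parametrization.eventually hG.chart.left_inv
  have hHδ : ∀ᶠ t in 𝓝 0, h (ξ (x t, y t)) = (t, -2 * t ^ 2) := by
    filter_upwards [hξδ, hT.eventually_parametrization] with t h1 h2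
    rw [h1, h2]
  have heven : ∀ᶠ t in 𝓝 0, graphPoint f (x (-t), y (-t)) = graphPoint f (x t, y t) := by
    have hd := hT.tendsto_parametrization.eventually (T.eventually_mem_dom hG.mem)
    have hneg : Tendsto (fun t : ℝ => -t) (𝓝 0) (𝓝 0) := continuous_neg.tendsto' _ _ neg_zero
    filter_upwards [hd, hneg.eventually hd, hT.eventually_parametrization,
      hneg.eventually hT.eventually_parametrization] with t h1 h2 h3 h4
    refine hG.graphPoint_eq_of_projEq h2 h1 ?_
    rw [hT.projEq_iff _ h2 _ h1, h3, h4]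
    ext i
    fin_cases i
    · simp [standardSwallowtail]
    · simp [standardSwallowtail]; ring
    · simp [standardSwallowtail]; ring
  have hy1 : deriv y 0 = 0 := by
    have h1 := (deriv_zero_of_even (e := fun t => py f (x t, y t))
      (heven.mono fun t ht => congrFun ht 1)).1
    rw [deriv_curve hf.py hxs hys] at h1
    simpa [hxy0, hj.xy, hj.yy] using h1
  have hx1 : px H₁ 0 * deriv x 0 = 1 := by
    have h1 := hasDerivAt_curve_pair hs1 hxs hys 0
    have h2 : HasDerivAt (fun t => H₁ (x t, y t)) 1 0 :=
      (hasDerivAt_id' (0 : ℝ)).congr_of_eventuallyEq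
        (hHδ.mono fun t ht => congrArg Prod.fst ht)
    have h3 := h1.unique h2
    simpa [hxy0, hy1] using h3
  have hx0 : deriv x 0 ≠ 0 := right_ne_zero_of_mul_eq_one hx1
  have hy2 : deriv (deriv y) 0 = 2 * ρ * deriv x 0 ^ 2 := by
    have h1 := (deriv_zero_of_even (e := fun t => px f (x t, y t))
      (heven.mono fun t ht => congrFun ht 0)).2
    rw [deriv_deriv_deriv_curve hf.px hxs hys] at h1
    simp only [hxy0, hj.xxxx, hj.xxx, hj.xy, hj.xx, hy1, py_px hf, hj.xxy] at h1
    have h2 : deriv x 0 * (deriv (deriv y) 0 - 2 * ρ * deriv x 0 ^ 2) = 0 := by linarith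
    linarith [(mul_eq_zero.1 h2).resolve_left hx0]
  -- The equation a + 2t² = 0 of the double curve, carried to the graph chart. Its vanishing along
  -- the parametrized curve yields G_x and the relation between G_xx and G_y.
  set G : ℝ × ℝ → ℝ := fun p => H₂ p + H₁ p * (2 * H₁ p) with hGd
  have h2H : ContDiff ℝ ∞ fun p => 2 * H₁ p := contDiff_const.mul hs1
  have hGs : ContDiff ℝ ∞ G := hs2.add (hs1.mul h2H)
  have hGδ : (fun t => G (x t, y t)) =ᶠ[𝓝 0] fun _ => 0 := by
    filter_upwards [hHδ] with t ht
    simp only [hGd, hH₁, hH₂, ht]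
    ring
  have hGx : px G 0 = 0 := by
    have h1 := hGδ.deriv.self_of_nhds
    rw [deriv_curve hGs hxs hys] at h1
    simpa [hxy0, hy1, hx0] using h1
  have hGxx : px (px G) 0 + 2 * ρ * py G 0 = 0 := by
    have h1 := hGδ.deriv.deriv.self_of_nhds
    rw [deriv_deriv_curve hGs hxs hys] at h1
    simp only [hxy0, hy1, hy2, hGx, deriv_const'] at h1
    have h2 : deriv x 0 ^ 2 * (px (px G) 0 + 2 * ρ * py G 0) = 0 := by linarith
    exact (mul_eq_zero.1 h2).resolve_left (pow_ne_zero 2 hx0)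
  -- At the origin the differential of G is that of the coordinate a of the swallowtail chart, which
  -- is nonzero along the axis t = 0.
  have hGy : py G 0 ≠ 0 := by
    intro h0
    have e1 : px G 0 = px H₂ 0 := by
      rw [hGd, px_add hs2 (hs1.mul h2H), px_mul hs1 h2H]
      simp [h10]
    have e2 : py G 0 = py H₂ 0 := by
      rw [hGd, py_add hs2 (hs1.mul h2H), py_mul hs1 h2H]
      simp [h10]
    rw [hGx] at e1
    rw [h0] at e2
    have hc : ContDiff ℝ ∞ fun t : ℝ => χ (k (0, t)) :=
      hG.chart.contDiff.comp (hT.chart.contDiff_inv.comp (contDiff_const.prodMk contDiff_id))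
    have h1 := hasDerivAt_curve_pair hs2 hc.fst hc.snd 0
    have ht : Tendsto (fun t : ℝ => ((0 : ℝ), t)) (𝓝 0) (𝓝 (0 : ℝ × ℝ)) :=
      (continuous_const.prodMk continuous_id).tendsto' _ _ rfl
    have h2 : HasDerivAt (fun t => H₂ ((χ (k (0, t))).1, (χ (k (0, t))).2)) 1 0 := by
      refine (hasDerivAt_id' (0 : ℝ)).congr_of_eventuallyEq ?_
      filter_upwards [ht.eventually hT.chart.right_inv,
        (hT.chart.tendsto_inv.comp ht).eventually hG.chart.left_inv] with t h3 h4
      simp only [Function.comp_apply] at h4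
      simp only [hH₂, Prod.mk.eta, h4, h3]
    have h3 := h1.unique h2
    have h4 : k (0, 0) = s := hT.chart.inv_zero
    simp [h4, hG.chart.map_base] at h3
    have hz : ((0 : ℝ), (0 : ℝ)) = 0 := rfl
    simp [hz, ← e1, ← e2] at h3
  refine IsGraphCurve.of_eventually_zero hG.chart hGs (by simp [hGd, h10, h20]) hGx hGy ?_ hGxx
  filter_upwards [hT.eventually_mem_selfIntersection_iff, hG.chart.left_inv] with u h1 h2
  rw [h1]
  simp only [hGd, hH₁, hH₂, h2]
  rw [show (h u).2 + 2 * (h u).1 ^ 2 = (h u).2 + (h u).1 * (2 * (h u).1) by ring]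

end Front.IsDualGraph

/-! ### Invariant, ellipticity and relative position of the curves. -/

theorem StrictMono.vec3 {a b c : ℝ} (h1 : a < b) (h2 : b < c) : StrictMono ![a, b, c] := by
  rw [Fin.strictMono_iff_lt_succ]
  intro i
  fin_cases i <;> simpa

theorem StrictMono.vec5 {a b c d e : ℝ} (h1 : a < b) (h2 : b < c) (h3 : c < d) (h4 : d < e) :
    StrictMono ![a, b, c, d, e] := by
  rw [Fin.strictMono_iff_lt_succ]
  intro i
  fin_cases i <;> simpa

theorem IsGraphCurve.orderedAt_vec3 {χ ξ : ℝ × ℝ → ℝ × ℝ} {s : ℝ × ℝ} (hχ : IsChartAt χ ξ s)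
    {A B C : Set (ℝ × ℝ)} {a b c : ℝ} (hA : IsGraphCurve χ s A a) (hB : IsGraphCurve χ s B b)
    (hC : IsGraphCurve χ s C c) (h1 : a < b) (h2 : b < c) : OrderedAt s ![A, B, C] := by
  refine IsGraphCurve.orderedAt hχ (k := ![a, b, c]) (fun i => ?_) (.vec3 h1 h2)
  fin_cases i <;> simpa

theorem IsGraphCurve.orderedAt_vec5 {χ ξ : ℝ × ℝ → ℝ × ℝ} {s : ℝ × ℝ} (hχ : IsChartAt χ ξ s)
    {A B C D E : Set (ℝ × ℝ)} {a b c d e : ℝ} (hA : IsGraphCurve χ s A a)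
    (hB : IsGraphCurve χ s B b) (hC : IsGraphCurve χ s C c) (hD : IsGraphCurve χ s D d)
    (hE : IsGraphCurve χ s E e) (h1 : a < b) (h2 : b < c) (h3 : c < d) (h4 : d < e) :
    OrderedAt s ![A, B, C, D, E] := by
  refine IsGraphCurve.orderedAt hχ (k := ![a, b, c, d, e]) (fun i => ?_) (.vec5 h1 h2 h3 h4)
  fin_cases i <;> simpa

namespace Front.IsDualGraph

variable {T : Front} {s : ℝ × ℝ} {χ ξ h k : ℝ × ℝ → ℝ × ℝ} {f lam mu : ℝ × ℝ → ℝ}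
  {L L' : (Fin 4 → ℝ) →L[ℝ] (Fin 4 → ℝ)} {ρ : ℝ}

/-- The coefficients give (ρ - (2ρ² - ρ)) / (ρ - (3ρ - 2)) = ρ. Uniqueness holds for every choice of
direction and parametrizations, since the isotropic direction has to be the kernel of dy and the
cross-ratio ignores the rest. -/
theorem hasCrInvariant_iff (hG : T.IsDualGraph s χ ξ f lam mu L L') (hj : IsGodronJet f ρ)
    (hT : T.IsSwallowtailChart s h k) (hρ : ρ ≠ 1) (r : ℝ) :
    T.dual.HasCrInvariant s r ↔ r = ρ := by
  have hF := (hG.isGraphCurve_flecnodalCurve hj hρ).2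
  have hP := hG.isGraphCurve_cuspidalEdge hj
  have hD := hG.isGraphCurve_selfIntersection hj hT
  rw [← hG.dual_parabolicCurve] at hP
  rw [← hG.dual_conodalCurve] at hD
  have hd : ρ - (3 * ρ - 2) ≠ 0 := fun h => hρ (by linarith)
  have hjk : 3 * ρ - 2 ≠ ρ := fun h => hd (by linarith)
  have hval : (ρ - (2 * ρ ^ 2 - ρ)) / (ρ - (3 * ρ - 2)) = ρ := by
    rw [div_eq_iff hd]; ring
  have hsf : ∀ e, T.dual.secondForm s e e = 0 ↔ (fderiv ℝ χ s e).2 = 0 := fun e => by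
    rw [hG.dual_secondForm_eq hG.mem, hG.chart.map_base]
    simp [hess, hj.xx, hj.xy, hj.yy, hG.lam_ne s hG.mem, hG.mu_ne s hG.mem]
  constructor
  · rintro ⟨-, e, he, hse, αF, αP, αD, lF, lP, lD, hαF, hαP, hαD, h1, h2, h3, -, rfl⟩
    obtain ⟨l, m, n, g1, g2, g3, -, h⟩ :=
      crossRatio_contactLift hG.chart he ((hsf e).1 hse) hF hP hD hjk hαF hαP hαD
    rw [h1.contactLift_unique he g1, h2.contactLift_unique he g2, h3.contactLift_unique he g3, h,
      hval]
  · rintro rfl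
    refine ⟨(hG.dual_isParabolic_iff hG.mem).2 ?_, ?_⟩
    · rw [hG.chart.map_base]; exact (hj.hessDet hG.contDiff).1
    obtain ⟨e, hχe⟩ := hG.fderiv_surjective hG.mem (1, 0)
    have he : e ≠ 0 := by
      rintro rfl
      rw [map_zero] at hχe
      exact one_ne_zero (congrArg Prod.fst hχe).symm
    have hχe2 : (fderiv ℝ χ s e).2 = 0 := by rw [hχe]
    obtain ⟨αF, -, hαF, -⟩ := hF.exists_parametrization hG.chart
    obtain ⟨αP, -, hαP, -⟩ := hP.exists_parametrization hG.chart
    obtain ⟨αD, -, hαD, -⟩ := hD.exists_parametrization hG.chart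
    obtain ⟨l, m, n, g1, g2, g3, g4, h⟩ :=
      crossRatio_contactLift hG.chart he hχe2 hF hP hD hjk hαF hαP hαD
    exact ⟨e, he, (hsf e).2 hχe2, αF, αP, αD, l, m, n, hαF, hαP, hαD, g1, g2, g3, g4,
      by rw [h, hval]⟩

theorem eventually_isElliptic (hG : T.IsDualGraph s χ ξ f lam mu L L') (hj : IsGodronJet f ρ)
    {A : Set (ℝ × ℝ)} {l : ℝ} (hA : IsGraphCurve χ s A l) (hl : l < 3 * ρ - 2) :
    ∀ᶠ u in 𝓝 s, u ∈ A → u ≠ s → T.IsElliptic u := by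
  obtain ⟨h0, h1, h2, h3⟩ := hj.hessDet hG.contDiff
  filter_upwards [hA.eventually_pos hG.chart (contDiff_hessDet hG.contDiff) h0 h1
    (by rw [h2, h3]; linarith), T.eventually_mem_dom hG.mem] with u hu hd hA hs
  exact (hG.isElliptic_iff hd).2 (hu hA hs)

theorem eventually_isHyperbolic (hG : T.IsDualGraph s χ ξ f lam mu L L') (hj : IsGodronJet f ρ)
    {A : Set (ℝ × ℝ)} {l : ℝ} (hA : IsGraphCurve χ s A l) (hl : 3 * ρ - 2 < l) :
    ∀ᶠ u in 𝓝 s, u ∈ A → u ≠ s → T.IsHyperbolic u := by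
  obtain ⟨h0, h1, h2, h3⟩ := hj.hessDet hG.contDiff
  filter_upwards [hA.eventually_neg hG.chart (contDiff_hessDet hG.contDiff) h0 h1
    (by rw [h2, h3]; linarith), T.eventually_mem_dom hG.mem] with u hu hd hA hs
  exact (hG.isHyperbolic_iff hd).2 (hu hA hs)

/-- The double curve has coefficient ρ, and ρ < 3ρ - 2 means ρ > 1. Conversely, for ρ < 1 the curve
has points arbitrarily near `s`, and they are hyperbolic. -/
theorem isEllipticSwallowtail_iff (hG : T.IsDualGraph s χ ξ f lam mu L L') (hj : IsGodronJet f ρ)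
    (hT : T.IsSwallowtailChart s h k) (hρ : ρ ≠ 1) : T.IsEllipticSwallowtail s ↔ 1 < ρ := by
  have hD := hG.isGraphCurve_selfIntersection hj hT
  refine ⟨fun he => ?_, fun h => hG.eventually_isElliptic hj hD (by linarith)⟩
  by_contra hlt
  have hlt : ρ < 1 := lt_of_le_of_ne (not_lt.1 hlt) hρ
  obtain ⟨u, ⟨hu, hus⟩, h1, h2⟩ := ((hD.frequently_mem hG.chart).and_eventually
    (he.and (hG.eventually_isHyperbolic hj hD (by linarith)))).exists
  exact lt_asymm (h1 hu hus).2 (h2 hu hus).2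

theorem isHyperbolicSwallowtail_iff (hG : T.IsDualGraph s χ ξ f lam mu L L')
    (hj : IsGodronJet f ρ) (hT : T.IsSwallowtailChart s h k) (hρ : ρ ≠ 1) :
    T.IsHyperbolicSwallowtail s ↔ ρ < 1 := by
  have hD := hG.isGraphCurve_selfIntersection hj hT
  refine ⟨fun he => ?_, fun h => hG.eventually_isHyperbolic hj hD (by linarith)⟩
  by_contra hlt
  have hlt : 1 < ρ := lt_of_le_of_ne (not_lt.1 hlt) hρ.symm
  obtain ⟨u, ⟨hu, hus⟩, h1, h2⟩ := ((hD.frequently_mem hG.chart).and_eventually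
    (he.and (hG.eventually_isElliptic hj hD (by linarith)))).exists
  exact lt_asymm (h1 hu hus).2 (h2 hu hus).2

/-- At a hyperbolic swallowtail, the contour consists of two smooth curves of the dual surface. -/
theorem exists_contour_branches (hG : T.IsDualGraph s χ ξ f lam mu L L') (hj : IsGodronJet f ρ)
    (hρ : ρ < 1) : ∃ A B : Set (ℝ × ℝ), IsGraphCurve χ s A (1 - √(1 - ρ)) ∧
      IsGraphCurve χ s B (1 + √(1 - ρ)) ∧ ∀ᶠ u in 𝓝 s, u ∈ T.contour s ↔ u ∈ A ∪ B := by
  obtain ⟨G, hGs, hm, hp, hiff⟩ := hj.exists_branches hG.contDiff hρ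
  have key : ∀ b l, px (px (G b)) 0 = -2 * l → IsGraphCurve χ s {u | G b (χ u) = 0} l :=
    fun b l hl => by
      obtain ⟨h1, h2, h3, h4⟩ := hGs b
      exact IsGraphCurve.of_eventually_zero hG.chart h1 h2 h3 (by rw [h4]; norm_num)
        (Eventually.of_forall fun u => Iff.rfl) (by rw [hl, h4]; ring)
  refine ⟨_, _, key false _ hm, key true _ hp, ?_⟩
  filter_upwards [T.eventually_mem_dom hG.mem, hG.chart.tendsto.eventually hiff] with u hu h1
  rw [hG.mem_contour_iff hj hu, h1]
  rfl

theorem contourTrivial_iff (hG : T.IsDualGraph s χ ξ f lam mu L L') (hj : IsGodronJet f ρ)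
    (hρ : ρ ≠ 1) : T.ContourTrivial s ↔ 1 < ρ := by
  constructor
  · intro ht
    by_contra hlt
    obtain ⟨A, B, hA, -, hc⟩ := hG.exists_contour_branches hj (lt_of_le_of_ne (not_lt.1 hlt) hρ)
    obtain ⟨u, ⟨hu, hus⟩, h1, h2⟩ :=
      ((hA.frequently_mem hG.chart).and_eventually (ht.and hc)).exists
    exact hus (h1.1 (h2.2 (Or.inl hu)))
  · intro h
    filter_upwards [T.eventually_mem_dom hG.mem, hG.chart.eventually_eq_base,
      hG.chart.tendsto.eventually (hj.eventually_ne_zero hG.contDiff h)] with u hu h1 h2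
    rw [hG.mem_contour_iff hj hu]
    refine ⟨fun h3 => h1 (h2 h3), ?_⟩
    rintro rfl
    rw [hG.chart.map_base]
    exact hj.zero

end Front.IsDualGraph

namespace Front.IsDualGraph

variable {T : Front} {s : ℝ × ℝ} {χ ξ h k : ℝ × ℝ → ℝ × ℝ} {f lam mu : ℝ × ℝ → ℝ}
  {L L' : (Fin 4 → ℝ) →L[ℝ] (Fin 4 → ℝ)} {ρ : ℝ}

theorem exists_cusp (hG : T.IsDualGraph s χ ξ f lam mu L L') (hj : IsGodronJet f ρ)
    {A : Set (ℝ × ℝ)} {l : ℝ} (hA : IsGraphCurve χ s A l) : ∃ α : ℝ → ℝ × ℝ,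
      ParametrizesAt α A s ∧ (l ≠ 1 → T.IsCusp α) ∧ (l ≠ 1 → l ≠ ρ → T.IsSemicubicCusp α) ∧
      ∃ c : ℝ → ℝ, ContDiff ℝ ∞ α ∧ ContDiff ℝ ∞ c ∧ c 0 = 0 ∧ deriv c 0 = 0 ∧
        deriv (deriv c) 0 = 2 * l ∧ ∀ᶠ t in 𝓝 0, χ (α t) = (t, c t) := by
  obtain ⟨α, c, hα, hαs, hc, hc0, hc1, hc2, hχα⟩ := hA.exists_parametrization hG.chart
  exact ⟨α, hα, fun hl => (hG.isCusp hj hαs hα.2.1 hc hc0 hc1 hc2 hχα hl).1,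
    fun hl => (hG.isCusp hj hαs hα.2.1 hc hc0 hc1 hc2 hχα hl).2,
    c, hαs, hc, hc0, hc1, hc2, hχα⟩

/-- Each assertion is an inequality between coefficients. Directions compare k - 1, and for the
flecnodal curve relative to the cuspidal edge the ratio is (2ρ + 1)/3, whence the threshold -1/2. -/
theorem exists_cusps (hG : T.IsDualGraph s χ ξ f lam mu L L') (hj : IsGodronJet f ρ)
    (hT : T.IsSwallowtailChart s h k) (hρ : ρ ≠ 1) :
    ∃ σ φ : ℝ → ℝ × ℝ,
      ParametrizesAt σ T.cuspidalEdge s ∧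
      ParametrizesAt φ T.flecnodalCurve s ∧
      T.IsSemicubicCusp σ ∧
      (ρ ≠ -1 / 2 → T.IsCusp φ) ∧
      (ρ ≠ -1 / 2 → ρ ≠ 0 → T.IsSemicubicCusp φ) ∧
      (-1 / 2 < ρ → T.SameDirection φ σ) ∧
      (ρ < -1 / 2 → T.OppositeDirection φ σ) ∧
      (1 < ρ → OrderedAt s ![T.selfIntersection, T.cuspidalEdge, T.flecnodalCurve]) ∧
      (ρ < 1 →
        ∃ (τm τp : ℝ → ℝ × ℝ) (Tm Tp : Set (ℝ × ℝ)),
          ParametrizesAt τm Tm s ∧ ParametrizesAt τp Tp s ∧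
          (∀ᶠ u in 𝓝 s, u ∈ T.contour s ↔ u ∈ Tm ∪ Tp) ∧
          T.IsCusp τm ∧ (ρ ≠ 0 → T.IsSemicubicCusp τm) ∧ T.IsSemicubicCusp τp ∧
          T.OppositeDirection τp τm ∧ T.SameDirection τm σ ∧
          (ρ ∈ Set.Ioo (8 / 9) 1 →
            (∀ᶠ u in 𝓝 s, u ∈ Tm → u ≠ s → T.IsElliptic u) ∧
            OrderedAt s ![Tm, T.cuspidalEdge, T.flecnodalCurve, T.selfIntersection, Tp]) ∧
          (ρ ∈ Set.Ioo (√3 / 2) (8 / 9) →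
            OrderedAt s ![T.cuspidalEdge, Tm, T.flecnodalCurve, T.selfIntersection, Tp]) ∧
          (ρ ∈ Set.Ioo 0 (√3 / 2) →
            OrderedAt s ![T.cuspidalEdge, T.flecnodalCurve, Tm, T.selfIntersection, Tp]) ∧
          (ρ ∈ Set.Ioo (-1 / 2) 0 →
            OrderedAt s ![T.cuspidalEdge, T.selfIntersection, Tm, T.flecnodalCurve, Tp]) ∧
          (ρ ∈ Set.Ioo (-√3 / 2) (-1 / 2) →
            OrderedAt s ![T.cuspidalEdge, T.selfIntersection, Tm, T.flecnodalCurve, Tp]) ∧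
          (ρ ∈ Set.Iio (-√3 / 2) →
            OrderedAt s ![T.cuspidalEdge, T.selfIntersection, Tm, Tp, T.flecnodalCurve])) := by
  have hS := hG.isGraphCurve_cuspidalEdge hj
  have hF := (hG.isGraphCurve_flecnodalCurve hj hρ).1
  have hD := hG.isGraphCurve_selfIntersection hj hT
  have hρ1 : ρ - 1 ≠ 0 := sub_ne_zero.2 hρ
  have hS1 : 3 * ρ - 2 ≠ 1 := fun h => hρ (by linarith)
  have hF1 : ρ ≠ -1 / 2 → 2 * ρ ^ 2 - ρ ≠ 1 := fun h h' => by
    have : (2 * ρ + 1) * (ρ - 1) = 0 := by linear_combination h'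
    rcases mul_eq_zero.1 this with h1 | h1
    · exact h (by linarith)
    · exact hρ1 h1
  have hF2 : ρ ≠ 0 → 2 * ρ ^ 2 - ρ ≠ ρ := fun h h' => by
    have : ρ * (ρ - 1) = 0 := by linear_combination h' / 2
    exact (mul_ne_zero h hρ1) this
  obtain ⟨σ, hσ, -, hσ2, cσ, hσs, hcσ, hcσ0, hcσ1, hcσ2, hχσ⟩ := hG.exists_cusp hj hS
  obtain ⟨φ, hφ, hφ1, hφ2, cφ, hφs, hcφ, hcφ0, hcφ1, hcφ2, hχφ⟩ := hG.exists_cusp hj hF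
  obtain ⟨a, ha⟩ := hG.exists_smul_add_eq hj hφs hφ.2.1 hcφ hcφ0 hcφ1 hcφ2 hχφ
    hσs hσ.2.1 hcσ hcσ0 hcσ1 hcσ2 hχσ hS1
  have hφσ : (2 * ρ ^ 2 - ρ - 1) / (3 * ρ - 2 - 1) = (2 * ρ + 1) / 3 := by
    rw [div_eq_div_iff (sub_ne_zero.2 hS1) (by norm_num)]; ring
  rw [hφσ] at ha
  refine ⟨σ, φ, hσ, hφ, hσ2 hS1 fun h => hρ (by linarith), fun h => hφ1 (hF1 h),
    fun h h' => hφ2 (hF1 h) (hF2 h'), fun h => ⟨_, a, by linarith, ha⟩,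
    fun h => ⟨_, a, by linarith, ha⟩,
    fun h => IsGraphCurve.orderedAt_vec3 hG.chart hD hS hF (by linarith) (by nlinarith), ?_⟩
  intro hlt
  obtain ⟨Tm, Tp, hm, hp, hcont⟩ := hG.exists_contour_branches hj hlt
  have hw : 0 < √(1 - ρ) := Real.sqrt_pos.2 (by linarith)
  have hw2 : √(1 - ρ) ^ 2 = 1 - ρ := Real.sq_sqrt (by linarith)
  -- With ρ = 1 - w² and w > 0 the five coefficients become polynomials: 1 - 3w² for the edge, 1 -
  -- 3w² + 2w⁴ for the flecnodal curve, 1 - w² for the double curve and 1 ∓ w for the contour.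
  generalize √(1 - ρ) = w at hm hp hw hw2
  obtain rfl : ρ = 1 - w ^ 2 := by linarith
  obtain ⟨τm, hτm, hm1, hm2, cm, hms, hcm, hcm0, hcm1, hcm2, hχm⟩ := hG.exists_cusp hj hm
  obtain ⟨τp, hτp, hp1, hp2, cp, hps, hcp, hcp0, hcp1, hcp2, hχp⟩ := hG.exists_cusp hj hp
  have hm3 : 1 - w ≠ 1 := by linarith
  obtain ⟨b, hb⟩ := hG.exists_smul_add_eq hj hps hτp.2.1 hcp hcp0 hcp1 hcp2 hχp
    hms hτm.2.1 hcm hcm0 hcm1 hcm2 hχm hm3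
  obtain ⟨d, hd⟩ := hG.exists_smul_add_eq hj hms hτm.2.1 hcm hcm0 hcm1 hcm2 hχm
    hσs hσ.2.1 hcσ hcσ0 hcσ1 hcσ2 hχσ hS1
  have h3 : √3 ^ 2 = 3 := Real.sq_sqrt (by norm_num)
  have h30 : 1 < √3 := by rw [Real.lt_sqrt] <;> norm_num
  generalize √3 = v at h3 h30 ⊢
  -- the thresholds `ρ = ±√3 / 2` in terms of `w`
  have lt_sm (h : v / 2 < 1 - w ^ 2) : w < (v - 1) / 2 :=
    lt_of_pow_lt_pow_left₀ 2 (by linarith) (by linarith)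
  have sm_lt (h : 1 - w ^ 2 < v / 2) : (v - 1) / 2 < w :=
    lt_of_pow_lt_pow_left₀ 2 hw.le (by linarith)
  have lt_la (h : -v / 2 < 1 - w ^ 2) : w < (v + 1) / 2 :=
    lt_of_pow_lt_pow_left₀ 2 (by linarith) (by linarith)
  have la_lt (h : 1 - w ^ 2 < -v / 2) : (v + 1) / 2 < w :=
    lt_of_pow_lt_pow_left₀ 2 hw.le (by linarith)
  -- The difference between the flecnodal curve and the first branch is w(w - 1)(2w² + 2w - 1). Its
  -- positive roots w = 1 and w = (√3 - 1)/2 are ρ = 0 and ρ = √3/2.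
  have Tm_F (h : 0 < (w - 1) * (2 * w ^ 2 + 2 * w - 1)) :
      1 - w < 2 * (1 - w ^ 2) ^ 2 - (1 - w ^ 2) := by
    linarith [mul_pos hw h]
  have F_Tm (h : (w - 1) * (2 * w ^ 2 + 2 * w - 1) < 0) :
      2 * (1 - w ^ 2) ^ 2 - (1 - w ^ 2) < 1 - w := by
    linarith [mul_neg_of_pos_of_neg hw h]
  have S_F : 3 * (1 - w ^ 2) - 2 < 2 * (1 - w ^ 2) ^ 2 - (1 - w ^ 2) := by
    have : 0 < w ^ 4 := by positivity
    linarith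
  have S_D : 3 * (1 - w ^ 2) - 2 < 1 - w ^ 2 := by linarith [pow_pos hw 2]
  have F_D (h : 0 < 1 - w ^ 2) : 2 * (1 - w ^ 2) ^ 2 - (1 - w ^ 2) < 1 - w ^ 2 := by
    linarith [mul_pos (pow_pos hw 2) h]
  have D_Tp : 1 - w ^ 2 < 1 + w := by linarith [pow_pos hw 2]
  have w_lt (h : 0 < 1 - w ^ 2) : w < 1 := lt_of_pow_lt_pow_left₀ 2 zero_le_one (by linarith)
  have lt_w (h : 1 - w ^ 2 < 0) : 1 < w := lt_of_pow_lt_pow_left₀ 2 hw.le (by linarith)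
  have D_Tm (h : 1 < w) : 1 - w ^ 2 < 1 - w := by nlinarith
  -- The difference between the flecnodal curve and the second branch is w(w + 1)(2w² - 2w - 1),
  -- with the only positive root w = (√3 + 1)/2, that is ρ = -√3/2.
  have F_Tp (h : w < (v + 1) / 2) : 2 * (1 - w ^ 2) ^ 2 - (1 - w ^ 2) < 1 + w := by
    have h1 : 2 * w ^ 2 - 2 * w - 1 < 0 := by nlinarith
    have h2 : (w + 1) * (2 * w ^ 2 - 2 * w - 1) < 0 := mul_neg_of_pos_of_neg (by linarith) h1
    linarith [mul_neg_of_pos_of_neg hw h2]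
  have Tp_F (h : (v + 1) / 2 < w) : 1 + w < 2 * (1 - w ^ 2) ^ 2 - (1 - w ^ 2) := by
    have h1 : 0 < 2 * w ^ 2 - 2 * w - 1 := by nlinarith
    have h2 : 0 < (w + 1) * (2 * w ^ 2 - 2 * w - 1) := mul_pos (by linarith) h1
    linarith [mul_pos hw h2]
  have big (h : 1 < w) : 0 < (w - 1) * (2 * w ^ 2 + 2 * w - 1) :=
    mul_pos (by linarith) (by nlinarith)
  -- The order does not change at ρ = -1/2, so one argument serves both intervals; only the
  -- direction of the flecnodal cusp changes there.
  have h2' (h : 1 - w ^ 2 < 0) (h' : -v / 2 < 1 - w ^ 2) :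
      OrderedAt s ![T.cuspidalEdge, T.selfIntersection, Tm, T.flecnodalCurve, Tp] :=
    IsGraphCurve.orderedAt_vec5 hG.chart hS hD hm hF hp S_D (D_Tm (lt_w h))
      (Tm_F (big (lt_w h))) (F_Tp (lt_la h'))
  refine ⟨τm, τp, Tm, Tp, hτm, hτp, hcont, hm1 hm3, fun h => hm2 hm3 fun h' => h ?_,
    hp2 (by linarith) (by nlinarith), ⟨_, b, ?_, hb⟩, ⟨_, d, ?_, hd⟩, ?_, ?_, ?_, ?_, ?_, ?_⟩
  · have : w * (w - 1) = 0 := by linear_combination h'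
    rcases mul_eq_zero.1 this with h1 | h1
    · exact absurd h1 hw.ne'
    · rw [sub_eq_zero.1 h1]; norm_num
  · exact div_neg_of_pos_of_neg (by linarith) (by linarith)
  · exact div_pos_of_neg_of_neg (by linarith) (by linarith [pow_pos hw 2])
  · rintro ⟨h1, h2⟩
    -- The first branch minus the edge is w(3w - 1), and w = 1/3 corresponds to ρ = 8/9.
    have hw3 : w < 1 / 3 := lt_of_pow_lt_pow_left₀ 2 (by norm_num) (by linarith)
    have Tm_S : 1 - w < 3 * (1 - w ^ 2) - 2 := by nlinarith
    exact ⟨hG.eventually_isElliptic hj hm Tm_S,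
      IsGraphCurve.orderedAt_vec5 hG.chart hm hS hF hD hp Tm_S S_F (F_D (by linarith)) D_Tp⟩
  · rintro ⟨h1, h2⟩
    have hw3 : 1 / 3 < w := lt_of_pow_lt_pow_left₀ 2 hw.le (by linarith)
    refine IsGraphCurve.orderedAt_vec5 hG.chart hS hm hF hD hp (by nlinarith)
      (Tm_F (mul_pos_of_neg_of_neg ?_ ?_)) (F_D (by linarith)) D_Tp
    · linarith [w_lt (by linarith)]
    · nlinarith [lt_sm h1]
  · rintro ⟨h1, h2⟩
    have hw1 := w_lt h1
    refine IsGraphCurve.orderedAt_vec5 hG.chart hS hF hm hD hp S_F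
      (F_Tm (mul_neg_of_neg_of_pos (by linarith) ?_)) (by nlinarith) D_Tp
    nlinarith [sm_lt h2]
  · rintro ⟨h1, h2⟩
    exact h2' h2 (by linarith)
  · rintro ⟨h1, h2⟩
    exact h2' (by linarith) h1
  · intro h
    have h1 : 1 - w ^ 2 < -v / 2 := h
    have hw1 := lt_w (by linarith)
    exact IsGraphCurve.orderedAt_vec5 hG.chart hS hD hm hp hF S_D (D_Tm hw1) (by linarith)
      (Tp_F (la_lt h1))

end Front.IsDualGraph

/-! ### Adapted projective coordinates and the dual as a graph. -/

namespace Front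

theorem fderiv_plane_dotProduct_point (S : Front) {s : ℝ × ℝ} (hs : s ∈ S.dom) (v : ℝ × ℝ) :
    fderiv ℝ S.plane s v ⬝ᵥ S.point s = 0 := by
  rw [dotProduct_comm]; exact S.dual_legendrian s hs v

/-- Projective coordinates adapted to a regular point of the dual front. -/
theorem exists_frame (S : Front) {s e₁ e₂ : ℝ × ℝ} (hs : S.dual.IsRegular s)
    (he : ∀ a b : ℝ, a • e₁ + b • e₂ = 0 → a = 0 ∧ b = 0) :
    ∃ L L' N R : (Fin 4 → ℝ) →L[ℝ] (Fin 4 → ℝ), (∀ p q, L' p ⬝ᵥ L q = p ⬝ᵥ q) ∧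
      (∀ p, L' (N p) = p) ∧ (∀ q, L (R q) = q) ∧
      (∀ q, R (L q) = q) ∧ N (S.plane s) = ![0, 0, 0, 1] ∧
      N (fderiv ℝ S.plane s e₁) = ![1, 0, 0, 0] ∧ N (fderiv ℝ S.plane s e₂) = ![0, 1, 0, 0] ∧
      ∃ m : ℝ, m ≠ 0 ∧ R (S.point s) = ![0, 0, -m, 0] := by
  have hd : s ∈ S.dom := hs.1
  set P₀ := S.plane s with hP₀
  set P₁ := fderiv ℝ S.plane s e₁ with hP₁
  set P₂ := fderiv ℝ S.plane s e₂ with hP₂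
  set Q₀ := S.point s with hQ₀
  have i0 : P₀ ⬝ᵥ Q₀ = 0 := S.incident s hd
  have i1 : P₁ ⬝ᵥ Q₀ = 0 := S.fderiv_plane_dotProduct_point hd e₁
  have i2 : P₂ ⬝ᵥ Q₀ = 0 := S.fderiv_plane_dotProduct_point hd e₂
  have i3 : Q₀ ⬝ᵥ Q₀ ≠ 0 := fun h => S.point_ne s hd (dotProduct_self_eq_zero.1 h)
  -- The plane and its two derivatives are orthogonal to the point `Q₀`, so `Q₀` itself, read as a
  -- covector, completes them to a basis. Taking `Wᵀ` on covectors and the inverse of `W` on points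
  -- preserves the pairing.
  set W : Matrix (Fin 4) (Fin 4) ℝ := Matrix.of ![P₁, P₂, Q₀, P₀] with hW
  have hmul : ∀ p, Wᵀ *ᵥ p = p 0 • P₁ + p 1 • P₂ + p 2 • Q₀ + p 3 • P₀ := fun p => by
    ext i
    simp [Matrix.mulVec, dotProduct, Fin.sum_univ_four, hW]
    ring
  have hker : ∀ p, Wᵀ *ᵥ p = 0 → p = 0 := fun p hp => by
    rw [hmul] at hp
    have h2 : p 2 = 0 := by
      have := congrArg (· ⬝ᵥ Q₀) hp
      simpa [add_dotProduct, smul_dotProduct, i0, i1, i2, i3] using this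
    have h3 : p 0 • e₁ + p 1 • e₂ = 0 := by
      refine hs.2 _ ⟨-p 3, ?_⟩
      change fderiv ℝ S.plane s _ = -p 3 • P₀
      rw [map_add, map_smul, map_smul, ← hP₁, ← hP₂]
      rw [h2, zero_smul, add_zero] at hp
      rw [neg_smul]
      exact eq_neg_of_add_eq_zero_left hp
    obtain ⟨h0, h1⟩ := he _ _ h3
    have h4 : p 3 = 0 := by
      rw [h0, h1, h2] at hp
      simp only [zero_smul, zero_add] at hp
      exact (smul_eq_zero.1 hp).resolve_right (S.plane_ne s hd)
    ext i
    fin_cases i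
    exacts [h0, h1, h2, h4]
  have hu : IsUnit Wᵀ := Matrix.mulVec_injective_iff_isUnit.1 fun p q hpq => by
    rw [← sub_eq_zero]
    refine hker _ ?_
    rw [Matrix.mulVec_sub]
    exact sub_eq_zero.2 hpq
  have hu' : IsUnit W := (Matrix.isUnit_transpose W).1 hu
  have hd1 : IsUnit Wᵀ.det := (Matrix.isUnit_iff_isUnit_det _).1 hu
  have hd2 : IsUnit W.det := (Matrix.isUnit_iff_isUnit_det _).1 hu'
  have hN : ∀ p q, Wᵀ *ᵥ p = q → Wᵀ⁻¹ *ᵥ q = p := fun p q h => by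
    rw [← h, Matrix.mulVec_mulVec, Matrix.nonsing_inv_mul _ hd1, Matrix.one_mulVec]
  refine ⟨W⁻¹.mulVecLin.toContinuousLinearMap, Wᵀ.mulVecLin.toContinuousLinearMap,
    Wᵀ⁻¹.mulVecLin.toContinuousLinearMap, W.mulVecLin.toContinuousLinearMap,
    ?_, ?_, ?_, ?_, ?_, ?_, ?_, -(Q₀ ⬝ᵥ Q₀), neg_ne_zero.2 i3, ?_⟩
  · intro p q
    change (Wᵀ *ᵥ p) ⬝ᵥ (W⁻¹ *ᵥ q) = _
    rw [Matrix.mulVec_transpose, ← Matrix.dotProduct_mulVec, Matrix.mulVec_mulVec,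
      Matrix.mul_nonsing_inv _ hd2, Matrix.one_mulVec]
  · intro p
    change Wᵀ *ᵥ (Wᵀ⁻¹ *ᵥ p) = p
    rw [Matrix.mulVec_mulVec, Matrix.mul_nonsing_inv _ hd1, Matrix.one_mulVec]
  · intro p
    change W⁻¹ *ᵥ (W *ᵥ p) = p
    rw [Matrix.mulVec_mulVec, Matrix.nonsing_inv_mul _ hd2, Matrix.one_mulVec]
  · intro p
    change W *ᵥ (W⁻¹ *ᵥ p) = p
    rw [Matrix.mulVec_mulVec, Matrix.mul_nonsing_inv _ hd2, Matrix.one_mulVec]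
  · exact hN _ _ (by rw [hmul]; simp)
  · exact hN _ _ (by rw [hmul]; simp)
  · exact hN _ _ (by rw [hmul]; simp)
  · change W *ᵥ Q₀ = _
    ext i
    fin_cases i
    · exact i1
    · exact i2
    · simp [Matrix.mulVec, hW]
    · exact i0

/-- Near a regular point, the dual of a front is the graph of a function. -/
theorem exists_isDualGraph (S : Front) {s e₁ e₂ : ℝ × ℝ} (hs : S.dual.IsRegular s)
    (he : ∀ a b : ℝ, a • e₁ + b • e₂ = 0 → a = 0 ∧ b = 0) :
    ∃ (χ ξ : ℝ × ℝ → ℝ × ℝ) (f lam mu : ℝ × ℝ → ℝ) (L L' : (Fin 4 → ℝ) →L[ℝ] (Fin 4 → ℝ)),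
      fderiv ℝ χ s e₁ = (1, 0) ∧ fderiv ℝ χ s e₂ = (0, 1) ∧ f 0 = 0 ∧ px f 0 = 0 ∧ py f 0 = 0 ∧
      ∃ V ∈ 𝓝 s, ∀ T : Front, s ∈ T.dom → T.dom ⊆ V → T.point = S.point → T.plane = S.plane →
        T.IsDualGraph s χ ξ f lam mu L L' := by
  have hd : s ∈ S.dom := hs.1
  obtain ⟨L, L', N, R, hLL, hLN, hLR, hRL, hN0, hN1, hN2, m, hm, hR⟩ := S.exists_frame hs he
  obtain ⟨P, hP, hPe⟩ := (S.smooth_plane.smoothNear S.isOpen_dom hd).exists_contDiff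
  obtain ⟨Q, hQ, hQe⟩ := (S.smooth_point.smoothNear S.isOpen_dom hd).exists_contDiff
  set C : ℝ × ℝ → Fin 4 → ℝ := fun u => N (P u) with hC
  have hCs : ContDiff ℝ ∞ C := N.contDiff.comp hP
  have hCi : ∀ i, ContDiff ℝ ∞ fun u => C u i := fun i => contDiff_pi.1 hCs i
  have hC0 : C s = ![0, 0, 0, 1] := by rw [hC, ← hN0, ← hPe.self_of_nhds]
  have hC3 : ∀ᶠ u in 𝓝 s, C u 3 ≠ 0 :=
    (hCi 3).continuous.continuousAt.eventually_ne (by rw [hC0]; simp)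
  have hdiv : ∀ i, SmoothNear (fun u => C u i / C u 3) s := fun i => by
    filter_upwards [hC3] with u hu
    exact (hCi i).contDiffAt.div (hCi 3).contDiffAt hu
  obtain ⟨X, hX, hXe⟩ := (hdiv 0).exists_contDiff
  obtain ⟨Y, hY, hYe⟩ := (hdiv 1).exists_contDiff
  obtain ⟨Z, hZ, hZe⟩ := (hdiv 2).exists_contDiff
  have hX0 : X s = 0 := hXe.self_of_nhds.trans (by simp [hC0])
  have hY0 : Y s = 0 := hYe.self_of_nhds.trans (by simp [hC0])
  have hZ0 : Z s = 0 := hZe.self_of_nhds.trans (by simp [hC0])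
  set χ : ℝ × ℝ → ℝ × ℝ := fun u => (X u, Y u) with hχ
  have hχs : ContDiff ℝ ∞ χ := hX.prodMk hY
  have hχ0 : χ s = 0 := Prod.ext hX0 hY0
  -- At `s` the denominator is 1 and the numerator is 0, so the quotient has the same differential
  -- as its numerator.
  have hquot : ∀ (F : ℝ × ℝ → ℝ) (i : Fin 4), ContDiff ℝ ∞ F →
      F =ᶠ[𝓝 s] (fun u => C u i / C u 3) → F s = 0 → ∀ v c,
      N (fderiv ℝ S.plane s v) = c → fderiv ℝ F s v = c i := by
    intro F i hFs hF h0 v c hc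
    have h1 : HasFDerivAt C (N.comp (fderiv ℝ S.plane s)) s := by
      refine N.hasFDerivAt.comp s ?_
      exact (S.differentiableAt_plane hd).hasFDerivAt.congr_of_eventuallyEq hPe
    have h2 := hasFDerivAt_pi'.1 h1
    have h3 := ((hFs.differentiable (by simp) s).hasFDerivAt.mul (h2 3)).unique
      ((h2 i).congr_of_eventuallyEq (by
        filter_upwards [hF, hC3] with u h4 h5
        simp only [Pi.mul_apply, h4]
        field_simp))
    have h4 := congrArg (fun A : ℝ × ℝ →L[ℝ] ℝ => A v) h3
    simpa [h0, hC0, hc] using h4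
  have hχ1 : fderiv ℝ χ s e₁ = (1, 0) := by
    rw [hχ, (hX.differentiable (by simp) s).fderiv_prodMk (hY.differentiable (by simp) s)]
    exact Prod.ext (hquot X 0 hX hXe hX0 e₁ _ hN1)
      (hquot Y 1 hY hYe hY0 e₁ _ hN1)
  have hχ2 : fderiv ℝ χ s e₂ = (0, 1) := by
    rw [hχ, (hX.differentiable (by simp) s).fderiv_prodMk (hY.differentiable (by simp) s)]
    exact Prod.ext (hquot X 0 hX hXe hX0 e₂ _ hN2)
      (hquot Y 1 hY hYe hY0 e₂ _ hN2)
  have hsurj : Function.Surjective (fderiv ℝ χ s : (ℝ × ℝ) →ₗ[ℝ] ℝ × ℝ) := fun w =>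
    ⟨w.1 • e₁ + w.2 • e₂, by
      change fderiv ℝ χ s _ = w
      rw [map_add, map_smul, map_smul, hχ1, hχ2]; ext <;> simp⟩
  let Eχ : (ℝ × ℝ) ≃L[ℝ] ℝ × ℝ := (LinearEquiv.ofBijective _
    ⟨LinearMap.injective_iff_surjective.2 hsurj, hsurj⟩).toContinuousLinearEquiv
  obtain ⟨ξ, hξ, hξ0, hl, hr⟩ := hχs.exists_local_inverse s Eχ (by ext <;> rfl)
  rw [hχ0] at hξ0 hr
  have hchart : IsChartAt χ ξ s := ⟨hχs, hξ, hχ0, hξ0, hl, hr⟩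
  set f : ℝ × ℝ → ℝ := fun p => Z (ξ p) with hf
  have hfs : ContDiff ℝ ∞ f := hZ.comp hξ
  have hplane : ∀ᶠ u in 𝓝 s, S.plane u = C u 3 • L' (graphPlane f (χ u)) := by
    filter_upwards [hPe, hXe, hYe, hZe, hl, hC3] with u h1 h2 h3 h4 h5 h6
    rw [← map_smul, ← h1, ← hLN (P u)]
    congr 1
    change C u = _
    ext i
    fin_cases i
    · simp [graphPlane, hχ, h2]; field_simp
    · simp [graphPlane, hχ, h3]; field_simp
    · simp [graphPlane, hf, h5, h4]; field_simp
    · simp [graphPlane]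
  set mu : ℝ × ℝ → ℝ := fun u => -R (Q u) 2 with hmu
  have hmus : ContDiff ℝ ∞ mu := (contDiff_pi.1 (R.contDiff.comp hQ) 2).neg
  have hmu0 : mu s = m := by simp [hmu, hQe.self_of_nhds, hR]
  have hmune : ∀ᶠ u in 𝓝 s, mu u ≠ 0 :=
    hmus.continuous.continuousAt.eventually_ne (by rwa [hmu0])
  have hinj : ∀ᶠ u in 𝓝 s, ∀ w, ∃ v, fderiv ℝ χ u v = w := by
    have h1 : ∀ᶠ u in 𝓝 s, fderiv ℝ χ u ∈
        Set.range ((↑) : ((ℝ × ℝ) ≃L[ℝ] ℝ × ℝ) → (ℝ × ℝ) →L[ℝ] ℝ × ℝ) :=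
      (hχs.continuous_fderiv (by simp)).continuousAt.eventually (Eχ.nhds)
    filter_upwards [h1] with u ⟨E, hE⟩ w
    exact ⟨E.symm w, by rw [← hE]; simp⟩
  -- The point is incident with the plane and with its derivatives in all directions. These three
  -- equations express its coordinates through the third one, which gives the tangent plane of the
  -- graph.
  have hpoint : ∀ᶠ u in 𝓝 s, S.point u = mu u • L (graphPoint f (χ u)) := by
    filter_upwards [hplane.eventually_nhds, hQe, hC3, hinj, S.eventually_mem_dom hd]
      with u h1 h2 h3 h4 hu
    have hin : graphPlane f (χ u) ⬝ᵥ R (S.point u) = 0 := by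
      have := S.incident u hu
      rw [h1.self_of_nhds, ← hLR (S.point u), smul_dotProduct, hLL, smul_eq_mul] at this
      exact (mul_eq_zero.1 this).resolve_left h3
    have htan : ∀ w : ℝ × ℝ, ![w.1, w.2, px f (χ u) * w.1 + py f (χ u) * w.2, 0] ⬝ᵥ
        R (S.point u) = 0 := by
      intro w
      obtain ⟨v, hv⟩ := h4 w
      have k0 := hasDerivAt_line u v
      have hl0 : u + (0 : ℝ) • v = u := by simp
      have k1 : HasDerivAt (fun t : ℝ => χ (u + t • v)) w 0 := by
        rw [← hv]
        exact HasFDerivAt.comp_hasDerivAt (0 : ℝ)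
          (by rw [hl0]; exact (hχs.differentiable (by simp) _).hasFDerivAt) k0
      have k2 := L'.hasFDerivAt.comp_hasDerivAt (0 : ℝ) (hasDerivAt_graphPlane hfs k1)
      have k3 : HasDerivAt (fun t : ℝ => C (u + t • v) 3) _ 0 :=
        HasFDerivAt.comp_hasDerivAt (0 : ℝ)
          (((hCi 3).differentiable (by simp) _).hasFDerivAt) k0
      have k4 := k3.fun_smul k2
      have k5 : HasDerivAt (fun t : ℝ => S.plane (u + t • v)) (fderiv ℝ S.plane u v) 0 :=
        HasFDerivAt.comp_hasDerivAt (0 : ℝ)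
          (by rw [hl0]; exact (S.differentiableAt_plane hu).hasFDerivAt) k0
      have ht : Tendsto (fun t : ℝ => u + t • v) (𝓝 0) (𝓝 u) := by
        have := k0.continuousAt
        rwa [ContinuousAt, hl0] at this
      have k6 := (k5.congr_of_eventuallyEq (ht.eventually h1 |>.mono fun t h => h.symm)).unique k4
      have k7 := S.fderiv_plane_dotProduct_point hu v
      rw [k6, ← hLR (S.point u)] at k7
      simp only [Function.comp_apply, hl0] at k7
      rw [add_dotProduct, smul_dotProduct, smul_dotProduct, hLL, hLL, hin, smul_zero, add_zero,
        smul_eq_mul] at k7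
      exact (mul_eq_zero.1 k7).resolve_left h3
    have t1 := htan (1, 0)
    have t2 := htan (0, 1)
    have hm2 : mu u = -R (S.point u) 2 := by rw [hmu, ← h2]
    rw [← map_smul]
    conv_lhs => rw [← hLR (S.point u)]
    congr 1
    simp [dotProduct, Fin.sum_univ_four, graphPlane] at hin t1 t2
    ext i
    fin_cases i
    · simp [graphPoint, hm2]; linarith
    · simp [graphPoint, hm2]; linarith
    · simp [graphPoint, hm2]
    · simp [graphPoint, hm2]; linear_combination hin - (χ u).1 * t1 - (χ u).2 * t2
  -- At `s` the point is a multiple of the third basis vector, so the gradient of f vanishes at the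
  -- origin.
  have hR0 : mu s • graphPoint f 0 = ![0, 0, -m, 0] := by
    have := hpoint.self_of_nhds
    rw [hχ0, ← map_smul] at this
    rw [← hR, this, hRL]
  have hmu1 := hmune.self_of_nhds
  have hfx : px f 0 = 0 := by
    have := congrFun hR0 0
    simpa [graphPoint, hmu1] using this
  have hfy : py f 0 = 0 := by
    have := congrFun hR0 1
    simpa [graphPoint, hmu1] using this
  refine ⟨χ, ξ, f, fun u => C u 3, mu, L, L', hχ1, hχ2, by simp only [hf, hξ0, hZ0], hfx, hfy, _,
    hl.and ((hχs.continuous.continuousAt.eventually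
      (by rw [hχ0]; exact hr.eventually_nhds)).and (hC3.and (hmune.and (hplane.and hpoint)))),
    fun T hT hTV hp hpl => ?_⟩
  exact ⟨hchart, hT, fun u hu => (hTV hu).1, fun u hu => (hTV hu).2.1, hfs, hCi 3, hmus,
    fun u hu => (hTV hu).2.2.1, fun u hu => (hTV hu).2.2.2.1, hLL,
    fun u hu => by rw [hpl]; exact (hTV hu).2.2.2.2.1,
    fun u hu => by rw [hp]; exact (hTV hu).2.2.2.2.2⟩

end Front

/-! ### Rescaling of the coordinates -/

theorem px_py_comp_scale {f : ℝ × ℝ → ℝ} (hf : ContDiff ℝ ∞ f) (θ c : ℝ) :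
    px (fun p => θ * f (p.1, c * p.2)) = (fun p => θ * px f (p.1, c * p.2)) ∧
    py (fun p => θ * f (p.1, c * p.2)) = fun p => θ * c * py f (p.1, c * p.2) := by
  have key : ∀ p v : ℝ × ℝ, fderiv ℝ (fun p : ℝ × ℝ => θ * f (p.1, c * p.2)) p v =
      θ * fderiv ℝ f (p.1, c * p.2) (v.1, c * v.2) := fun p v => by
    have h1 : HasFDerivAt (fun p : ℝ × ℝ => (p.1, c * p.2))
        ((ContinuousLinearMap.fst ℝ ℝ ℝ).prod (c • ContinuousLinearMap.snd ℝ ℝ ℝ)) p :=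
      hasFDerivAt_fst.prodMk (hasFDerivAt_snd.const_mul c)
    have h2 := ((hf.differentiable (by simp) (p.1, c * p.2)).hasFDerivAt.comp p h1).const_mul θ
    have h3 := congrArg (fun A : ℝ × ℝ →L[ℝ] ℝ => A v) h2.fderiv
    simpa using h3
  constructor
  · funext p
    rw [px, key]
    simp [px]
  · funext p
    rw [py, key, fderiv_apply_eq_px_py]
    ring

theorem contDiff_comp_scale {f : ℝ × ℝ → ℝ} (hf : ContDiff ℝ ∞ f) (θ c : ℝ) :
    ContDiff ℝ ∞ (fun p : ℝ × ℝ => θ * f (p.1, c * p.2)) :=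
  contDiff_const.mul (hf.comp (contDiff_fst.prodMk (contDiff_const.mul contDiff_snd)))

/-- A nondegenerate jet of a graph at a godron becomes a normal jet after rescaling. -/
theorem IsGodronJet.comp_scale {f : ℝ × ℝ → ℝ} (hf : ContDiff ℝ ∞ f) (h0 : f 0 = 0)
    (hx : px f 0 = 0) (hy : py f 0 = 0) (hxx : px (px f) 0 = 0) (hxy : px (py f) 0 = 0)
    (hyy : py (py f) 0 ≠ 0) (hxxx : px (px (px f)) 0 = 0) (hxxy : px (px (py f)) 0 ≠ 0) :
    IsGodronJet (fun p => 4 * py (py f) 0 / px (px (py f)) 0 ^ 2 *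
        f (p.1, -(px (px (py f)) 0 / (2 * py (py f) 0)) * p.2))
      (py (py f) 0 * px (px (px (px f))) 0 / (3 * px (px (py f)) 0 ^ 2)) := by
  set a := py (py f) 0
  set b := px (px (py f)) 0
  have s1 := px_py_comp_scale hf
  have s2 := px_py_comp_scale hf.px
  have s3 := px_py_comp_scale hf.py
  have s4 := px_py_comp_scale hf.px.px
  have s5 := px_py_comp_scale hf.py.px
  have s6 := px_py_comp_scale hf.px.px.px
  have hz : ((0 : ℝ), (0 : ℝ)) = 0 := rfl
  -- Replacing f by θf(x, cy), the conditions θc²a = 1 and θcb = -2 determine c = -b/(2a) and θ =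
  -- 4a/b². The invariant is then θ f_xxxx / 12.
  constructor <;> simp only [(s1 _ _).1, (s1 _ _).2, (s2 _ _).1, (s3 _ _).1, (s3 _ _).2,
    (s4 _ _).1, (s5 _ _).1, (s6 _ _).1, Prod.fst_zero, Prod.snd_zero, mul_zero, hz, h0, hx, hy,
    hxx, hxy, hxxx]
  · change 4 * a / b ^ 2 * -(b / (2 * a)) * -(b / (2 * a)) * a = 1
    field_simp
    norm_num
  · change 4 * a / b ^ 2 * -(b / (2 * a)) * b = -2
    field_simp
    norm_num
  · field_simp
    ring

def diagonalMap (d : Fin 4 → ℝ) : (Fin 4 → ℝ) →L[ℝ] (Fin 4 → ℝ) :=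
  ContinuousLinearMap.pi fun i => d i • ContinuousLinearMap.proj i

theorem diagonalMap_apply (d p : Fin 4 → ℝ) (i : Fin 4) : diagonalMap d p i = d i * p i := rfl

/-- A rescaling of the graph is a diagonal projective transformation. The inverse factors act on
points, which keeps the pairing. -/
theorem Front.IsDualGraph.comp_scale {T : Front} {s : ℝ × ℝ} {χ ξ : ℝ × ℝ → ℝ × ℝ}
    {f lam mu : ℝ × ℝ → ℝ} {L L' : (Fin 4 → ℝ) →L[ℝ] (Fin 4 → ℝ)}
    (h : T.IsDualGraph s χ ξ f lam mu L L') {θ c : ℝ} (hθ : θ ≠ 0) (hc : c ≠ 0) :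
    T.IsDualGraph s (fun u => ((χ u).1, c⁻¹ * (χ u).2)) (fun p => ξ (p.1, c * p.2))
      (fun p => θ * f (p.1, c * p.2)) lam (fun u => θ⁻¹ * mu u)
      (L.comp (diagonalMap ![1, c⁻¹, θ, 1])) (L'.comp (diagonalMap ![1, c, θ⁻¹, 1])) := by
  have hsc : ContDiff ℝ ∞ fun p : ℝ × ℝ => (p.1, c * p.2) :=
    contDiff_fst.prodMk (contDiff_const.mul contDiff_snd)
  have hright : ∀ q : ℝ × ℝ, (∀ᶠ p in 𝓝 q, χ (ξ p) = p) → ∀ᶠ p in 𝓝 (q.1, c⁻¹ * q.2),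
      ((χ (ξ (p.1, c * p.2))).1, c⁻¹ * (χ (ξ (p.1, c * p.2))).2) = p := fun q hq => by
    have ht : Tendsto (fun p : ℝ × ℝ => (p.1, c * p.2)) (𝓝 (q.1, c⁻¹ * q.2)) (𝓝 q) :=
      hsc.continuous.tendsto' _ _ (by simp [hc])
    filter_upwards [ht.eventually hq] with p hp
    rw [hp]
    simp [hc]
  have hg : ∀ u, ((χ u).1, c * (c⁻¹ * (χ u).2)) = χ u := fun u => by simp [hc]
  obtain ⟨hpx, hpy⟩ := px_py_comp_scale h.contDiff θ c
  refine ⟨⟨?_, h.chart.contDiff_inv.comp hsc, by simp [h.chart.map_base], ?_, ?_, ?_⟩, h.mem,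
    fun u hu => by simp only [hg, h.left_inv u hu], fun u hu => hright _ (h.right_inv u hu),
    contDiff_comp_scale h.contDiff θ c, h.contDiff_lam, contDiff_const.mul h.contDiff_mu,
    h.lam_ne, fun u hu => mul_ne_zero (inv_ne_zero hθ) (h.mu_ne u hu), fun p q => ?_,
    fun u hu => ?_, fun u hu => ?_⟩
  · exact h.chart.contDiff.fst.prodMk (contDiff_const.mul h.chart.contDiff.snd)
  · have := h.chart.inv_zero
    simp only [Prod.zero_eq_mk] at this
    simpa using this
  · filter_upwards [h.chart.left_inv] with u hu
    simp only [hg, hu]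
  · have := hright 0 h.chart.right_inv
    simpa only [Prod.fst_zero, Prod.snd_zero, mul_zero, Prod.mk_zero_zero] using this
  · simp only [ContinuousLinearMap.comp_apply]
    rw [h.pairing]
    simp [dotProduct, Fin.sum_univ_four, diagonalMap_apply]
    field_simp
  · rw [h.plane_eq u hu, ContinuousLinearMap.comp_apply]
    congr 2
    ext i
    fin_cases i <;> simp [diagonalMap_apply, graphPlane, hc, hθ]
  · have key : diagonalMap ![1, c⁻¹, θ, 1] (graphPoint (fun p => θ * f (p.1, c * p.2))
        ((χ u).1, c⁻¹ * (χ u).2)) = θ • graphPoint f (χ u) := by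
      have e1 := congrFun hpx ((χ u).1, c⁻¹ * (χ u).2)
      have e2 := congrFun hpy ((χ u).1, c⁻¹ * (χ u).2)
      simp only [hg] at e1 e2
      ext i
      fin_cases i
      · simp [diagonalMap_apply, graphPoint, e1]
      · simp [diagonalMap_apply, graphPoint, e2]; field_simp
      · simp [diagonalMap_apply, graphPoint]
      · simp [diagonalMap_apply, graphPoint, e1, e2, hg]; field_simp
    rw [h.point_eq u hu, ContinuousLinearMap.comp_apply, key, map_smul, smul_smul]
    congr 1
    field_simp

/-! ### The jet of the dual of a swallowtail -/

theorem contDiff_standardSwallowtail : ContDiff ℝ ∞ standardSwallowtail := by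
  rw [contDiff_pi]
  intro i
  fin_cases i <;> simp [standardSwallowtail] <;> fun_prop

/-- The derivative of the standard swallowtail in t is (-12t² - 2a)(0, 1, -t). It vanishes to second
order along a = 0, so the low-order jet of any function of it involves only two directional
derivatives. -/
theorem partials_comp_standardSwallowtail {φ : (Fin 3 → ℝ) → ℝ} (hφ : ContDiff ℝ ∞ φ) :
    let E : ℝ × ℝ → ℝ := fun q => φ (standardSwallowtail q)
    ContDiff ℝ ∞ E ∧ px E 0 = 0 ∧ py E 0 = fderiv ℝ φ 0 ![1, 0, 0] ∧ px (px E) 0 = 0 ∧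
      py (px E) 0 = -2 * fderiv ℝ φ 0 ![0, 1, 0] ∧
      px (px (px E)) 0 = -24 * fderiv ℝ φ 0 ![0, 1, 0] := by
  intro E
  have hE : ContDiff ℝ ∞ E := hφ.comp contDiff_standardSwallowtail
  have hs0 : standardSwallowtail 0 = 0 := by
    ext i
    fin_cases i <;> simp [standardSwallowtail]
  set b : ℝ × ℝ → ℝ := fun q => fderiv ℝ φ (standardSwallowtail q) ![0, 1, 0] with hb
  set c : ℝ × ℝ → ℝ := fun q => fderiv ℝ φ (standardSwallowtail q) ![0, 0, 1] with hc
  have hdφ : ContDiff ℝ ∞ fun q => fderiv ℝ φ (standardSwallowtail q) :=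
    (hφ.fderiv_right (by simp)).comp contDiff_standardSwallowtail
  have hbs : ContDiff ℝ ∞ b := hdφ.clm_apply contDiff_const
  have hcs : ContDiff ℝ ∞ c := hdφ.clm_apply contDiff_const
  have hd : ∀ (γ : ℝ → ℝ × ℝ) (v : ℝ × ℝ) (w : Fin 3 → ℝ) (r : ℝ), HasDerivAt γ v r →
      HasDerivAt (fun r => standardSwallowtail (γ r)) w r →
      fderiv ℝ E (γ r) v = fderiv ℝ φ (standardSwallowtail (γ r)) w := fun γ v w r h1 h2 =>
    ((hE.differentiable (by simp) _).hasFDerivAt.comp_hasDerivAt r h1).unique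
      ((hφ.differentiable (by simp) _).hasFDerivAt.comp_hasDerivAt r h2)
  have hx : px E = fun q => (-12 * q.1 ^ 2 - 2 * q.2) * b q +
      (12 * q.1 ^ 3 + 2 * q.1 * q.2) * c q := by
    funext q
    have h1 : HasDerivAt (fun r : ℝ => (r, q.2)) ((1 : ℝ), (0 : ℝ)) q.1 :=
      (hasDerivAt_id' _).prodMk (hasDerivAt_const _ _)
    have h2 : HasDerivAt (fun r : ℝ => standardSwallowtail (r, q.2))
        ![0, -12 * q.1 ^ 2 - 2 * q.2, 12 * q.1 ^ 3 + 2 * q.1 * q.2] q.1 := by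
      rw [hasDerivAt_pi]
      intro i
      fin_cases i
      · simpa [standardSwallowtail] using hasDerivAt_const q.1 q.2
      · have := ((hasDerivAt_pow 3 q.1).const_mul (-4)).sub
          ((hasDerivAt_id' q.1).const_mul (2 * q.2))
        simp [standardSwallowtail]
        simp at this
        exact this.congr_deriv (by ring)
      · have := ((hasDerivAt_pow 4 q.1).const_mul 3).add
          ((hasDerivAt_pow 2 q.1).const_mul q.2)
        simp [standardSwallowtail]
        exact this.congr_deriv (by push_cast; ring)
    rw [px, hd _ _ _ _ h1 h2]
    have : ![0, -12 * q.1 ^ 2 - 2 * q.2, 12 * q.1 ^ 3 + 2 * q.1 * q.2] =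
        (-12 * q.1 ^ 2 - 2 * q.2) • ![0, 1, 0] + (12 * q.1 ^ 3 + 2 * q.1 * q.2) • ![0, 0, 1] := by
      ext i
      fin_cases i <;> simp
    rw [this, map_add, map_smul, map_smul]
    rfl
  have hy : py E 0 = fderiv ℝ φ 0 ![1, 0, 0] := by
    have h1 : HasDerivAt (fun r : ℝ => ((0 : ℝ), r)) ((0 : ℝ), (1 : ℝ)) 0 :=
      (hasDerivAt_const _ _).prodMk (hasDerivAt_id' _)
    have h2 : HasDerivAt (fun r : ℝ => standardSwallowtail (0, r)) ![1, 0, 0] 0 := by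
      rw [hasDerivAt_pi]
      intro i
      fin_cases i
      · simpa [standardSwallowtail] using hasDerivAt_id' (0 : ℝ)
      · simpa [standardSwallowtail] using hasDerivAt_const (0 : ℝ) (0 : ℝ)
      · simpa [standardSwallowtail] using hasDerivAt_const (0 : ℝ) (0 : ℝ)
    have h3 := hd _ _ _ _ h1 h2
    have hz : ((0 : ℝ), (0 : ℝ)) = 0 := rfl
    rwa [hz, hs0] at h3
  have hax : ContDiff ℝ ∞ fun t : ℝ => (t, (0 : ℝ)) := contDiff_id.prodMk contDiff_const
  -- On a = 0 the factor t² is explicit, so the next two derivatives in t are read off directly.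
  have hxa : (fun t => px E (t, 0)) = fun t => t ^ 2 * (-12 * b (t, 0) + 12 * t * c (t, 0)) := by
    funext t
    rw [hx]
    ring
  have hm : ContDiff ℝ ∞ fun t : ℝ => -12 * b (t, 0) + 12 * t * c (t, 0) :=
    (contDiff_const.mul (hbs.comp hax)).add ((contDiff_const.mul contDiff_id).mul (hcs.comp hax))
  have hb0 : b 0 = fderiv ℝ φ 0 ![0, 1, 0] := by simp only [hb, hs0]
  have hz : ((0 : ℝ), (0 : ℝ)) = 0 := rfl
  have i1 := deriv_comp_axis hE.px
  have i2 := deriv_comp_axis hE.px.px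
  refine ⟨hE, by simp [hx], hy, ?_, ?_, ?_⟩
  · have := congrFun i1 0
    rw [hxa, deriv_fun_mul (by fun_prop) (hm.differentiable (by simp) 0)] at this
    simp [hz] at this
    exact this.symm
  · have h1 : ContDiff ℝ ∞ fun r : ℝ => b (0, r) :=
      hbs.comp (contDiff_const.prodMk contDiff_id)
    have h2 := hasDerivAt_curve_pair hE.px (a := fun _ => 0) (b := fun r => r) contDiff_const
      contDiff_id 0
    have h3 : (fun r : ℝ => px E (0, r)) = fun r => -2 * r * b (0, r) := by
      funext r
      rw [hx]
      ring
    rw [h3] at h2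
    have h4 := ((hasDerivAt_id' (0 : ℝ)).const_mul (-2)).fun_mul (h1.hasDerivAt' 0)
    have h5 := h2.unique h4
    simp [hz, hb0] at h5
    linarith
  · have h1 := iteratedDeriv_pow_mul_zero 2 hm
    rw [← hxa] at h1
    simp only [iteratedDeriv_succ, iteratedDeriv_zero] at h1
    rw [i1, i2] at h1
    simp [hz, hb0] at h1
    linarith

theorem Filter.EventuallyEq.px {f g : ℝ × ℝ → ℝ} {p : ℝ × ℝ} (h : f =ᶠ[𝓝 p] g) :
    px f =ᶠ[𝓝 p] px g := h.fderiv.mono fun q hq => by rw [_root_.px, _root_.px, hq]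

theorem Filter.EventuallyEq.py {f g : ℝ × ℝ → ℝ} {p : ℝ × ℝ} (h : f =ᶠ[𝓝 p] g) :
    py f =ᶠ[𝓝 p] py g := h.fderiv.mono fun q hq => by rw [_root_.py, _root_.py, hq]

theorem fderiv_comp_pair {U x y : ℝ × ℝ → ℝ} (hU : ContDiff ℝ ∞ U) (hx : ContDiff ℝ ∞ x)
    (hy : ContDiff ℝ ∞ y) (q v : ℝ × ℝ) : fderiv ℝ (fun q => U (x q, y q)) q v =
      px U (x q, y q) * fderiv ℝ x q v + py U (x q, y q) * fderiv ℝ y q v := by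
  have h1 := (hU.differentiable (by simp) (x q, y q)).hasFDerivAt.comp q
    ((hx.differentiable (by simp) q).hasFDerivAt.prodMk (hy.differentiable (by simp) q).hasFDerivAt)
  have h2 := congrArg (fun A : ℝ × ℝ →L[ℝ] ℝ => A v) h1.fderiv
  simp only [ContinuousLinearMap.comp_apply] at h2
  exact h2.trans (fderiv_apply_eq_px_py _ _ _)

theorem px_comp_pair {U x y : ℝ × ℝ → ℝ} (hU : ContDiff ℝ ∞ U) (hx : ContDiff ℝ ∞ x)
    (hy : ContDiff ℝ ∞ y) : px (fun q => U (x q, y q)) =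
      fun q => px U (x q, y q) * px x q + py U (x q, y q) * px y q :=
  funext fun q => fderiv_comp_pair hU hx hy q (1, 0)

theorem py_comp_pair {U x y : ℝ × ℝ → ℝ} (hU : ContDiff ℝ ∞ U) (hx : ContDiff ℝ ∞ x)
    (hy : ContDiff ℝ ∞ y) : py (fun q => U (x q, y q)) =
      fun q => px U (x q, y q) * py x q + py U (x q, y q) * py y q :=
  funext fun q => fderiv_comp_pair hU hx hy q (0, 1)

/-- The jet of a function that factors through the standard swallowtail. -/
theorem jet_of_comp_eq {U x y : ℝ × ℝ → ℝ} {φ : (Fin 3 → ℝ) → ℝ} (hU : ContDiff ℝ ∞ U)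
    (hx : ContDiff ℝ ∞ x) (hy : ContDiff ℝ ∞ y) (hφ : ContDiff ℝ ∞ φ) (x0 : x 0 = 0) (y0 : y 0 = 0)
    (hxt : px x 0 = 1) (hxa : py x 0 = 0) (hyt : px y 0 = 0) (hya : py y 0 = 1)
    (h : ∀ᶠ q in 𝓝 0, U (x q, y q) = φ (standardSwallowtail q)) :
    px U 0 = 0 ∧ py U 0 = fderiv ℝ φ 0 ![1, 0, 0] ∧
      px (px U) 0 + py U 0 * px (px y) 0 = 0 ∧
      px (py U) 0 + py U 0 * py (px y) 0 = -2 * fderiv ℝ φ 0 ![0, 1, 0] ∧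
      px (px (px U)) 0 + 3 * px (px U) 0 * px (px x) 0 + 3 * px (py U) 0 * px (px y) 0 +
        py U 0 * px (px (px y)) 0 = -24 * fderiv ℝ φ 0 ![0, 1, 0] := by
  obtain ⟨hE, e1, e2, e3, e4, e5⟩ := partials_comp_standardSwallowtail hφ
  have hz : ((0 : ℝ), (0 : ℝ)) = 0 := rfl
  have hxy : ContDiff ℝ ∞ fun q => (x q, y q) := hx.prodMk hy
  have hUx : ContDiff ℝ ∞ fun q => px U (x q, y q) := hU.px.comp hxy
  have hUy : ContDiff ℝ ∞ fun q => py U (x q, y q) := hU.py.comp hxy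
  have hG : ContDiff ℝ ∞ fun q => U (x q, y q) := hU.comp hxy
  have h' : (fun q => U (x q, y q)) =ᶠ[𝓝 0] fun q => φ (standardSwallowtail q) := h
  have k1 : px U 0 = 0 := by
    have := h'.px.self_of_nhds
    rw [px_comp_pair hU hx hy, e1] at this
    simpa [x0, y0, hz, hxt, hyt] using this
  have k2 : py U 0 = fderiv ℝ φ 0 ![1, 0, 0] := by
    have := h'.py.self_of_nhds
    rw [py_comp_pair hU hx hy, e2] at this
    simpa [x0, y0, hz, hxa, hya] using this
  refine ⟨k1, k2, ?_, ?_, ?_⟩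
  · have := h'.px.px.self_of_nhds
    rw [px_comp_pair hU hx hy, e3, px_add (hUx.mul hx.px) (hUy.mul hy.px), px_mul hUx hx.px,
      px_mul hUy hy.px, px_comp_pair hU.px hx hy, px_comp_pair hU.py hx hy] at this
    simpa [x0, y0, hz, hxt, hyt, k1] using this
  · have := h'.px.py.self_of_nhds
    rw [px_comp_pair hU hx hy, e4, py_add (hUx.mul hx.px) (hUy.mul hy.px), py_mul hUx hx.px,
      py_mul hUy hy.px, py_comp_pair hU.px hx hy, py_comp_pair hU.py hx hy] at this
    simpa [x0, y0, hz, hxt, hyt, hxa, hya, k1, py_px hU] using this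
  -- The third derivative is computed along the axis a = 0 as that of a function on a curve, which
  -- avoids expanding three nested product rules.
  · have hax : ContDiff ℝ ∞ fun t : ℝ => (t, (0 : ℝ)) := contDiff_id.prodMk contDiff_const
    have h1 := h'.px.px.px.self_of_nhds
    rw [e5, ← hz, ← congrFun (deriv_comp_axis hG.px.px) 0, ← deriv_comp_axis hG.px,
      ← deriv_comp_axis hG,
      deriv_deriv_deriv_curve (a := fun t => x (t, 0)) (b := fun t => y (t, 0)) hU (hx.comp hax)
        (hy.comp hax), deriv_comp_axis hx, deriv_comp_axis hy, deriv_comp_axis hx.px,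
      deriv_comp_axis hy.px, deriv_comp_axis hy.px.px] at h1
    simp [x0, y0, hz, hxt, hyt, k1] at h1
    linarith

/-- The jet of a graph whose dual is a swallowtail. -/
theorem jet_of_swallowtail {f x y : ℝ × ℝ → ℝ} {φ₀ φ₁ φ₂ : (Fin 3 → ℝ) → ℝ} (hf : ContDiff ℝ ∞ f)
    (hx : ContDiff ℝ ∞ x) (hy : ContDiff ℝ ∞ y) (hφ₀ : ContDiff ℝ ∞ φ₀) (hφ₁ : ContDiff ℝ ∞ φ₁)
    (hφ₂ : ContDiff ℝ ∞ φ₂) (x0 : x 0 = 0) (y0 : y 0 = 0)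
    (hxt : px x 0 = 1) (hxa : py x 0 = 0) (hyt : px y 0 = 0) (hya : py y 0 = 1)
    (hinj : ∀ w, fderiv ℝ φ₀ 0 w = 0 → fderiv ℝ φ₁ 0 w = 0 → fderiv ℝ φ₂ 0 w = 0 → w = 0)
    (h : ∀ᶠ q in 𝓝 0, graphPoint f (x q, y q) = ![φ₀ (standardSwallowtail q),
      φ₁ (standardSwallowtail q), -1, φ₂ (standardSwallowtail q)]) :
    px (px f) 0 = 0 ∧ px (py f) 0 = 0 ∧ py (py f) 0 ≠ 0 ∧ px (px (px f)) 0 = 0 ∧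
      px (px (py f)) 0 ≠ 0 ∧ py (py f) 0 * px (px (px (px f))) 0 - 3 * px (px (py f)) 0 ^ 2 =
        12 * px (px (py f)) 0 * py (py f) 0 := by
  have h1 : ContDiff ℝ ∞ fun p : ℝ × ℝ => p.1 := contDiff_fst
  have h2 : ContDiff ℝ ∞ fun p : ℝ × ℝ => p.2 := contDiff_snd
  have x1 : px (fun p : ℝ × ℝ => p.1) = fun _ => 1 := funext fun p => by
    rw [px, fderiv_fst]; rfl
  have x2 : px (fun p : ℝ × ℝ => p.2) = fun _ => 0 := funext fun p => by
    rw [px, fderiv_snd]; rfl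
  have y1 : py (fun p : ℝ × ℝ => p.1) = fun _ => 0 := funext fun p => by
    rw [py, fderiv_fst]; rfl
  have y2 : py (fun p : ℝ × ℝ => p.2) = fun _ => 1 := funext fun p => by
    rw [py, fderiv_snd]; rfl
  set W : ℝ × ℝ → ℝ := fun p => f p - p.1 * px f p - p.2 * py f p with hW
  have hWs : ContDiff ℝ ∞ W := (hf.sub (h1.mul hf.px)).sub (h2.mul hf.py)
  have hWy : py W = fun p => -(p.1 * px (py f) p + p.2 * py (py f) p) := by
    rw [hW, py_sub (hf.sub (h1.mul hf.px)) (h2.mul hf.py), py_sub hf (h1.mul hf.px),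
      py_mul h1 hf.px, py_mul h2 hf.py, y1, y2, py_px hf]
    funext p
    ring
  have hWxy : px (py W) 0 = -px (py f) 0 := by
    have h3 : px (fun p => p.1 * px (py f) p + p.2 * py (py f) p) 0 = px (py f) 0 := by
      rw [px_add (h1.mul hf.py.px) (h2.mul hf.py.py), px_mul h1 hf.py.px, px_mul h2 hf.py.py, x1, x2]
      simp
    rw [hWy, ← h3]
    simp only [px, fderiv_fun_neg]
    rfl
  obtain ⟨a1, a2, a3, a4, a5⟩ := jet_of_comp_eq hf.px hx hy hφ₀ x0 y0 hxt hxa hyt hya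
    (h.mono fun q hq => congrFun hq 0)
  obtain ⟨b1, b2, b3, b4, b5⟩ := jet_of_comp_eq hf.py hx hy hφ₁ x0 y0 hxt hxa hyt hya
    (h.mono fun q hq => congrFun hq 1)
  obtain ⟨c1, c2, c3, c4, c5⟩ := jet_of_comp_eq hWs hx hy hφ₂ x0 y0 hxt hxa hyt hya
    (h.mono fun q hq => congrFun hq 3)
  rw [py_px hf] at a2 a3 a4 a5
  rw [b1] at a2 a3 a4 a5
  have hWy0 : py W 0 = 0 := by simp [hWy]
  rw [hWxy, hWy0, b1] at c4
  rw [hWy0] at c2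
  -- If f_yy vanished, the derivative along the first axis of the ambient space would be zero in all
  -- three affine coordinates, contrary to immersivity.
  have hA : py (py f) 0 ≠ 0 := fun hA => by
    rw [hA] at b2
    have := congrFun (hinj ![1, 0, 0] a2.symm b2.symm c2.symm) 0
    simp at this
  -- Otherwise the first two axes would both be mapped into the second coordinate line, and the
  -- displayed combination of them would be killed.
  have hB : fderiv ℝ φ₀ 0 ![0, 1, 0] ≠ 0 := fun hB => by
    have hv : ![fderiv ℝ φ₁ 0 ![0, 1, 0], -py (py f) 0, 0] =
        fderiv ℝ φ₁ 0 ![0, 1, 0] • ![1, 0, 0] + (-py (py f) 0) • ![0, 1, 0] := by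
      ext i
      fin_cases i <;> simp
    have hw := hinj ![fderiv ℝ φ₁ 0 ![0, 1, 0], -py (py f) 0, 0]
      (by rw [hv, map_add, map_smul, map_smul, hB, ← a2]; simp)
      (by rw [hv, map_add, map_smul, map_smul, ← b2]; simp [mul_comm])
      (by
        have : fderiv ℝ φ₂ 0 ![0, 1, 0] = 0 := by linarith
        rw [hv, map_add, map_smul, map_smul, ← c2, this]; simp)
    have := congrFun hw 1
    simp [hA] at this
  have a3' : px (px (px f)) 0 = 0 := by linarith
  have a4' : px (px (py f)) 0 = -2 * fderiv ℝ φ₀ 0 ![0, 1, 0] := by linarith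
  refine ⟨a1, b1, hA, a3', fun h0 => hB (by linarith), ?_⟩
  rw [a3'] at a5
  -- With y_tt = -b/a from `b3`, the third-order identity reads f_xxxx - 3b²/a = 12b.
  linear_combination py (py f) 0 * a5 - 12 * py (py f) 0 * a4' - 3 * px (px (py f)) 0 * b3

theorem ContDiff.exists_local_inverse_of_injective {E : Type*} [NormedAddCommGroup E]
    [NormedSpace ℝ E] [FiniteDimensional ℝ E] {f : E → E} (hf : ContDiff ℝ ∞ f) (a : E)
    (hinj : ∀ v, fderiv ℝ f a v = 0 → v = 0) :
    ∃ g : E → E, ContDiff ℝ ∞ g ∧ g (f a) = a ∧ (∀ᶠ x in 𝓝 a, g (f x) = x) ∧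
      ∀ᶠ y in 𝓝 (f a), f (g y) = y := by
  have h : Function.Injective (fderiv ℝ f a : E →ₗ[ℝ] E) :=
    (injective_iff_map_eq_zero _).2 hinj
  exact hf.exists_local_inverse a (LinearEquiv.ofInjectiveEndo _ h).toContinuousLinearEquiv
    (by ext; rfl)

theorem SmoothNear.exists_isChartAt {h : ℝ × ℝ → ℝ × ℝ} {s : ℝ × ℝ} (hs : SmoothNear h s)
    (h0 : h s = 0) (hinj : ∀ v, fderiv ℝ h s v = 0 → v = 0) :
    ∃ h' k : ℝ × ℝ → ℝ × ℝ, h' =ᶠ[𝓝 s] h ∧ IsChartAt h' k s := by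
  obtain ⟨h', hh, he⟩ := hs.exists_contDiff
  obtain ⟨k, hk, h1, h2, h3⟩ := hh.exists_local_inverse_of_injective s (by rwa [he.fderiv_eq])
  have h4 : h' s = 0 := he.self_of_nhds.trans h0
  rw [h4] at h1 h3
  exact ⟨h', k, he, hh, hk, h4, h1, h2, h3⟩

theorem IsChartAt.fderiv_inv_injective {h k : ℝ × ℝ → ℝ × ℝ} {s v : ℝ × ℝ} (hc : IsChartAt h k s)
    (hv : fderiv ℝ k 0 v = 0) : v = 0 := by
  have h1 : HasFDerivAt (fun p => h (k p)) ((fderiv ℝ h (k 0)).comp (fderiv ℝ k 0)) 0 :=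
    (hc.contDiff.differentiable (by simp) (k 0)).hasFDerivAt.comp 0
      (hc.contDiff_inv.differentiable (by simp) 0).hasFDerivAt
  have h2 : HasFDerivAt (fun p => h (k p)) (ContinuousLinearMap.id ℝ (ℝ × ℝ)) 0 :=
    (hasFDerivAt_id _).congr_of_eventuallyEq hc.right_inv
  have h3 := congrArg (fun A : ℝ × ℝ →L[ℝ] ℝ × ℝ => A v) (h1.unique h2)
  simpa [hv] using h3.symm

theorem standardSwallowtail_zero : standardSwallowtail 0 = 0 := by
  ext i
  fin_cases i <;> simp [standardSwallowtail]

/-- The affine equations of a swallowtail in the coordinates adapted to the dual graph. -/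
theorem Front.IsDualGraph.exists_swallowtail_coordinates {T : Front} {s : ℝ × ℝ}
    {χ ξ h k : ℝ × ℝ → ℝ × ℝ} {f lam mu : ℝ × ℝ → ℝ} {L L' : (Fin 4 → ℝ) →L[ℝ] (Fin 4 → ℝ)}
    (hG : T.IsDualGraph s χ ξ f lam mu L L') (hc : IsChartAt h k s)
    {Ψ : (Fin 3 → ℝ) → Fin 4 → ℝ} (hΨ : SmoothNear Ψ 0)
    (hinj : ∀ w, (∃ a : ℝ, fderiv ℝ Ψ 0 w = a • Ψ 0) → w = 0)
    (hproj : ∀ᶠ u in 𝓝 s, ProjEq (T.point u) (Ψ (standardSwallowtail (h u)))) :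
    ∃ φ₀ φ₁ φ₂ : (Fin 3 → ℝ) → ℝ, ContDiff ℝ ∞ φ₀ ∧ ContDiff ℝ ∞ φ₁ ∧ ContDiff ℝ ∞ φ₂ ∧
      (∀ w, fderiv ℝ φ₀ 0 w = 0 → fderiv ℝ φ₁ 0 w = 0 → fderiv ℝ φ₂ 0 w = 0 → w = 0) ∧
      ∀ᶠ u in 𝓝 s, graphPoint f (χ u) = ![φ₀ (standardSwallowtail (h u)),
        φ₁ (standardSwallowtail (h u)), -1, φ₂ (standardSwallowtail (h u))] := by
  obtain ⟨Φ, hΦ, hΦe⟩ := hΨ.exists_contDiff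
  have hsw : Tendsto (fun u => standardSwallowtail (h u)) (𝓝 s) (𝓝 0) :=
    (contDiff_standardSwallowtail.continuous.tendsto' 0 0 standardSwallowtail_zero).comp hc.tendsto
  -- By the pairing, the images under `L'` of the basis covectors are the coordinate functions of
  -- the frame `L`.
  set r : Fin 4 → (Fin 4 → ℝ) →L[ℝ] ℝ := fun i =>
    ∑ j, L' (Pi.single i 1) j • ContinuousLinearMap.proj j with hr
  have hrq : ∀ i q, r i q = L' (Pi.single i 1) ⬝ᵥ q := fun i q => by
    simp [hr, dotProduct]
  have hrL : ∀ i q, r i (L q) = q i := fun i q => by rw [hrq, hG.pairing, single_one_dotProduct]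
  have hr0 : ∀ q, (∀ i, r i q = 0) → q = 0 := fun q hq => by
    have hLinj : Function.Injective (L : (Fin 4 → ℝ) →ₗ[ℝ] Fin 4 → ℝ) := hG.L_injective
    obtain ⟨p, rfl⟩ := LinearMap.injective_iff_surjective.1 hLinj q
    have : p = 0 := funext fun i => (hrL i p).symm.trans (hq i)
    rw [this, map_zero]
  set g : Fin 4 → (Fin 3 → ℝ) → ℝ := fun i w => r i (Φ w) with hg
  have hgs : ∀ i, ContDiff ℝ ∞ (g i) := fun i => (r i).contDiff.comp hΦ
  have hev : ∀ᶠ u in 𝓝 s, ∃ c : ℝ, c ≠ 0 ∧ ∀ i, g i (standardSwallowtail (h u)) =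
      c * graphPoint f (χ u) i := by
    filter_upwards [hproj, hsw.eventually hΦe, T.eventually_mem_dom hG.mem] with u ⟨c, hc, h1⟩ h2 h3
    refine ⟨c * mu u, mul_ne_zero hc (hG.mu_ne u h3), fun i => ?_⟩
    simp only [hg]
    rw [h2, h1, hG.point_eq u h3, map_smul, map_smul, hrL, smul_eq_mul, smul_eq_mul, mul_assoc]
  have hg2 : ∀ u c, (∀ i, g i (standardSwallowtail (h u)) = c * graphPoint f (χ u) i) →
      g 2 (standardSwallowtail (h u)) = -c := fun u c h => by rw [h 2]; simp [graphPoint]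
  have hg20 : g 2 0 ≠ 0 := by
    obtain ⟨c, hc0, h1⟩ := hev.self_of_nhds
    have := hg2 s c h1
    rw [hc.map_base, standardSwallowtail_zero] at this
    rw [this]
    exact neg_ne_zero.2 hc0
  have hg2n : ∀ᶠ w in 𝓝 0, g 2 w ≠ 0 := (hgs 2).continuous.continuousAt.eventually_ne hg20
  -- Affine coordinates normalized so that the third homogeneous coordinate is -1, as for the
  -- tangent plane of a graph.
  have hdiv : ∀ i, SmoothNear (fun w => -(g i w / g 2 w)) 0 := fun i => by
    filter_upwards [hg2n] with w hw
    exact ((hgs i).contDiffAt.div (hgs 2).contDiffAt hw).neg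
  have hder : ∀ (φ : (Fin 3 → ℝ) → ℝ) (i : Fin 4), ContDiff ℝ ∞ φ →
      φ =ᶠ[𝓝 0] (fun w => -(g i w / g 2 w)) → ∀ w, fderiv ℝ φ 0 w = 0 →
      r i (fderiv ℝ Φ 0 w - (fderiv ℝ (g 2) 0 w / g 2 0) • Φ 0) = 0 := fun φ i hφ he w hw => by
    have h1 : HasFDerivAt (fun w => φ w * g 2 w) _ 0 :=
      (hφ.differentiable (by simp) 0).hasFDerivAt.mul
        ((hgs 2).differentiable (by simp) 0).hasFDerivAt
    have h2 : HasFDerivAt (fun w => -g i w) (-(r i).comp (fderiv ℝ Φ 0)) 0 :=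
      ((r i).hasFDerivAt.comp 0 (hΦ.differentiable (by simp) 0).hasFDerivAt).fun_neg
    have h3 := congrArg (fun A : (Fin 3 → ℝ) →L[ℝ] ℝ => A w) (h1.unique
      (h2.congr_of_eventuallyEq (by
        filter_upwards [he, hg2n] with w h4 h5
        rw [h4]
        field_simp)))
    simp [hw, he.self_of_nhds] at h3
    rw [map_sub, map_smul, smul_eq_mul, ← h3]
    change _ - _ * g i 0 = 0
    field_simp
    ring
  obtain ⟨φ₀, hφ₀, he₀⟩ := (hdiv 0).exists_contDiff
  obtain ⟨φ₁, hφ₁, he₁⟩ := (hdiv 1).exists_contDiff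
  obtain ⟨φ₂, hφ₂, he₂⟩ := (hdiv 3).exists_contDiff
  refine ⟨φ₀, φ₁, φ₂, hφ₀, hφ₁, hφ₂, fun w w0 w1 w2 => ?_, ?_⟩
  · refine hinj w ⟨fderiv ℝ (g 2) 0 w / g 2 0, ?_⟩
    rw [← hΦe.fderiv_eq, ← hΦe.self_of_nhds, ← sub_eq_zero]
    refine hr0 _ fun i => ?_
    fin_cases i
    · exact hder φ₀ 0 hφ₀ he₀ w w0
    · exact hder φ₁ 1 hφ₁ he₁ w w1
    · change r 2 _ = 0
      have : r 2 (fderiv ℝ Φ 0 w) = fderiv ℝ (g 2) 0 w := by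
        have h1 := ((r 2).hasFDerivAt.comp 0 (hΦ.differentiable (by simp) 0).hasFDerivAt).fderiv
        exact (congrArg (fun A : (Fin 3 → ℝ) →L[ℝ] ℝ => A w) h1).symm
      rw [map_sub, map_smul, this, smul_eq_mul]
      change _ - _ * g 2 0 = 0
      field_simp
      ring
    · exact hder φ₂ 3 hφ₂ he₂ w w2
  · filter_upwards [hev, hsw.eventually he₀, hsw.eventually he₁, hsw.eventually he₂]
      with u ⟨c, hc, h1⟩ h2 h3 h4
    rw [h2, h3, h4, hg2 u c h1, h1, h1, h1]
    ext i
    fin_cases i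
    · simp; field_simp
    · simp; field_simp
    · simp [graphPoint]
    · simp; field_simp

/-- Normal form of a front and of its dual near a generic swallowtail. -/
theorem Front.IsGenericSwallowtail.exists_normal_form {S : Front} {s : ℝ × ℝ}
    (hS : S.IsGenericSwallowtail s) : ∃ (χ ξ h k : ℝ × ℝ → ℝ × ℝ) (f lam mu : ℝ × ℝ → ℝ)
      (L L' : (Fin 4 → ℝ) →L[ℝ] (Fin 4 → ℝ)) (ρ : ℝ), ρ ≠ 1 ∧ IsGodronJet f ρ ∧
      ∃ V ∈ 𝓝 s, ∀ T : Front, s ∈ T.dom → T.dom ⊆ V → T.point = S.point → T.plane = S.plane →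
        T.IsDualGraph s χ ξ f lam mu L L' ∧ T.IsSwallowtailChart s h k := by
  obtain ⟨⟨hs, h₀, Ψ, hh₀, h₀s, h₀inj, hΨ, -, hΨinj, hproj₀⟩, hreg⟩ := hS
  obtain ⟨h, k, hhe, hc⟩ := hh₀.exists_isChartAt h₀s h₀inj
  have hproj : ∀ᶠ u in 𝓝 s, ProjEq (S.point u) (Ψ (standardSwallowtail (h u))) := by
    filter_upwards [hproj₀, hhe] with u h1 h2
    rwa [h2]
  -- The tangent frame is the image of the standard one under the inverse swallowtail chart. The
  -- transition between the two charts then has identity differential at 0, as the computation of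
  -- the jet requires.
  obtain ⟨χ, ξ, f, lam, mu, L, L', hχ1, hχ2, f0, fx, fy, V, hV, hT⟩ :=
    S.exists_isDualGraph (e₁ := fderiv ℝ k 0 (1, 0)) (e₂ := fderiv ℝ k 0 (0, 1)) hreg
    (fun a b hab => by
      rw [← map_smul, ← map_smul, ← map_add] at hab
      have := hc.fderiv_inv_injective hab
      simpa using this)
  have hG := hT (S.restrict (interior V) isOpen_interior)
    ⟨hs, mem_interior_iff_mem_nhds.2 hV⟩ (fun u hu => interior_subset hu.2) rfl rfl
  obtain ⟨φ₀, φ₁, φ₂, hφ₀, hφ₁, hφ₂, hinj, hgp⟩ :=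
    hG.exists_swallowtail_coordinates hc hΨ hΨinj hproj
  have hf := hG.contDiff
  have hκ : ContDiff ℝ ∞ fun q => χ (k q) := hG.chart.contDiff.comp hc.contDiff_inv
  have hκd : ∀ v, fderiv ℝ (fun q => χ (k q)) 0 v = fderiv ℝ χ s (fderiv ℝ k 0 v) := fun v => by
    have h1 := ((hG.chart.contDiff.differentiable (by simp) (k 0)).hasFDerivAt.comp 0
      (hc.contDiff_inv.differentiable (by simp) 0).hasFDerivAt).fderiv
    rw [hc.inv_zero] at h1
    exact congrArg (fun A : ℝ × ℝ →L[ℝ] ℝ × ℝ => A v) h1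
  have hfst : ∀ v, fderiv ℝ (fun q => (χ (k q)).1) 0 v = (fderiv ℝ χ s (fderiv ℝ k 0 v)).1 :=
    fun v => by
      rw [← hκd, (hκ.differentiable (by simp) 0).hasFDerivAt.fst.fderiv]; rfl
  have hsnd : ∀ v, fderiv ℝ (fun q => (χ (k q)).2) 0 v = (fderiv ℝ χ s (fderiv ℝ k 0 v)).2 :=
    fun v => by
      rw [← hκd, (hκ.differentiable (by simp) 0).hasFDerivAt.snd.fderiv]; rfl
  obtain ⟨j1, j2, j3, j4, j5, j6⟩ := jet_of_swallowtail hf hκ.fst hκ.snd hφ₀ hφ₁ hφ₂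
    (by simp [hc.inv_zero, hG.chart.map_base]) (by simp [hc.inv_zero, hG.chart.map_base])
    (by rw [px, hfst, hχ1]) (by rw [py, hfst, hχ2]) (by rw [px, hsnd, hχ1])
    (by rw [py, hsnd, hχ2]) hinj (by
      filter_upwards [hc.tendsto_inv.eventually hgp, hc.right_inv] with q h1 h2
      rw [h2] at h1
      exact h1)
  have hjet := IsGodronJet.comp_scale hf f0 fx fy j1 j2 j3 j4 j5
  set a := py (py f) 0
  set b := px (px (py f)) 0
  have hθ : 4 * a / b ^ 2 ≠ 0 := div_ne_zero (mul_ne_zero (by norm_num) j3) (pow_ne_zero 2 j5)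
  have hη : -(b / (2 * a)) ≠ 0 := neg_ne_zero.2 (div_ne_zero j5 (mul_ne_zero two_ne_zero j3))
  set Φ : (Fin 3 → ℝ) → Fin 3 → ℝ := fun w => ![φ₀ w, φ₁ w, φ₂ w] with hΦ
  have hΦs : ContDiff ℝ ∞ Φ := by
    rw [contDiff_pi]
    intro i
    fin_cases i <;> simpa [hΦ]
  -- The affine coordinates form a local diffeomorphism of three-space. Its local inverse shows that
  -- points of the front coincide only when the corresponding points of the standard swallowtail do.
  obtain ⟨G, -, -, hGl, -⟩ := hΦs.exists_local_inverse_of_injective 0 (fun w hw => by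
    have h1 := hasFDerivAt_pi'.1 (hΦs.differentiable (by simp) 0).hasFDerivAt
    have h2 : ∀ i, fderiv ℝ (fun w => Φ w i) 0 w = 0 := fun i => by
      rw [(h1 i).fderiv, ContinuousLinearMap.comp_apply, hw]; rfl
    exact hinj w (h2 0) (h2 1) (h2 2))
  have hsw : Tendsto (fun u => standardSwallowtail (h u)) (𝓝 s) (𝓝 0) :=
    (contDiff_standardSwallowtail.continuous.tendsto' 0 0 standardSwallowtail_zero).comp hc.tendsto
  set η := -(b / (2 * a)) with hηd
  set θ := 4 * a / b ^ 2 with hθd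
  refine ⟨fun u => ((χ u).1, η⁻¹ * (χ u).2), fun p => ξ (p.1, η * p.2), h, k,
    fun p => θ * f (p.1, η * p.2), lam, fun u => θ⁻¹ * mu u, L.comp (diagonalMap ![1, η⁻¹, θ, 1]),
    L'.comp (diagonalMap ![1, η, θ⁻¹, 1]), _, ?_, hjet, _,
    (show ∀ᶠ u in 𝓝 s, _ from hV).and (hgp.and ((hsw.eventually hGl).and hc.left_inv)),
    fun T hsT hTV hp hpl => ?_⟩
  -- The value ρ = 1 would mean a f_xxxx = 3b², and the swallowtail relation would give 12ab = 0.
  · intro h1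
    rw [div_eq_one_iff_eq (mul_ne_zero (by norm_num) (pow_ne_zero 2 j5))] at h1
    have : 12 * b * a = 0 := by rw [← j6, h1]; ring
    exact mul_ne_zero (mul_ne_zero (by norm_num) j5) j3 this
  · have hGT := hT T hsT (fun u hu => (hTV hu).1) hp hpl
    refine ⟨hGT.comp_scale hθ hη, hc, hsT, fun u hu => (hTV hu).2.2.2, fun u hu w hw => ?_⟩
    have hu2 := (hTV hu).2.1
    have hw2 := (hTV hw).2.1
    constructor
    · intro hpr
      have h1 := hGT.graphPoint_eq_of_projEq hu hw hpr
      rw [hu2, hw2] at h1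
      have h2 : Φ (standardSwallowtail (h u)) = Φ (standardSwallowtail (h w)) := by
        have i0 := congrFun h1 0
        have i1 := congrFun h1 1
        have i2 := congrFun h1 3
        simp at i0 i1 i2
        simp only [hΦ, i0, i1, i2]
      have hu3 := (hTV hu).2.2.1
      have hw3 := (hTV hw).2.2.1
      rw [← hu3, h2, hw3]
    · intro he
      rw [← he, ← hu2] at hw2
      refine ⟨mu w / mu u, div_ne_zero (hGT.mu_ne w hw) (hGT.mu_ne u hu), ?_⟩
      rw [hGT.point_eq u hu, hGT.point_eq w hw, hw2, smul_smul,
        div_mul_cancel₀ _ (hGT.mu_ne u hu)]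

/-! ### The front dual to a graph -/

theorem hasFDerivAt_line_comp {E : Type*} [NormedAddCommGroup E] [NormedSpace ℝ E]
    {g : ℝ × ℝ → E} (hg : ContDiff ℝ ∞ g) (u v : ℝ × ℝ) :
    HasDerivAt (fun t : ℝ => g (u + t • v)) (fderiv ℝ g u v) 0 := by
  refine HasFDerivAt.comp_hasDerivAt (0 : ℝ) ?_ (Front.hasDerivAt_line u v)
  simpa using (hg.differentiable (by simp) u).hasFDerivAt

noncomputable def graphFront (f : ℝ × ℝ → ℝ) (hf : ContDiff ℝ ∞ f) : Front where
  dom := Set.univ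
  point := graphPoint f
  plane := graphPlane f
  isOpen_dom := isOpen_univ
  smooth_point := (contDiff_graphPoint hf).contDiffOn
  smooth_plane := (contDiff_graphPlane hf).contDiffOn
  point_ne := fun u _ h => by simpa [graphPoint] using congrFun h 2
  plane_ne := fun u _ h => by simpa [graphPlane] using congrFun h 3
  incident := fun u _ => by
    simp [graphPlane, graphPoint, dotProduct, Fin.sum_univ_four]
    ring
  legendrian := fun u _ v => by
    rw [(hasFDerivAt_line_comp (contDiff_graphPoint hf) u v).unique
      (hasDerivAt_graphPoint hf (Front.hasDerivAt_line u v))]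
    simp [graphPlane, dotProduct, Fin.sum_univ_four]
  immersed := fun u _ v _ ⟨b, hb⟩ => by
    rw [(hasFDerivAt_line_comp (contDiff_graphPlane hf) u v).unique
      (hasDerivAt_graphPlane hf (Front.hasDerivAt_line u v))] at hb
    have h3 := congrFun hb 3
    have h0 := congrFun hb 0
    have h1 := congrFun hb 1
    simp [graphPlane] at h3 h0 h1
    rw [← h3] at h0 h1
    exact Prod.ext (by simpa using h0) (by simpa using h1)

theorem graphFront_isDualGraph {f : ℝ × ℝ → ℝ} (hf : ContDiff ℝ ∞ f) :
    (graphFront f hf).IsDualGraph 0 id id f (fun _ => 1) (fun _ => 1)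
      (ContinuousLinearMap.id ℝ _) (ContinuousLinearMap.id ℝ _) where
  chart := ⟨contDiff_id, contDiff_id, rfl, rfl, Eventually.of_forall fun _ => rfl,
    Eventually.of_forall fun _ => rfl⟩
  mem := Set.mem_univ _
  left_inv := fun _ _ => rfl
  right_inv := fun _ _ => Eventually.of_forall fun _ => rfl
  contDiff := hf
  contDiff_lam := contDiff_const
  contDiff_mu := contDiff_const
  lam_ne := fun _ _ => one_ne_zero
  mu_ne := fun _ _ => one_ne_zero
  pairing := fun _ _ => rfl
  plane_eq := fun u _ => by rw [one_smul]; rfl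
  point_eq := fun u _ => by rw [one_smul]; rfl

/-! ### A swallowtail with a given invariant -/

/-- The graph with a godron of invariant `r` at the origin. -/
noncomputable def godronModel (r : ℝ) (p : ℝ × ℝ) : ℝ :=
  p.2 ^ 2 / 2 - p.1 ^ 2 * p.2 + r * p.1 ^ 4 / 2

theorem contDiff_godronModel (r : ℝ) : ContDiff ℝ ∞ (godronModel r) := by
  unfold godronModel; fun_prop

theorem px_eq_of_hasDerivAt {f d : ℝ × ℝ → ℝ} (hf : ContDiff ℝ ∞ f)
    (h : ∀ x y, HasDerivAt (fun t => f (t, y)) (d (x, y)) x) : px f = d := by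
  funext ⟨x, y⟩
  have h1 := hasDerivAt_curve_pair hf (a := fun t => t) (b := fun _ => y) contDiff_id
    contDiff_const x
  simpa using h1.unique (h x y)

theorem py_eq_of_hasDerivAt {f d : ℝ × ℝ → ℝ} (hf : ContDiff ℝ ∞ f)
    (h : ∀ x y, HasDerivAt (fun t => f (x, t)) (d (x, y)) y) : py f = d := by
  funext ⟨x, y⟩
  have h1 := hasDerivAt_curve_pair hf (a := fun _ => x) (b := fun t => t) contDiff_const
    contDiff_id y
  simpa using h1.unique (h x y)

theorem px_godronModel (r : ℝ) :
    px (godronModel r) = fun p => -2 * p.1 * p.2 + 2 * r * p.1 ^ 3 := by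
  refine px_eq_of_hasDerivAt (contDiff_godronModel r) fun x y => ?_
  have := ((hasDerivAt_const x (y ^ 2 / 2)).fun_sub ((hasDerivAt_pow 2 x).mul_const y)).fun_add
    (((hasDerivAt_pow 4 x).const_mul r).div_const 2)
  exact this.congr_deriv (by push_cast; ring)

theorem py_godronModel (r : ℝ) : py (godronModel r) = fun p => p.2 - p.1 ^ 2 := by
  refine py_eq_of_hasDerivAt (contDiff_godronModel r) fun x y => ?_
  have := (((hasDerivAt_pow 2 y).div_const 2).fun_sub
    ((hasDerivAt_id' y).const_mul (x ^ 2))).fun_add (hasDerivAt_const y (r * x ^ 4 / 2))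
  exact this.congr_deriv (by push_cast; ring)

theorem graphPoint_godronModel (r : ℝ) (p : ℝ × ℝ) : graphPoint (godronModel r) p =
    ![-2 * p.1 * p.2 + 2 * r * p.1 ^ 3, p.2 - p.1 ^ 2, -1,
      -p.2 ^ 2 / 2 + 2 * p.1 ^ 2 * p.2 - 3 / 2 * r * p.1 ^ 4] := by
  rw [graphPoint, px_godronModel, py_godronModel, godronModel]
  congr 4
  ring

theorem isGodronJet_godronModel (r : ℝ) : IsGodronJet (godronModel r) r := by
  have e1 : px (fun p : ℝ × ℝ => -2 * p.1 * p.2 + 2 * r * p.1 ^ 3) =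
      fun p => -2 * p.2 + 6 * r * p.1 ^ 2 := px_eq_of_hasDerivAt (by fun_prop) fun x y =>
    ((((hasDerivAt_id' x).const_mul (-2)).mul_const y).fun_add
      ((hasDerivAt_pow 3 x).const_mul (2 * r))).congr_deriv (by push_cast; ring)
  have e2 : px (fun p : ℝ × ℝ => p.2 - p.1 ^ 2) = fun p => -2 * p.1 :=
    px_eq_of_hasDerivAt (by fun_prop) fun x y =>
    ((hasDerivAt_const x y).fun_sub (hasDerivAt_pow 2 x)).congr_deriv (by push_cast; ring)
  have e3 : py (fun p : ℝ × ℝ => p.2 - p.1 ^ 2) = fun p => 1 :=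
    py_eq_of_hasDerivAt (by fun_prop) fun x y =>
    ((hasDerivAt_id' y).fun_sub (hasDerivAt_const y (x ^ 2))).congr_deriv (by ring)
  have e4 : px (fun p : ℝ × ℝ => -2 * p.2 + 6 * r * p.1 ^ 2) = fun p => 12 * r * p.1 :=
    px_eq_of_hasDerivAt (by fun_prop) fun x y =>
    ((hasDerivAt_const x (-2 * y)).fun_add ((hasDerivAt_pow 2 x).const_mul (6 * r))).congr_deriv
      (by push_cast; ring)
  have e5 : px (fun p : ℝ × ℝ => -2 * p.1) = fun p => -2 :=
    px_eq_of_hasDerivAt (by fun_prop) fun x y =>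
    ((hasDerivAt_id' x).const_mul (-2)).congr_deriv (by ring)
  have e6 : px (fun p : ℝ × ℝ => 12 * r * p.1) = fun p => 12 * r :=
    px_eq_of_hasDerivAt (by fun_prop) fun x y =>
    ((hasDerivAt_id' x).const_mul (12 * r)).congr_deriv (by ring)
  refine ⟨by simp [godronModel], ?_, ?_, ?_, ?_, ?_, ?_, ?_, ?_⟩ <;>
    simp only [px_godronModel, py_godronModel, e1, e2, e3, e4, e5, e6] <;> simp

/-- The chart in which the front dual to `godronModel r` is the standard swallowtail. -/
noncomputable def modelChart (r : ℝ) (p : ℝ × ℝ) : ℝ × ℝ :=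
  (p.1, -2 * (p.2 - p.1 ^ 2) / (r - 1))

noncomputable def modelMap (r : ℝ) (w : Fin 3 → ℝ) : Fin 4 → ℝ :=
  ![-(r - 1) / 2 * w 1, -(r - 1) / 2 * w 0, -1, -((r - 1) * w 2 + (-(r - 1) / 2 * w 0) ^ 2) / 2]

/-- With t = x and y = x² - (r - 1)a/2, the first two affine coordinates are multiples of the second
and first swallowtail coordinates. The last is -((r - 1)c + f_y²)/2, which explains the quadratic
correction in `modelMap`. -/
theorem graphPoint_eq_modelMap {r : ℝ} (hr : r ≠ 1) (p : ℝ × ℝ) :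
    graphPoint (godronModel r) p = modelMap r (standardSwallowtail (modelChart r p)) := by
  have h : r - 1 ≠ 0 := sub_ne_zero.2 hr
  rw [graphPoint_godronModel]
  ext i
  fin_cases i
  · simp [modelMap, modelChart, standardSwallowtail]; field_simp; ring
  · simp [modelMap, modelChart, standardSwallowtail]; field_simp; ring
  · simp [modelMap]
  · simp [modelMap, modelChart, standardSwallowtail]; field_simp; ring

theorem modelMap_injective {r : ℝ} (hr : r ≠ 1) : Function.Injective (modelMap r) := by
  have h : r - 1 ≠ 0 := sub_ne_zero.2 hr
  have h' : 1 - r ≠ 0 := sub_ne_zero.2 hr.symm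
  intro v w hvw
  have h0 := congrFun hvw 0
  have h1 := congrFun hvw 1
  have h3 := congrFun hvw 3
  simp [modelMap, h'] at h0 h1 h3
  rw [h1] at h3
  have h2 : (r - 1) * v 2 = (r - 1) * w 2 := by linarith
  ext i
  fin_cases i
  exacts [h1, h0, mul_left_cancel₀ h h2]

theorem graphFront_isSwallowtailChart {r : ℝ} (hr : r ≠ 1) :
    (graphFront _ (contDiff_godronModel r)).IsSwallowtailChart 0 (modelChart r)
      (fun q => (q.1, q.1 ^ 2 - (r - 1) * q.2 / 2)) := by
  have h : r - 1 ≠ 0 := sub_ne_zero.2 hr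
  have hl : ∀ u : ℝ × ℝ, ((modelChart r u).1,
      (modelChart r u).1 ^ 2 - (r - 1) * (modelChart r u).2 / 2) = u := fun u => by
    ext
    · rfl
    · simp only [modelChart]; field_simp; ring
  refine ⟨⟨?_, ?_, ?_, ?_, Eventually.of_forall hl, Eventually.of_forall fun p => ?_⟩,
    Set.mem_univ _, fun u _ => hl u, fun u _ w _ => ?_⟩
  · unfold modelChart; fun_prop
  · fun_prop
  · simp [modelChart]
  · simp
  · ext
    · rfl
    · simp only [modelChart]; field_simp; ring
  · change ProjEq (graphPoint _ u) (graphPoint _ w) ↔ _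
    rw [graphPoint_eq_modelMap hr, graphPoint_eq_modelMap hr]
    constructor
    · rintro ⟨c, -, hc⟩
      have h2 := congrFun hc 2
      simp [modelMap] at h2
      rw [← h2, one_smul] at hc
      exact (modelMap_injective hr hc).symm
    · intro he
      exact ⟨1, one_ne_zero, by rw [he, one_smul]⟩

theorem graphFront_isGenericSwallowtail {r : ℝ} (hr : r ≠ 1) :
    (graphFront _ (contDiff_godronModel r)).IsGenericSwallowtail 0 := by
  have h : r - 1 ≠ 0 := sub_ne_zero.2 hr
  have h' : 1 - r ≠ 0 := sub_ne_zero.2 hr.symm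
  have hc := (graphFront_isSwallowtailChart hr).chart
  have hG := graphFront_isDualGraph (contDiff_godronModel r)
  have hs : ContDiff ℝ ∞ (modelMap r) := by
    refine contDiff_vec4 ?_ ?_ contDiff_const ?_ <;> fun_prop
  refine ⟨⟨Set.mem_univ _, modelChart r, modelMap r, hc.contDiff.smoothNear 0, hc.map_base,
    fun v hv => hc.fderiv_injective hc.left_inv hv, hs.smoothNear 0, fun h0 => ?_, ?_,
    Eventually.of_forall fun u => ⟨1, one_ne_zero, ?_⟩⟩, hG.dual_isRegular (Set.mem_univ _)⟩
  · simpa [modelMap] using congrFun h0 2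
  · rintro w ⟨a, ha⟩
    have h1 : HasDerivAt (fun t : ℝ => t • w) w 0 := by
      simpa using (hasDerivAt_id (0 : ℝ)).smul_const w
    have h2 : HasDerivAt (fun t : ℝ => modelMap r (t • w)) (fderiv ℝ (modelMap r) 0 w) 0 := by
      have h0 : HasFDerivAt (modelMap r) (fderiv ℝ (modelMap r) 0) ((0 : ℝ) • w) := by
        rw [zero_smul]
        exact (hs.differentiable (by simp) 0).hasFDerivAt
      exact h0.comp_hasDerivAt (0 : ℝ) h1
    have hlin : ∀ i, HasDerivAt (fun t : ℝ => t * w i) (w i) 0 := fun i => by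
      simpa using (hasDerivAt_id (0 : ℝ)).mul_const (w i)
    -- The quadratic correction has zero derivative at the origin, so the affine differential is a
    -- permuted diagonal matrix with entries nonzero for r ≠ 1.
    have h3 : HasDerivAt (fun t : ℝ => modelMap r (t • w))
        ![-(r - 1) / 2 * w 1, -(r - 1) / 2 * w 0, 0, -((r - 1) * w 2) / 2] 0 := by
      refine hasDerivAt_vec4 ((hlin 1).const_mul _) ((hlin 0).const_mul _) (hasDerivAt_const _ _)
        (((((hlin 2).const_mul (r - 1)).add
          (((hlin 0).const_mul (-(r - 1) / 2)).pow 2)).neg.div_const 2).congr_deriv ?_)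
      simp
    rw [h2.unique h3] at ha
    have a2 := congrFun ha 2
    have a0 := congrFun ha 0
    have a1 := congrFun ha 1
    have a3 := congrFun ha 3
    simp [modelMap] at a2
    simp [modelMap, a2, h, h'] at a0 a1 a3
    ext i
    fin_cases i
    exacts [a1, a0, a3]
  · rw [one_smul]
    exact (graphPoint_eq_modelMap hr u).symm

/-! ### The theorem on swallowtails. -/

theorem theorem17 :
    (∀ (S : Front) (s : ℝ × ℝ), S.IsGenericSwallowtail s →
      ∃ ρ : ℝ, ρ ≠ 1 ∧ ∃ V₀ ∈ 𝓝 s, ∀ (V : Set (ℝ × ℝ)) (hV : IsOpen V), s ∈ V → V ⊆ V₀ →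
        ∀ T : Front, T = S.restrict V hV →
          -- `ρ` is the cr-invariant of the swallowtail, i.e. of the godron of the dual surface
          (∀ r : ℝ, T.dual.HasCrInvariant s r ↔ r = ρ) ∧
          (T.IsEllipticSwallowtail s ↔ 1 < ρ) ∧
          (T.IsHyperbolicSwallowtail s ↔ ρ < 1) ∧
          -- the local contour is trivial exactly at elliptic swallowtails
          (T.ContourTrivial s ↔ T.IsEllipticSwallowtail s) ∧
          -- the cuspidal edge and the flecnodal curve
          ∃ σ φ : ℝ → ℝ × ℝ,
            ParametrizesAt σ T.cuspidalEdge s ∧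
            ParametrizesAt φ T.flecnodalCurve s ∧
            T.IsSemicubicCusp σ ∧
            (ρ ≠ -1 / 2 → T.IsCusp φ) ∧
            (ρ ≠ -1 / 2 → ρ ≠ 0 → T.IsSemicubicCusp φ) ∧
            (-1 / 2 < ρ → T.SameDirection φ σ) ∧
            (ρ < -1 / 2 → T.OppositeDirection φ σ) ∧
            (1 < ρ → OrderedAt s ![T.selfIntersection, T.cuspidalEdge, T.flecnodalCurve]) ∧
            -- hyperbolic swallowtails: the contour is the union of the cusps `Tm`, `Tp`
            (T.IsHyperbolicSwallowtail s →
              ∃ (τm τp : ℝ → ℝ × ℝ) (Tm Tp : Set (ℝ × ℝ)),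
                ParametrizesAt τm Tm s ∧ ParametrizesAt τp Tp s ∧
                (∀ᶠ u in 𝓝 s, u ∈ T.contour s ↔ u ∈ Tm ∪ Tp) ∧
                T.IsCusp τm ∧ (ρ ≠ 0 → T.IsSemicubicCusp τm) ∧ T.IsSemicubicCusp τp ∧
                T.OppositeDirection τp τm ∧ T.SameDirection τm σ ∧
                (ρ ∈ Set.Ioo (8 / 9) 1 →
                  (∀ᶠ u in 𝓝 s, u ∈ Tm → u ≠ s → T.IsElliptic u) ∧
                  OrderedAt s
                    ![Tm, T.cuspidalEdge, T.flecnodalCurve, T.selfIntersection, Tp]) ∧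
                (ρ ∈ Set.Ioo (√3 / 2) (8 / 9) →
                  OrderedAt s
                    ![T.cuspidalEdge, Tm, T.flecnodalCurve, T.selfIntersection, Tp]) ∧
                (ρ ∈ Set.Ioo 0 (√3 / 2) →
                  OrderedAt s
                    ![T.cuspidalEdge, T.flecnodalCurve, Tm, T.selfIntersection, Tp]) ∧
                (ρ ∈ Set.Ioo (-1 / 2) 0 →
                  OrderedAt s
                    ![T.cuspidalEdge, T.selfIntersection, Tm, T.flecnodalCurve, Tp]) ∧
                (ρ ∈ Set.Ioo (-√3 / 2) (-1 / 2) →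
                  OrderedAt s
                    ![T.cuspidalEdge, T.selfIntersection, Tm, T.flecnodalCurve, Tp]) ∧
                (ρ ∈ Set.Iio (-√3 / 2) →
                  OrderedAt s
                    ![T.cuspidalEdge, T.selfIntersection, Tm, Tp, T.flecnodalCurve]))) ∧
    -- every value of the invariant other than `1` occurs
    (∀ r : ℝ, r ≠ 1 → ∃ (S : Front) (s : ℝ × ℝ),
      S.IsGenericSwallowtail s ∧ S.dual.HasCrInvariant s r) := by

  refine ⟨fun S s hS => ?_, fun r hr => ?_⟩
  -- The double curve and the conodal curve depend on pairs of parameters. The front is therefore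
  -- cut down to a neighbourhood on which both charts are injective, and any smaller one serves as
  -- well.
  · obtain ⟨χ, ξ, h, k, f, lam, mu, L, L', ρ, hρ, hj, V₀, hV₀, hT⟩ := hS.exists_normal_form
    refine ⟨ρ, hρ, V₀, hV₀, fun V hV hsV hVV T hTV => ?_⟩
    subst hTV
    obtain ⟨hG, hC⟩ := hT (S.restrict V hV) ⟨hS.1.1, hsV⟩ (fun u hu => hVV hu.2) rfl rfl
    obtain ⟨σ, φ, h1, h2, h3, h4, h5, h6, h7, h8, h9⟩ := hG.exists_cusps hj hC hρ
    exact ⟨hG.hasCrInvariant_iff hj hC hρ, hG.isEllipticSwallowtail_iff hj hC hρ,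
      hG.isHyperbolicSwallowtail_iff hj hC hρ,
      (hG.contourTrivial_iff hj hρ).trans (hG.isEllipticSwallowtail_iff hj hC hρ).symm,
      σ, φ, h1, h2, h3, h4, h5, h6, h7, h8,
      fun hyp => h9 ((hG.isHyperbolicSwallowtail_iff hj hC hρ).1 hyp)⟩
  · exact ⟨_, 0, graphFront_isGenericSwallowtail hr,
      ((graphFront_isDualGraph (contDiff_godronModel r)).hasCrInvariant_iff
        (isGodronJet_godronModel r) (graphFront_isSwallowtailChart hr) hr r).2 rfl⟩
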